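/- Let $m,n\ge 0$ be integers with $m\le n+1$. Let $q$ be a non-zero complex number that is not a root of unity, fix a square root $q^{1/2}$ of $q$, and write $q^{a/2}=(q^{1/2})^a$ for $a\in\mathbb Z$. Put $(a;q)_k=\prod_{j=0}^{k-1}(1-aq^j)$ for $k\ge 0$, $(a;q)_{-k}=\prod_{j=1}^{k}(1-aq^{-j})^{-1}$ for $k\geq 1$, and $(a_1,\dots,a_s;q)_k=(a_1;q)_k\cdots(a_s;q)_k$. Define $$P_n(x_1,\dots,x_m)=\frac{(-q;q)_n^m}{(q;q)_n^m}\sum_{k_1,\dots,k_m=0}^n\ \prod_{1\le i<j\le m}\frac{q^{k_j}-q^{k_i}}{q^{k_j}+q^{k_i}}\prod_{i=1}^m\frac{(-q,q^{-n};q)_{k_i}}{(q,-q^{-n};q)_{k_i}}x_i^{k_i}.$$ Let $x_1,\dots,x_m$ be non-zero complex numbers. (I) If $n+m$ is odd, let $N=(n+m-1)/2$. Then $\prod_{1\le i<j\le m}(1-x_ix_j)\,P_n(x_1,\dots,x_m)$ is equal to each of the four expressions $$\frac{(-1)^{\binom m2}q^{-\frac12\binom{m+1}3-\frac n2\binom{m+1}2}}{(1-q)^m}\prod_{i=1}^m\frac{(q^{n+1-m+i};q)_i}{(q^{(1-n-m)/2},-q^{(3+n-m)/2};q)_{i-1}}x_i^{N}\sum_{k_1,\dots,k_m=0}^{N}\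 \prod_{i<j}(q^{k_j}-q^{k_i})\prod_{i=1}^m\frac{(q^{(1-n-m)/2},-q^{(3+n-m)/2},qx_i,q/x_i;q)_{k_i}}{(q,q,q^{3/2},-q^{3/2};q)_{k_i}}q^{k_i},$$ $$\frac{q^{-\frac14nm}(-q;q)_{(n+1-m)/2}^m}{(q;q)_{N}^m}\prod_{i=1}^m\frac{(q^{n+1-m+i};q)_{i-1}(q^{3/2};q)_{(n+m+1-2i)/2}}{(-q^{1/2};q)_{(n+m+1-2i)/2}}x_i^{N}\sum_{k_1,\dots,k_m=0}^{N}\ \prod_{i<j}(q^{k_j}-q^{k_i})\prod_{i=1}^m\frac{(q^{(1-n-m)/2},-q^{(3+n-m)/2},q^{1/2}x_i,q^{1/2}/x_i;q)_{k_i}}{(q,q^{1/2},q^{3/2},-q;q)_{k_i}}q^{k_i},$$ $$\frac{q^{-\frac12nm}}{(1-q)^m(q^{3+n-m};q^2)_{m-1}^m}\prod_{i=1}^m(q^{n+1-m+i};q)_m\,x_i^{N}\sum_{k_1,\dots,k_m=0}^{N}\ \prod_{i<j}(q^{2k_j}-q^{2k_i})\prod_{i=1}^m\frac{(q^{1-n-m},q^{3+n-m},qx_i,q/x_i;q^2)_{k_i}}{(q,q^2,q^2,q^3;q^2)_{k_i}}q^{2k_i},$$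 $$\frac{q^{-nm}}{(1-q)^{2m}(q^{3+n-m};q^2)_{m-1}^m}\prod_{i=1}^m(q^{n+1-m+i};q)_i^2\,x_i^{N}\sum_{k_1,\dots,k_m=0}^{N}\ \prod_{i<j}(q^{2k_j}-q^{2k_i})\prod_{i=1}^m\frac{(q^{1-n-m},q^{3+n-m},q^2x_i,q^2/x_i;q^2)_{k_i}}{(q^2,q^2,q^3,q^3;q^2)_{k_i}}q^{2k_i}.$$ (II) If $n+m$ is even, let $M=(n+m-2)/2$ (when $m=0$ there are no variables and every product over $i$ and every multiple sum is read as $1$). Then $\prod_{1\le i<j\le m}(1-x_ix_j)\,P_n(x_1,\dots,x_m)$ is equal to each of the four expressions $$\frac{(-1)^{\binom m2}q^{-\frac12\binom{m+1}3-\frac{n-1}2\binom{m+1}2}}{(1-q)^{2m}}\prod_{i=1}^m\frac{(q^{n+1-m+i};q)_i}{(q^{(2-n-m)/2},-q^{(4+n-m)/2};q)_{i-1}}\prod_{i=1}^m(1-x_i)x_i^{M}\sum_{k_1,\dots,k_m=0}^{M}\ \prod_{i<j}(q^{k_j}-q^{k_i})\prod_{i=1}^m\frac{(q^{(2-n-m)/2},-q^{(4+n-m)/2},qx_i,q/x_i;q)_{k_i}}{(q,q^2,q^{3/2},-q^{3/2};q)_{k_i}}q^{k_i},$$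 $$\frac{q^{-\frac14(n-1)m}(-q;q)_{(n+2-m)/2}^m}{(1-q)^m(q;q)_{M}^m}\prod_{i=1}^m\frac{(q^{n+1-m+i};q)_{i-1}(q^{3/2};q)_{(n+m-2i)/2}}{(-q^{3/2};q)_{(n+m-2i)/2}}\prod_{i=1}^m(1-x_i)x_i^{M}\sum_{k_1,\dots,k_m=0}^{M}\ \prod_{i<j}(q^{k_j}-q^{k_i})\prod_{i=1}^m\frac{(q^{(2-n-m)/2},-q^{(4+n-m)/2},q^{1/2}x_i,q^{1/2}/x_i;q)_{k_i}}{(q,q^{3/2},q^{3/2},-q;q)_{k_i}}q^{k_i},$$ $$\frac{q^{-\frac12(n-1)m}}{(1-q)^{2m}(q^{4+n-m};q^2)_{m-2}^m}\prod_{i=1}^m(q^{n+1-m+i};q)_{i-1}^2\prod_{i=1}^m(1-x_i)x_i^{M}\sum_{k_1,\dots,k_m=0}^{M}\ \prod_{i<j}(q^{2k_j}-q^{2k_i})\prod_{i=1}^m\frac{(q^{2-n-m},q^{4+n-m},qx_i,q/x_i;q^2)_{k_i}}{(q^2,q^2,q^3,q^3;q^2)_{k_i}}q^{2k_i},$$ $$\frac{q^{-(n-1)m}}{(1-q)^{2m}(1-q^2)^m(q^{4+n-m};q^2)_{m-2}^m}\prod_{i=1}^m(q^{n+1-m+i};q)_m\prod_{i=1}^m(1-x_i)x_i^{M}\sum_{k_1,\dots,k_m=0}^{M}\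 \prod_{i<j}(q^{2k_j}-q^{2k_i})\prod_{i=1}^m\frac{(q^{2-n-m},q^{4+n-m},q^2x_i,q^2/x_i;q^2)_{k_i}}{(q^2,q^3,q^3,q^4;q^2)_{k_i}}q^{2k_i}.$$ (III) All eight expressions are regular at $q=1$ in the following sense. Let $\lambda_1,\dots,\lambda_m\in\mathbb C$ with $\lambda_i+\lambda_j\ne0$ for $i<j$ (for instance, the parts of a partition of length $m$), and put $x_i=q^{\lambda_i}$, with principal values of $q^{\lambda_i}$ and $q^{1/2}$ for $q$ near $1$. Then, for $n+m$ odd in the case of (I) and $n+m$ even in the case of (II), each individual term of the multiple sum, multiplied by the factor in front of the sum and divided by $\prod_{1\le i<j\le m}(1-x_ix_j)$, has a finite limit as $q\to1$, $q\neq 1$, in $\mathbb C$. -/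

import Mathlib

noncomputable section

namespace SchurQ

/-- The `q`-shifted factorial `(a;q)_k = (1-a)(1-aq)⋯(1-aq^{k-1})`. -/
def qp (a q : ℂ) (k : ℕ) : ℂ := ∏ j ∈ Finset.range k, (1 - a * q ^ j)

/-- The `q`-shifted factorial with an integer index, with the usual convention
`(a;q)_{-k} = 1 / ((1-aq^{-1})(1-aq^{-2})⋯(1-aq^{-k}))`. -/
def qpInt (a q : ℂ) (k : ℤ) : ℂ :=
  if 0 ≤ k then qp a q k.toNat
  else (∏ j ∈ Finset.range (-k).toNat, (1 - a * q ^ (-((j : ℤ) + 1))))⁻¹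

/-- The compact notation `(a₁,…,a_s;q)_k = (a₁;q)_k ⋯ (a_s;q)_k`. -/
def qps (as : List ℂ) (q : ℂ) (k : ℕ) : ℂ := (as.map fun a => qp a q k).prod

/-- The product of `f i j` over all pairs `i < j`. -/
def pairProd {m : ℕ} (f : Fin m → Fin m → ℂ) : ℂ := ∏ i, ∏ j ∈ Finset.Ioi i, f i j

/-- The polynomial `P_n(x₁,…,x_m)`. -/
def P (n : ℕ) {m : ℕ} (q : ℂ) (x : Fin m → ℂ) : ℂ :=
  qp (-q) q n ^ m / qp q q n ^ m *
    ∑ k : Fin m → Fin (n + 1),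
      pairProd (fun i j =>
          (q ^ (k j : ℕ) - q ^ (k i : ℕ)) / (q ^ (k j : ℕ) + q ^ (k i : ℕ))) *
        ∏ i, qps [-q, q ^ (-(n : ℤ))] q (k i) / qps [q, -q ^ (-(n : ℤ))] q (k i) *
          x i ^ (k i : ℕ)

/-- A multiple series in `m` summation indices, given by the factor in front of the sum
and the summand. -/
structure MultiSeries (m : ℕ) where
  prefactor : ℂ
  summand : (Fin m → ℕ) → ℂ

/-- `prefactor · ∑_{k₁,…,k_m = 0}^N summand(k)`. -/
def MultiSeries.value {m : ℕ} (E : MultiSeries m) (N : ℕ) : ℂ :=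
  E.prefactor * ∑ k : Fin m → Fin (N + 1), E.summand (fun i => k i)

/-- `∏_{i<j} (b^{k_j} - b^{k_i}) ∏_i (num_i;b)_{k_i} / (den;b)_{k_i} b^{k_i}`. -/
def schlosserSummand {m : ℕ} (b : ℂ) (num : Fin m → List ℂ) (den : List ℂ)
    (k : Fin m → ℕ) : ℂ :=
  pairProd (fun i j => b ^ k j - b ^ k i) *
    ∏ i, qps (num i) b (k i) / qps den b (k i) * b ^ k i

/-! In the eight series below `r` is a square root of `q`, and `q^{a/2}` is written `r^a`.
The index `i : Fin m` runs from `0`, so that it stands for `i - 1` in formulas where the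
index runs from `1`. Every integer division by two is exact for the parity of `n + m`
that the series is meant for. -/

/-- First series for `n + m` odd. -/
def oddA (n : ℕ) {m : ℕ} (q r : ℂ) (x : Fin m → ℂ) : MultiSeries m where
  prefactor :=
    (-1) ^ m.choose 2 *
        r ^ (-((m + 1).choose 3 : ℤ) - (n : ℤ) * ((m + 1).choose 2 : ℤ)) / (1 - q) ^ m *
      ∏ i : Fin m,
        qp (q ^ ((n : ℤ) + 1 - m + (i + 1))) q (i + 1) /
            qps [r ^ (1 - (n : ℤ) - m), -r ^ (3 + (n : ℤ) - m)] q i *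
          x i ^ ((n + m - 1) / 2)
  summand := schlosserSummand q
    (fun i => [r ^ (1 - (n : ℤ) - m), -r ^ (3 + (n : ℤ) - m), q * x i, q / x i])
    [q, q, r ^ 3, -r ^ 3]

/-- Second series for `n + m` odd. -/
def oddB (n : ℕ) {m : ℕ} (q r : ℂ) (x : Fin m → ℂ) : MultiSeries m where
  prefactor :=
    r ^ (-((n : ℤ) * m / 2)) * qp (-q) q ((n + 1 - m) / 2) ^ m /
        qp q q ((n + m - 1) / 2) ^ m *
      ∏ i : Fin m,
        qp (q ^ ((n : ℤ) + 1 - m + (i + 1))) q i *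
            qp (r ^ 3) q ((n + m + 1 - 2 * (i + 1)) / 2) /
            qp (-r) q ((n + m + 1 - 2 * (i + 1)) / 2) *
          x i ^ ((n + m - 1) / 2)
  summand := schlosserSummand q
    (fun i => [r ^ (1 - (n : ℤ) - m), -r ^ (3 + (n : ℤ) - m), r * x i, r / x i])
    [q, r, r ^ 3, -q]

/-- Third series for `n + m` odd. -/
def oddC (n : ℕ) {m : ℕ} (q r : ℂ) (x : Fin m → ℂ) : MultiSeries m where
  prefactor :=
    r ^ (-((n : ℤ) * m)) /
        ((1 - q) ^ m * qpInt (q ^ (3 + (n : ℤ) - m)) (q ^ 2) ((m : ℤ) - 1) ^ m) *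
      ∏ i : Fin m,
        qp (q ^ ((n : ℤ) + 1 - m + (i + 1))) q m * x i ^ ((n + m - 1) / 2)
  summand := schlosserSummand (q ^ 2)
    (fun i => [q ^ (1 - (n : ℤ) - m), q ^ (3 + (n : ℤ) - m), q * x i, q / x i])
    [q, q ^ 2, q ^ 2, q ^ 3]

/-- Fourth series for `n + m` odd. -/
def oddD (n : ℕ) {m : ℕ} (q : ℂ) (x : Fin m → ℂ) : MultiSeries m where
  prefactor :=
    q ^ (-((n : ℤ) * m)) /
        ((1 - q) ^ (2 * m) * qpInt (q ^ (3 + (n : ℤ) - m)) (q ^ 2) ((m : ℤ) - 1) ^ m) *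
      ∏ i : Fin m,
        qp (q ^ ((n : ℤ) + 1 - m + (i + 1))) q (i + 1) ^ 2 * x i ^ ((n + m - 1) / 2)
  summand := schlosserSummand (q ^ 2)
    (fun i => [q ^ (1 - (n : ℤ) - m), q ^ (3 + (n : ℤ) - m), q ^ 2 * x i, q ^ 2 / x i])
    [q ^ 2, q ^ 2, q ^ 3, q ^ 3]

/-- First series for `n + m` even. -/
def evenA (n : ℕ) {m : ℕ} (q r : ℂ) (x : Fin m → ℂ) : MultiSeries m where
  prefactor :=
    (-1) ^ m.choose 2 *
        r ^ (-((m + 1).choose 3 : ℤ) - ((n : ℤ) - 1) * ((m + 1).choose 2 : ℤ)) /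
        (1 - q) ^ (2 * m) *
      (∏ i : Fin m,
        qp (q ^ ((n : ℤ) + 1 - m + (i + 1))) q (i + 1) /
            qps [r ^ (2 - (n : ℤ) - m), -r ^ (4 + (n : ℤ) - m)] q i) *
      ∏ i : Fin m, (1 - x i) * x i ^ ((n + m - 2) / 2)
  summand := schlosserSummand q
    (fun i => [r ^ (2 - (n : ℤ) - m), -r ^ (4 + (n : ℤ) - m), q * x i, q / x i])
    [q, q ^ 2, r ^ 3, -r ^ 3]

/-- Second series for `n + m` even. -/
def evenB (n : ℕ) {m : ℕ} (q r : ℂ) (x : Fin m → ℂ) : MultiSeries m where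
  prefactor :=
    r ^ (-(((n : ℤ) - 1) * m / 2)) * qp (-q) q ((n + 2 - m) / 2) ^ m /
        ((1 - q) ^ m * qp q q ((n + m - 2) / 2) ^ m) *
      (∏ i : Fin m,
        qp (q ^ ((n : ℤ) + 1 - m + (i + 1))) q i *
            qp (r ^ 3) q ((n + m - 2 * (i + 1)) / 2) /
            qp (-r ^ 3) q ((n + m - 2 * (i + 1)) / 2)) *
      ∏ i : Fin m, (1 - x i) * x i ^ ((n + m - 2) / 2)
  summand := schlosserSummand q
    (fun i => [r ^ (2 - (n : ℤ) - m), -r ^ (4 + (n : ℤ) - m), r * x i, r / x i])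
    [q, r ^ 3, r ^ 3, -q]

/-- Third series for `n + m` even. -/
def evenC (n : ℕ) {m : ℕ} (q r : ℂ) (x : Fin m → ℂ) : MultiSeries m where
  prefactor :=
    r ^ (-(((n : ℤ) - 1) * m)) /
        ((1 - q) ^ (2 * m) * qpInt (q ^ (4 + (n : ℤ) - m)) (q ^ 2) ((m : ℤ) - 2) ^ m) *
      (∏ i : Fin m, qp (q ^ ((n : ℤ) + 1 - m + (i + 1))) q i ^ 2) *
      ∏ i : Fin m, (1 - x i) * x i ^ ((n + m - 2) / 2)
  summand := schlosserSummand (q ^ 2)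
    (fun i => [q ^ (2 - (n : ℤ) - m), q ^ (4 + (n : ℤ) - m), q * x i, q / x i])
    [q ^ 2, q ^ 2, q ^ 3, q ^ 3]

/-- Fourth series for `n + m` even. -/
def evenD (n : ℕ) {m : ℕ} (q : ℂ) (x : Fin m → ℂ) : MultiSeries m where
  prefactor :=
    q ^ (-(((n : ℤ) - 1) * m)) /
        ((1 - q) ^ (2 * m) * (1 - q ^ 2) ^ m *
          qpInt (q ^ (4 + (n : ℤ) - m)) (q ^ 2) ((m : ℤ) - 2) ^ m) *
      (∏ i : Fin m, qp (q ^ ((n : ℤ) + 1 - m + (i + 1))) q m) *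
      ∏ i : Fin m, (1 - x i) * x i ^ ((n + m - 2) / 2)
  summand := schlosserSummand (q ^ 2)
    (fun i => [q ^ (2 - (n : ℤ) - m), q ^ (4 + (n : ℤ) - m), q ^ 2 * x i, q ^ 2 / x i])
    [q ^ 2, q ^ 3, q ^ 3, q ^ 4]

/-- Regularity at `q = 1` of the expression for `P_n(q^{l₁},…,q^{l_m})` that a series for
`∏_{i<j} (1 - x_i x_j) P_n(x)` gives after division by the product: each individual term of
the sum, with the factor in front included, has a finite limit as `q → 1`.
Here `q^{1/2}` and `q^{l_i}` are principal values. -/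
def RegularAtOne {m : ℕ} (l : Fin m → ℂ) (N : ℕ)
    (E : ℂ → ℂ → (Fin m → ℂ) → MultiSeries m) : Prop :=
  ∀ k : Fin m → ℕ, (∀ i, k i ≤ N) → ∃ L : ℂ,
    Filter.Tendsto
      (fun q : ℂ =>
        (E q (q ^ (1 / 2 : ℂ)) (fun i => q ^ l i)).prefactor *
            (E q (q ^ (1 / 2 : ℂ)) (fun i => q ^ l i)).summand k /
          pairProd (fun i j => 1 - q ^ l i * q ^ l j))
      (nhdsWithin 1 {1}ᶜ) (nhds L)

end SchurQ

end

/-!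
For `n = 0, 1, 2, …` let `f_n` be the Rogers polynomial `∑ a_k a_{n-k} (-x)^k`, with
`a_k = (-q;q)_k / (q;q)_k`. The weights in `P_n` are the coefficients of `f_n` (`P_eq_sum`), so that
`P_n(x) = f_n(x)` for one variable, and everything rests on the three-term recurrence of the `f_n`.

*`P` as a determinant.* The factors `(q^{k_j} - q^{k_i}) / (q^{k_j} + q^{k_i})` form Schur's Pfaffian.
For an even number of variables its expansion (`pairProd_schurFactor_expansion`) makes `P_n` the
Pfaffian of the two-variable polynomials `P_n(x_i, x_j)` (`P_expansion`). In turn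
`(1 - x y) P_n(x, y)` is a `2 × 2` determinant in `f_{n+1}(x)` and `x f_{n-1}(x)`
(`one_sub_mul_rogersTwo`). A determinant with rows `(g, h, g u, h u, …)`, `u = x + 1/x`, has an
expansion of the same shape (`det_pairMatrix_expansion`), so `∏ (1 - x_i x_j) P_n` is such a
determinant. By the recurrence its columns span, up to a power of `x`, the same functions as
`x^s f_{d+2(m-1-s)}(x)`, `0 ≤ s < m`, where `d = n + 1 - m`; this gives proportionality to `rogersDet`. The case of an odd
number of variables and the value of the constant follow on letting one variable tend to zero
(`proportional_of_succ`, `pairProd_mul_P`). The assumption `m ≤ n + 1` is what makes `d ≥ 0`.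

*The series.* For either parity of `n` there are four expansions of `f_n` in terms of
`(a x, a/x; b)_k`, with `(a, b)` one of `(q, q)`, `(q^{1/2}, q)`, `(q, q²)`, `(q², q²)`. They follow
from a common computation, that their coefficients satisfy the recurrence (`rogers_eq_series`). When
they are inserted into `rogersDet`, multilinearity in the rows leaves determinants of the polynomials
`(α X; b)_s (γ X; b)_{m-s}` at `X = b^{k_i}` (up to a shift of `m`), and these are multiples of the
Vandermonde determinant (`det_qp_mul_qp`). This gives the multiple series
(`pairProd_mul_P_eq_series`); the lemmas `prefactor_*` identify the factors in front.

*Regularity at `q = 1`.* A factor `1 - u(q)` with `u(1) = 1` and `u'(1) = c` vanishes at `q = 1` to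
the order one at least, and exactly if `c ≠ 0`. Counting such factors shows that the factor in front
of each sum, and each summand over `∏ (1 - q^{λ_i + λ_j})`, have non-negative order. The condition
`λ_i + λ_j ≠ 0` enters as the exact order one of `1 - q^{λ_i + λ_j}`, which balances the zero of
`b^{k_j} - b^{k_i}` (`orderGE_summand`).
-/

noncomputable section

namespace SchurQ

open Finset

/-! ### Shifted factorials and Rogers polynomials -/

/-- `q` is non-zero and not a root of unity. -/
def NotRootOfUnity (q : ℂ) : Prop := q ≠ 0 ∧ ∀ k : ℕ, 1 ≤ k → q ^ k ≠ 1

namespace NotRootOfUnity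

variable {q : ℂ}

theorem ne_zero (hq : NotRootOfUnity q) : q ≠ 0 := hq.1

theorem zpow_ne_one (hq : NotRootOfUnity q) {k : ℤ} (hk : k ≠ 0) : q ^ k ≠ 1 := by
  obtain ⟨n, rfl | rfl⟩ := k.eq_nat_or_neg
  · rw [zpow_natCast]
    exact hq.2 n (by omega)
  · rw [zpow_neg, zpow_natCast, Ne, inv_eq_one]
    exact hq.2 n (by omega)

theorem one_sub_pow_ne (hq : NotRootOfUnity q) {k : ℕ} (hk : k ≠ 0) : 1 - q ^ k ≠ 0 :=
  fun h => hq.2 k (by omega) (sub_eq_zero.mp h).symm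

theorem one_add_zpow_ne (hq : NotRootOfUnity q) (k : ℤ) : 1 + q ^ k ≠ 0 := by
  intro h
  have h1 : q ^ k = -1 := by linear_combination h
  rcases eq_or_ne k 0 with rfl | hk
  · norm_num at h1
  · apply hq.zpow_ne_one (k := k * 2) (by omega)
    rw [zpow_mul, h1]
    norm_num

theorem one_add_pow_ne (hq : NotRootOfUnity q) (k : ℕ) : 1 + q ^ k ≠ 0 := by
  simpa using hq.one_add_zpow_ne k

theorem pow_add_pow_ne (hq : NotRootOfUnity q) (k l : ℕ) : q ^ k + q ^ l ≠ 0 := by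
  have h := mul_ne_zero (pow_ne_zero k hq.ne_zero) (hq.one_add_zpow_ne ((l : ℤ) - k))
  rwa [mul_add, mul_one, zpow_sub₀ hq.ne_zero, zpow_natCast, zpow_natCast,
    mul_div_cancel₀ _ (pow_ne_zero k hq.ne_zero)] at h

end NotRootOfUnity

theorem qp_zero (a q : ℂ) : qp a q 0 = 1 := by simp [qp]

theorem qp_succ (a q : ℂ) (k : ℕ) : qp a q (k + 1) = qp a q k * (1 - a * q ^ k) := by
  simp [qp, prod_range_succ]

theorem qp_succ' (a q : ℂ) (k : ℕ) : qp a q (k + 1) = (1 - a) * qp (a * q) q k := by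
  simp only [qp, prod_range_succ', pow_zero, mul_one, mul_comm (1 - a)]
  congr 1
  exact prod_congr rfl fun j _ => by ring

theorem qp_ne_zero {a q : ℂ} {k : ℕ} (h : ∀ j < k, a * q ^ j ≠ 1) : qp a q k ≠ 0 :=
  prod_ne_zero_iff.mpr fun j hj => fun h0 => h j (mem_range.mp hj) (sub_eq_zero.mp h0).symm

theorem qp_self_ne_zero {q : ℂ} (hq : NotRootOfUnity q) (k : ℕ) : qp q q k ≠ 0 :=
  qp_ne_zero fun j _ => by rw [← pow_succ']; exact hq.2 _ (by omega)

theorem qp_neg_self_ne_zero {q : ℂ} (hq : NotRootOfUnity q) (k : ℕ) : qp (-q) q k ≠ 0 :=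
  qp_ne_zero fun j _ h => hq.one_add_pow_ne (j + 1) (by rw [pow_succ']; linear_combination -h)

/-- The coefficients `(-q;q)_k / (q;q)_k` of the generating function `(-qz;q)_∞ / (z;q)_∞`,
extended by zero to negative indices. -/
def coef (q : ℂ) (k : ℤ) : ℂ := if 0 ≤ k then qp (-q) q k.toNat / qp q q k.toNat else 0

theorem coef_natCast (q : ℂ) (k : ℕ) : coef q k = qp (-q) q k / qp q q k := by simp [coef]

theorem coef_zero (q : ℂ) : coef q 0 = 1 := by simp [coef, qp_zero]

theorem coef_of_neg (q : ℂ) {k : ℤ} (hk : k < 0) : coef q k = 0 := by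
  simp [coef, hk]

theorem coef_ne_zero {q : ℂ} (hq : NotRootOfUnity q) (k : ℕ) : coef q k ≠ 0 := by
  rw [coef_natCast]
  exact div_ne_zero (qp_neg_self_ne_zero hq k) (qp_self_ne_zero hq k)

/-- The first-order recurrence of the coefficients; the convention `coef q k = 0` for `k < 0` makes
it hold for every integer `k`. -/
theorem coef_sub_one {q : ℂ} (hq : NotRootOfUnity q) (k : ℤ) :
    coef q (k - 1) = coef q k * (1 - q ^ k) / (1 + q ^ k) := by
  rw [eq_div_iff (hq.one_add_zpow_ne k)]
  rcases lt_trichotomy k 0 with hk | rfl | hk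
  · rw [coef_of_neg q hk, coef_of_neg q (by omega)]; ring
  · rw [coef_of_neg q (by omega)]; simp
  · obtain ⟨n, rfl⟩ : ∃ n : ℕ, k = n + 1 := ⟨(k - 1).toNat, by omega⟩
    have h1 : coef q ((n : ℤ) + 1) = qp (-q) q (n + 1) / qp q q (n + 1) :=
      mod_cast coef_natCast q (n + 1)
    have h2 : q ^ ((n : ℤ) + 1) = q ^ (n + 1) := mod_cast zpow_natCast q (n + 1)
    have h3 := qp_self_ne_zero hq (n + 1)
    have h4 := qp_self_ne_zero hq n
    rw [h1, h2, add_sub_cancel_right, coef_natCast, div_mul_eq_mul_div, div_mul_eq_mul_div,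
      div_eq_div_iff h4 h3, qp_succ, qp_succ]
    ring

/-- The Rogers polynomial with parameter `-q`, written as a polynomial in `x = -e^{-2iθ}`:
the sum of `a_k a_{n-k} (-x)^k` for `a_k = (-q;q)_k / (q;q)_k`. -/
def rogers (q : ℂ) (n : ℕ) (x : ℂ) : ℂ :=
  ∑ k ∈ range (n + 1), coef q k * coef q (n - k) * (-x) ^ k

theorem rogers_eq_sum (q : ℂ) {n N : ℕ} (h : n < N) (x : ℂ) :
    rogers q n x = ∑ k ∈ range N, coef q k * coef q (n - k) * (-x) ^ k := by
  refine sum_subset (range_mono h) fun k _ hk => ?_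
  rw [coef_of_neg q (k := n - k) (by simp at hk; omega)]
  ring

/-- Multiplication by `x` shifts the summation index; the upper limit is left free so that sums with
different shifts can be compared term by term. -/
theorem mul_rogers_eq_sum (q : ℂ) {n N : ℕ} (h : n + 1 < N) (x : ℂ) :
    x * rogers q n x = -∑ k ∈ range N, coef q (k - 1) * coef q (n + 1 - k) * (-x) ^ k := by
  obtain ⟨N, rfl⟩ : ∃ M, N = M + 1 := ⟨N - 1, by omega⟩
  rw [sum_range_succ', rogers_eq_sum q (N := N) (by omega), mul_sum]
  simp only [Nat.cast_zero, zero_sub, coef_of_neg q (show (-1 : ℤ) < 0 by norm_num), zero_mul,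
    add_zero]
  rw [← sum_neg_distrib]
  refine sum_congr rfl fun k _ => ?_
  push_cast
  rw [show (k : ℤ) + 1 - 1 = k by ring, show (n : ℤ) + 1 - (k + 1) = n - k by ring]
  ring

theorem rogers_zero (q x : ℂ) : rogers q 0 x = 1 := by
  simp [rogers, coef_zero]

theorem rogers_eval_zero (q : ℂ) (n : ℕ) : rogers q n 0 = coef q n := by
  rw [rogers, sum_range_succ']
  simp [coef_zero]

theorem continuous_rogers (q : ℂ) (n : ℕ) : Continuous (rogers q n) := by
  unfold rogers
  fun_prop

/-- The three-term recurrence of the Rogers polynomials. -/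
theorem rogers_succ_succ {q : ℂ} (hq : NotRootOfUnity q) (n : ℕ) (x : ℂ) :
    rogers q (n + 2) x =
      (1 + q ^ (n + 2)) / (1 - q ^ (n + 2)) * (1 - x) * rogers q (n + 1) x + x * rogers q n x := by
  have h1 : (1 - x) * rogers q (n + 1) x = ∑ k ∈ range (n + 4),
      (coef q k * coef q (n + 1 - k) + coef q (k - 1) * coef q (n + 2 - k)) * (-x) ^ k := by
    rw [sub_mul, one_mul, mul_rogers_eq_sum q (N := n + 4) (by omega),
      rogers_eq_sum q (N := n + 4) (by omega), sub_neg_eq_add, ← sum_add_distrib]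
    refine sum_congr rfl fun k _ => ?_
    push_cast
    rw [show (n : ℤ) + 1 + 1 - k = n + 2 - k by ring]
    ring
  rw [mul_assoc, h1, mul_rogers_eq_sum q (N := n + 4) (by omega),
    rogers_eq_sum q (N := n + 4) (by omega), mul_sum, ← sub_eq_add_neg, ← sum_sub_distrib]
  refine sum_congr rfl fun k _ => ?_
  have e1 : coef q ((n : ℤ) + 1 - k) = _ :=
    (congrArg (coef q) (by ring)).trans (coef_sub_one hq ((n : ℤ) + 2 - k))
  push_cast
  rw [e1, coef_sub_one hq k, zpow_sub₀ hq.ne_zero]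
  have hA := hq.one_add_pow_ne k
  have hB := hq.one_add_zpow_ne ((n : ℤ) + 2 - k)
  have hC := hq.one_sub_pow_ne (k := n + 2) (by omega)
  have hD : q ^ k ≠ 0 := pow_ne_zero _ hq.ne_zero
  have e2 : q ^ ((n : ℤ) + 2) = q ^ (n + 2) := mod_cast zpow_natCast q (n + 2)
  rw [zpow_sub₀ hq.ne_zero, e2, zpow_natCast] at hB
  rw [e2, zpow_natCast]
  generalize q ^ (n + 2) = Q at *
  generalize q ^ k = A at *
  have hB' : A + Q ≠ 0 := fun h => hB (by field_simp; linear_combination h)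
  field_simp
  ring

theorem rogers_one {q : ℂ} (hq : NotRootOfUnity q) (x : ℂ) :
    rogers q 1 x = (1 + q) / (1 - q) * (1 - x) := by
  have h := hq.one_sub_pow_ne one_ne_zero
  simp [rogers, sum_range_succ, coef, qp]
  ring

/-- The two-variable case of `P`. -/
def rogersTwo (q : ℂ) (n : ℕ) (x y : ℂ) : ℂ :=
  ∑ k ∈ range (n + 1), ∑ l ∈ range (n + 1), (q ^ l - q ^ k) / (q ^ l + q ^ k) *
    (coef q k * coef q (n - k) * (-x) ^ k * (coef q l * coef q (n - l) * (-y) ^ l))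

theorem sum_range_succ_eq_of_zero {f : ℕ → ℂ} {n : ℕ} (h : f n = 0) :
    ∑ k ∈ range (n + 1), f k = ∑ k ∈ range n, f k := by rw [sum_range_succ, h, add_zero]

theorem sum_range_succ_eq_of_zero' {f : ℕ → ℂ} {n : ℕ} (h : f 0 = 0) :
    ∑ k ∈ range (n + 1), f k = ∑ k ∈ range n, f (k + 1) := by rw [sum_range_succ', h, add_zero]

/-- The product of `1 - x y` and the two-variable polynomial is a `2 × 2` determinant of Rogers
polynomials; this is the quadratic relation behind the determinant formula in `m` variables. -/
theorem one_sub_mul_rogersTwo {q : ℂ} (hq : NotRootOfUnity q) (n : ℕ) (x y : ℂ) :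
    (1 - x * y) * rogersTwo q (n + 1) x y =
      (1 - q ^ (n + 2)) / (1 + q ^ (n + 2)) *
        (rogers q (n + 2) x * (y * rogers q n y) - x * rogers q n x * rogers q (n + 2) y) := by
  have h1 : rogersTwo q (n + 1) x y = ∑ k ∈ range (n + 3), ∑ l ∈ range (n + 3),
      (q ^ l - q ^ k) / (q ^ l + q ^ k) *
    (coef q k * coef q (n + 1 - k) * coef q l * coef q (n + 1 - l)) *
      ((-x) ^ k * (-y) ^ l) := by
    rw [sum_range_succ_eq_of_zero]
    · refine sum_congr rfl fun k _ => ?_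
      rw [sum_range_succ_eq_of_zero (n := n + 2)]
      · exact sum_congr rfl fun l _ => by push_cast; ring
      · rw [coef_of_neg q (k := (n : ℤ) + 1 - (n + 2 : ℕ)) (by push_cast; omega)]; ring
    · refine sum_eq_zero fun l _ => ?_
      rw [coef_of_neg q (k := (n : ℤ) + 1 - (n + 2 : ℕ)) (by push_cast; omega)]; ring
  have h2 : x * y * rogersTwo q (n + 1) x y = ∑ k ∈ range (n + 3), ∑ l ∈ range (n + 3),
      (q ^ l - q ^ k) / (q ^ l + q ^ k) *
    (coef q (k - 1) * coef q (n + 2 - k) * coef q (l - 1) * coef q (n + 2 - l)) *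
      ((-x) ^ k * (-y) ^ l) := by
    have z : coef q (((0 : ℕ) : ℤ) - 1) = 0 := coef_of_neg q (by norm_num)
    rw [sum_range_succ_eq_of_zero', rogersTwo, mul_sum]
    · refine sum_congr rfl fun k _ => ?_
      rw [sum_range_succ_eq_of_zero' (n := n + 2), mul_sum]
      · refine sum_congr rfl fun l _ => ?_
        have hs : ∀ j : ℕ, ((n : ℤ) + 2 - (j + 1)) = n + 1 - j := fun j => by ring
        have hf : (q ^ (l + 1) - q ^ (k + 1)) / (q ^ (l + 1) + q ^ (k + 1)) =
            (q ^ l - q ^ k) / (q ^ l + q ^ k) := by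
          rw [pow_succ, pow_succ, ← sub_mul, ← add_mul, mul_div_mul_right _ _ hq.ne_zero]
        push_cast
        rw [hs, hs, hf, add_sub_cancel_right, add_sub_cancel_right]
        ring
      · rw [z]; ring
    · exact sum_eq_zero fun l _ => by rw [z]; ring
  have h3 : rogers q (n + 2) x * (y * rogers q n y) - x * rogers q n x * rogers q (n + 2) y =
      ∑ k ∈ range (n + 3), ∑ l ∈ range (n + 3),
      (coef q (k - 1) * coef q (n + 1 - k) * coef q l * coef q (n + 2 - l) -
        coef q k * coef q (n + 2 - k) * coef q (l - 1) * coef q (n + 1 - l)) *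
      ((-x) ^ k * (-y) ^ l) := by
    rw [mul_rogers_eq_sum q (N := n + 3) (by omega), mul_rogers_eq_sum q (N := n + 3) (by omega),
      rogers_eq_sum q (N := n + 3) (by omega), rogers_eq_sum q (N := n + 3) (by omega),
      mul_neg, sum_mul_sum, neg_mul, sum_mul_sum, ← sum_neg_distrib, ← sum_neg_distrib,
      ← sum_sub_distrib]
    refine sum_congr rfl fun k _ => ?_
    rw [← sum_neg_distrib, ← sum_neg_distrib, ← sum_sub_distrib]
    refine sum_congr rfl fun l _ => ?_
    push_cast
    ring
  rw [sub_mul, one_mul, h2, h1, h3, mul_sum, ← sum_sub_distrib]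
  refine sum_congr rfl fun k _ => ?_
  rw [mul_sum, ← sum_sub_distrib]
  refine sum_congr rfl fun l _ => ?_
  have e1 : ∀ j : ℕ, coef q ((n : ℤ) + 1 - j) = _ := fun j =>
    (congrArg (coef q) (by ring)).trans (coef_sub_one hq ((n : ℤ) + 2 - j))
  have e2 : q ^ ((n : ℤ) + 2) = q ^ (n + 2) := mod_cast zpow_natCast q (n + 2)
  rw [e1, e1, coef_sub_one hq k, coef_sub_one hq l, zpow_sub₀ hq.ne_zero, zpow_sub₀ hq.ne_zero,
    e2, zpow_natCast, zpow_natCast, ← sub_mul, ← mul_assoc ((1 - q ^ (n + 2)) / _)]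
  congr 1
  have hA := hq.one_add_pow_ne k
  have hA' := hq.one_add_pow_ne l
  have hB := hq.one_add_zpow_ne ((n : ℤ) + 2 - k)
  have hB' := hq.one_add_zpow_ne ((n : ℤ) + 2 - l)
  have hC := hq.one_add_pow_ne (n + 2)
  have hD : q ^ k ≠ 0 := pow_ne_zero _ hq.ne_zero
  have hD' : q ^ l ≠ 0 := pow_ne_zero _ hq.ne_zero
  have hS := hq.pow_add_pow_ne l k
  rw [zpow_sub₀ hq.ne_zero, e2, zpow_natCast] at hB hB'
  generalize q ^ (n + 2) = Q at *
  generalize q ^ k = A at *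
  generalize q ^ l = B at *
  have hB1 : A + Q ≠ 0 := fun h => hB (by field_simp; linear_combination h)
  have hB2 : B + Q ≠ 0 := fun h => hB' (by field_simp; linear_combination h)
  field_simp
  ring

/-! ### Products over pairs and Schur's Pfaffian -/

theorem pairProd_eq_prod_ite {m : ℕ} (f : Fin m → Fin m → ℂ) :
    pairProd f = ∏ i, ∏ j, if i < j then f i j else 1 := by
  unfold pairProd
  refine prod_congr rfl fun i _ => ?_
  rw [← prod_filter]
  congr 1
  ext j
  simp

/-- Splitting off from a product over pairs all the pairs that contain a given index. -/
theorem pairProd_succAbove {m : ℕ} (f : Fin (m + 1) → Fin (m + 1) → ℂ) (i : Fin (m + 1)) :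
    pairProd f =
      (∏ l : Fin m, if i.succAbove l < i then f (i.succAbove l) i else f i (i.succAbove l)) *
        pairProd fun a b => f (i.succAbove a) (i.succAbove b) := by
  simp only [pairProd_eq_prod_ite]
  rw [Fin.prod_univ_succAbove _ i, Fin.prod_univ_succAbove _ i]
  simp only [lt_irrefl, if_false, one_mul]
  rw [prod_congr rfl fun a _ => Fin.prod_univ_succAbove
    (fun j => if i.succAbove a < j then f (i.succAbove a) j else 1) i, prod_mul_distrib,
    ← mul_assoc, ← prod_mul_distrib]
  congr 1
  · refine prod_congr rfl fun l _ => ?_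
    rcases lt_or_gt_of_ne (Fin.succAbove_ne i l) with h | h
    · rw [if_neg h.not_gt, if_pos h, if_pos h, one_mul]
    · rw [if_pos h, if_neg h.not_gt, if_neg h.not_gt, mul_one]
  · simp only [Fin.succAbove_lt_succAbove_iff]

theorem pairProd_succ {m : ℕ} (f : Fin (m + 1) → Fin (m + 1) → ℂ) :
    pairProd f = (∏ l : Fin m, f 0 l.succ) * pairProd fun a b => f a.succ b.succ := by
  rw [pairProd_succAbove f 0]
  simp

theorem pairProd_succAbove_of_symm {m : ℕ} {f : Fin (m + 1) → Fin (m + 1) → ℂ}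
    (hf : ∀ i j, f i j = f j i) (i : Fin (m + 1)) :
    pairProd f = (∏ l : Fin m, f i (i.succAbove l)) *
      pairProd fun a b => f (i.succAbove a) (i.succAbove b) := by
  rw [pairProd_succAbove f i]
  congr 1
  refine prod_congr rfl fun l _ => ?_
  rw [hf (i.succAbove l) i, ite_self]

theorem pairProd_succAbove_of_antisymm {m : ℕ} {f : Fin (m + 1) → Fin (m + 1) → ℂ}
    (hf : ∀ i j, f i j = -f j i) (i : Fin (m + 1)) :
    pairProd f = (-1) ^ (i : ℕ) * (∏ l : Fin m, f i (i.succAbove l)) *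
      pairProd fun a b => f (i.succAbove a) (i.succAbove b) := by
  rw [pairProd_succAbove f i]
  congr 1
  have h : ∀ l, (if i.succAbove l < i then f (i.succAbove l) i else f i (i.succAbove l)) =
      (if i.succAbove l < i then -1 else 1) * f i (i.succAbove l) := fun l => by
    split_ifs
    · rw [hf]; ring
    · ring
  rw [prod_congr rfl fun l _ => h l, prod_mul_distrib]
  congr 1
  rw [← prod_filter, prod_const]
  congr 1
  have h2 : #{l : Fin m | i.succAbove l < i} = #(Iio i) := by
    rw [← card_map (Fin.succAboveEmb i)]
    congr 1
    ext j
    simp only [mem_map, mem_filter, mem_univ, true_and, mem_Iio]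
    constructor
    · rintro ⟨a, ha, rfl⟩
      exact ha
    · intro hj
      obtain ⟨a, rfl⟩ := Fin.exists_succAbove_eq hj.ne
      exact ⟨a, hj, rfl⟩
  rw [h2, Fin.card_Iio]

theorem pairProd_comp_perm {m : ℕ} {f : Fin m → Fin m → ℂ} (hf : ∀ i j, f i j = -f j i)
    (σ : Equiv.Perm (Fin m)) :
    pairProd (fun i j => f (σ i) (σ j)) = Equiv.Perm.sign σ * pairProd f :=
  σ.prod_Ioi_comp_eq_sign_mul_prod hf

/-- The factor attached to a pair of indices in Schur's Pfaffian. -/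
def schurFactor (a b : ℂ) : ℂ := (b - a) / (b + a)

theorem schurFactor_antisymm (a b : ℂ) : schurFactor a b = -schurFactor b a := by
  rw [schurFactor, schurFactor, ← neg_div, add_comm b a, neg_sub]

theorem prod_add_ne_zero_of_forall {M : ℕ} {s : Fin M → ℂ} {t : ℂ} (h : ∀ l, s l + t ≠ 0) :
    ∏ l, (s l + t) ≠ 0 := prod_ne_zero_iff.mpr fun l _ => h l

open Polynomial in
/-- Expansion of Schur's Pfaffian along a row, for distinct variables: as functions of `t` the two
sides have the same poles and residues, so they differ by a constant; the difference changes sign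
between `t = 0` and `t = ∞`. -/
theorem schurFactor_expansion_of_injective {M : ℕ} (hM : Odd (M + 1)) {s : Fin (M + 1) → ℂ}
    (hs : Function.Injective s) (hs0 : ∀ i j, s i + s j ≠ 0) {t : ℂ} (ht : ∀ i, s i + t ≠ 0) :
    (∏ l, schurFactor t (s l)) * pairProd (fun i j => schurFactor (s i) (s j)) =
      ∑ j : Fin (M + 1), (-1) ^ (j : ℕ) * schurFactor t (s j) *
        pairProd (fun a b => schurFactor (s (j.succAbove a)) (s (j.succAbove b))) := by
  set p := pairProd (fun i j => schurFactor (s i) (s j)) with hp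
  set r := fun j : Fin (M + 1) =>
    pairProd (fun a b => schurFactor (s (j.succAbove a)) (s (j.succAbove b))) with hr
  -- the residues at `t = -s i` agree
  have hpr : ∀ i, p * ∏ l : Fin M, (s (i.succAbove l) + s i) =
      (-1) ^ (i : ℕ) * (∏ l : Fin M, (s (i.succAbove l) - s i)) * r i := fun i => by
    rw [hp, pairProd_succAbove_of_antisymm (fun a b => schurFactor_antisymm _ _) i]
    simp only [schurFactor, prod_div_distrib]
    have h := prod_add_ne_zero_of_forall fun l : Fin M => hs0 (i.succAbove l) i
    field_simp
    rfl
  -- `H / B`, with `t` for `X`, is the difference of the two sides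
  let A : ℂ[X] := ∏ l, (C (s l) - X)
  let B : ℂ[X] := ∏ l, (C (s l) + X)
  let G := fun j : Fin (M + 1) => (C (s j) - X) * ∏ l : Fin M, (C (s (j.succAbove l)) + X)
  let H : ℂ[X] := C p * A - ∑ j : Fin (M + 1), C ((-1) ^ (j : ℕ) * r j) * G j
  have dm : ∀ z : ℂ, (C z - X : ℂ[X]).natDegree ≤ 1 := fun z => by compute_degree
  have dp : ∀ z : ℂ, (C z + X : ℂ[X]).natDegree ≤ 1 := fun z => by compute_degree
  have cm : ∀ z : ℂ, (C z - X : ℂ[X]).coeff 1 = -1 := fun z => by simp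
  have cp : ∀ z : ℂ, (C z + X : ℂ[X]).coeff 1 = 1 := fun z => by simp
  have dP : ∀ {N : ℕ} (f : Fin N → ℂ[X]), (∀ l, (f l).natDegree ≤ 1) →
      (∏ l, f l).natDegree ≤ N := fun f hf =>
    (natDegree_prod_le _ _).trans ((sum_le_sum fun l _ => hf l).trans (by simp))
  have cP : ∀ {N : ℕ} (f : Fin N → ℂ[X]), (∀ l, (f l).natDegree ≤ 1) →
      (∏ l, f l).coeff N = ∏ l, (f l).coeff 1 := fun {N} f hf => by
    simpa using coeff_prod_of_natDegree_le univ f 1 fun l _ => hf l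
  have dG : ∀ j, (G j).natDegree ≤ M + 1 := fun j => by
    rw [add_comm M 1]
    exact natDegree_mul_le.trans (add_le_add (dm _) (dP _ fun l => dp _))
  have cG : ∀ j, (G j).coeff (M + 1) = -1 := fun j => by
    rw [add_comm M 1]
    refine (coeff_mul_add_eq_of_natDegree_le (dm _) (dP _ fun l => dp _)).trans ?_
    rw [cm, cP _ fun l => dp _]
    simp only [cp, prod_const_one, mul_one]
  have dH : H.natDegree ≤ M + 1 := by
    refine (natDegree_sub_le _ _).trans
      (max_le ((natDegree_C_mul_le _ _).trans (dP _ fun l => dm _)) ?_)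
    exact natDegree_sum_le_of_forall_le _ _ fun j _ => (natDegree_C_mul_le _ _).trans (dG j)
  set δ := p - ∑ j : Fin (M + 1), (-1) ^ (j : ℕ) * r j with hδ
  have cH : H.coeff (M + 1) = -δ := by
    simp only [H, coeff_sub, finsetSum_coeff, coeff_C_mul, cG]
    rw [show A.coeff (M + 1) = -1 by
      simp only [A]
      rw [cP _ fun l => dm _]
      simp only [cm, prod_const, card_univ, Fintype.card_fin, hM.neg_one_pow], hδ,
      ← sum_mul]
    ring
  -- `H - δ B` has degree at most `M + 1`, and vanishes at `0` and at the `M + 1` points `-s i`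
  have hz : H - C δ * B = 0 := by
    refine eq_zero_of_natDegree_lt_card_of_eval_eq_zero _
      (f := fun o : Option (Fin (M + 1)) => o.elim 0 fun i => -s i) ?_ ?_ ?_
    · have h0 : ∀ i, s i ≠ 0 := fun i h => hs0 i i (by rw [h, add_zero])
      rintro (_ | i) (_ | j) h
      · rfl
      · exact absurd (by simpa using h) (h0 j)
      · exact absurd (by simpa using h) (h0 i)
      · exact congrArg some (hs (by simpa using h))
    · rintro (_ | i)
      · simp only [Option.elim, H, A, B, G, eval_sub, eval_mul, eval_C, eval_prod, eval_add, eval_X,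
          eval_finsetSum, sub_zero, add_zero]
        rw [sum_congr rfl fun j _ => by rw [← Fin.prod_univ_succAbove s j], ← sum_mul, hδ]
        ring
      · simp only [Option.elim, H, A, B, G, eval_sub, eval_mul, eval_C, eval_prod, eval_add, eval_X,
          eval_finsetSum, sub_neg_eq_add, ← sub_eq_add_neg]
        rw [Fin.prod_univ_succAbove _ i, Fin.prod_univ_succAbove (fun l => s l - s i) i,
          sum_eq_single i]
        · linear_combination (s i + s i) * hpr i
        · intro j _ hj
          obtain ⟨l, hl⟩ := Fin.exists_succAbove_eq hj.symm
          rw [prod_eq_zero (mem_univ l) (by rw [hl, sub_self])]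
          ring
        · simp
    · rw [Fintype.card_option, Fintype.card_fin]
      exact Nat.lt_succ_of_le ((natDegree_sub_le _ _).trans
        (max_le dH ((natDegree_C_mul_le _ _).trans (dP _ fun l => dp _))))
  -- the leading coefficients of `H` and `δ B` are `-δ` and `δ`
  have hδ0 : δ = 0 := by
    have h := congrArg (fun P : ℂ[X] => P.coeff (M + 1)) hz
    simp only [coeff_sub, coeff_C_mul, cH, coeff_zero] at h
    rw [show B.coeff (M + 1) = 1 by
      simp only [B]
      rw [cP _ fun l => dp _]
      simp only [cp, prod_const_one]] at h
    linear_combination (-1 / 2) * h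
  rw [hδ0, C_0, zero_mul, sub_zero] at hz
  have h := congrArg (eval t) hz
  simp only [H, A, G, eval_sub, eval_mul, eval_C, eval_prod, eval_add, eval_X,
    eval_finsetSum, eval_zero] at h
  have hB := prod_add_ne_zero_of_forall ht
  have hr' : ∀ j, (pairProd fun a b => schurFactor (s (j.succAbove a)) (s (j.succAbove b))) = r j :=
    fun _ => rfl
  simp only [hr']
  clear_value p r
  simp only [schurFactor, prod_div_distrib]
  rw [div_mul_eq_mul_div, div_eq_iff hB, mul_comm _ p, sub_eq_zero.mp h, sum_mul]
  refine sum_congr rfl fun j _ => ?_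
  rw [Fin.prod_univ_succAbove _ j]
  have := ht j
  field_simp

/-- Expansion of Schur's Pfaffian along the first row. Coincidences among the variables are
removed by a perturbation. -/
theorem pairProd_schurFactor_expansion {m : ℕ} (hm : Even m) {t : Fin (m + 2) → ℂ}
    (ht : ∀ i j, t i + t j ≠ 0) :
    pairProd (fun i j => schurFactor (t i) (t j)) =
      ∑ j : Fin (m + 1), (-1) ^ (j : ℕ) * schurFactor (t 0) (t j.succ) *
        pairProd (fun a b =>
          schurFactor (t (j.succAbove a).succ) (t (j.succAbove b).succ)) := by
  let w : ℂ → Fin (m + 2) → ℂ := fun ε i => t i + ε * (i : ℕ)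
  have hw : ∀ i, Continuous fun ε => w ε i := fun i => by fun_prop
  have hw0 : ∀ i, w 0 i = t i := fun i => by simp [w]
  have hc : ∀ i j, ContinuousAt (fun ε => schurFactor (w ε i) (w ε j)) 0 := fun i j =>
    ((hw j).continuousAt.sub (hw i).continuousAt).div
      ((hw j).continuousAt.add (hw i).continuousAt) (by simpa only [hw0] using ht j i)
  have hcp : ∀ {d : ℕ} (e : Fin d → Fin (m + 2)), ContinuousAt (fun ε =>
      pairProd fun a b => schurFactor (w ε (e a)) (w ε (e b))) 0 := fun e =>
    tendsto_finsetProd _ fun i _ => tendsto_finsetProd _ fun j _ => hc (e i) (e j)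
  have hL := hcp id
  have hR : ContinuousAt (fun ε => ∑ j : Fin (m + 1), (-1) ^ (j : ℕ) *
      schurFactor (w ε 0) (w ε j.succ) * pairProd (fun a b =>
          schurFactor (w ε (j.succAbove a).succ) (w ε (j.succAbove b).succ))) 0 :=
    tendsto_finsetSum _ fun j _ =>
      ((tendsto_const_nhds.mul (hc 0 j.succ)).mul (hcp fun a => (j.succAbove a).succ))
  have key := tendsto_nhds_unique_of_eventuallyEq
    (hL.mono_left (nhdsWithin_le_nhds (s := {0}ᶜ))) (hR.mono_left nhdsWithin_le_nhds) ?_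
  · simpa only [hw0, id] using key
  have hne : ∀ᶠ ε in nhdsWithin (0 : ℂ) {0}ᶜ, ∀ i j, w ε i + w ε j ≠ 0 := by
    simp only [Filter.eventually_all]
    refine fun i j => nhdsWithin_le_nhds ?_
    have : Continuous fun ε => w ε i + w ε j := (hw i).add (hw j)
    exact this.continuousAt.eventually_ne (by simpa only [hw0] using ht i j)
  have hinj : ∀ᶠ ε in nhdsWithin (0 : ℂ) {0}ᶜ, Function.Injective (w ε) := by
    have h : ∀ i j, i ≠ j → ∀ᶠ ε in nhdsWithin (0 : ℂ) {0}ᶜ, w ε i ≠ w ε j := by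
      intro i j hij
      by_cases hij' : t i = t j
      · filter_upwards [self_mem_nhdsWithin] with ε hε h
        simp only [w, hij', add_right_inj, mul_eq_mul_left_iff, Nat.cast_inj] at h
        exact h.elim (fun h => hij (Fin.ext h)) hε
      · refine nhdsWithin_le_nhds ?_
        have : Continuous fun ε => w ε i - w ε j := (hw i).sub (hw j)
        filter_upwards [this.continuousAt.eventually_ne
          (by simpa only [hw0] using sub_ne_zero.mpr hij' : w 0 i - w 0 j ≠ 0)] with ε h
        exact sub_ne_zero.mp h
    have h' : ∀ᶠ ε in nhdsWithin (0 : ℂ) {0}ᶜ, ∀ i j, i ≠ j → w ε i ≠ w ε j := by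
      simp only [Filter.eventually_all]
      exact h
    filter_upwards [h'] with ε hε i j hij
    by_contra hne
    exact hε i j hne hij
  filter_upwards [hne, hinj] with ε h1 h2
  rw [pairProd_succ]
  exact schurFactor_expansion_of_injective (s := fun i : Fin (m + 1) => w ε i.succ)
    (by simpa [Nat.odd_add_one] using hm) (h2.comp (Fin.succ_injective _)) (fun i j => h1 _ _)
    (fun i => h1 _ _)

/-! ### The polynomial `P` -/

theorem qps_two (a b q : ℂ) (k : ℕ) : qps [a, b] q k = qp a q k * qp b q k := by simp [qps]

theorem qps_four (a b c d q : ℂ) (k : ℕ) :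
    qps [a, b, c, d] q k = qp a q k * qp b q k * (qp c q k * qp d q k) := by
  simp [qps, mul_assoc]

/-- Each weight in the definition of `P` is, up to sign, a coefficient of the Rogers polynomial of
degree `n`. -/
theorem weight_eq_coef_mul_coef {q : ℂ} (hq : NotRootOfUnity q) {n k : ℕ} (hk : k ≤ n) :
    qp (-q) q n / qp q q n * (qps [-q, q ^ (-(n : ℤ))] q k / qps [q, -q ^ (-(n : ℤ))] q k) =
      coef q k * coef q (n - k) * (-1) ^ k := by
  induction k with
  | zero => simp [qps, qp_zero, coef_zero, coef_natCast]
  | succ k ih =>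
    have ih := ih (by omega)
    have e : (n : ℤ) - (k + 1 : ℕ) = (n - k : ℤ) - 1 := by push_cast; ring
    have e2 : coef q (k : ℤ) = coef q ((k + 1 : ℕ) : ℤ) * (1 - q ^ (k + 1)) /
        (1 + q ^ (k + 1)) := by
      have := coef_sub_one hq ((k + 1 : ℕ) : ℤ)
      rwa [zpow_natCast, Nat.cast_add, Nat.cast_one, add_sub_cancel_right] at this
    have h1 := hq.one_sub_pow_ne (k := k + 1) (by omega)
    have h2 := hq.one_add_pow_ne (k + 1)
    have h3 := hq.one_add_zpow_ne ((n : ℤ) - k)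
    have e3 : q ^ (-(n : ℤ)) * q ^ k * q ^ ((n : ℤ) - k) = 1 := by
      rw [← zpow_natCast, ← zpow_add₀ hq.ne_zero, ← zpow_add₀ hq.ne_zero]
      simp
    rw [e2] at ih
    rw [e, coef_sub_one hq, pow_succ]
    simp only [qps_two, qp_succ] at ih ⊢
    set Y := q ^ ((n : ℤ) - k)
    set Z := q ^ (-(n : ℤ)) * q ^ k with hZ
    have hY : Y ≠ 0 := zpow_ne_zero _ hq.ne_zero
    have eZ : Z = Y⁻¹ := eq_inv_of_mul_eq_one_left e3
    have h4 : 1 + Z ≠ 0 := by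
      rw [eZ]
      intro h
      apply h3
      field_simp at h
      linear_combination h
    have e4 : coef q ((k + 1 : ℕ) : ℤ) * coef q (n - k) * (-1) ^ k =
      qp (-q) q n / qp q q n * (qp (-q) q k * qp (q ^ (-(n : ℤ))) q k /
        (qp q q k * qp (-q ^ (-(n : ℤ))) q k)) * ((1 + q ^ (k + 1)) / (1 - q ^ (k + 1))) := by
      rw [ih]
      field_simp
    calc _ = qp (-q) q n / qp q q n * (qp (-q) q k * qp (q ^ (-(n : ℤ))) q k /
        (qp q q k * qp (-q ^ (-(n : ℤ))) q k)) * ((1 + q ^ (k + 1)) / (1 - q ^ (k + 1))) *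
          ((1 - Z) / (1 + Z)) := by
          rw [pow_succ', hZ]
          simp only [div_mul_div_comm, neg_mul, sub_neg_eq_add]
          congr 1 <;> ring
      _ = _ := by
          rw [← e4, eZ]
          have h5 : Y + 1 ≠ 0 := by rwa [add_comm]
          have h6 : 1 + Y⁻¹ = (Y + 1) / Y := by field_simp
          have h7 : 1 - Y⁻¹ = (Y - 1) / Y := by field_simp
          rw [h6, h7, div_div_div_cancel_right₀ hY, add_comm 1 Y]
          field_simp
          ring

theorem P_eq_sum {q : ℂ} (hq : NotRootOfUnity q) (n : ℕ) {m : ℕ} (x : Fin m → ℂ) :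
    P n q x = ∑ k : Fin m → Fin (n + 1),
      pairProd (fun i j => schurFactor (q ^ (k i : ℕ)) (q ^ (k j : ℕ))) *
        ∏ i, coef q (k i : ℕ) * coef q (n - (k i : ℕ)) * (-x i) ^ (k i : ℕ) := by
  rw [P, mul_sum]
  refine sum_congr rfl fun k _ => ?_
  rw [mul_left_comm]
  simp only [schurFactor]
  congr 1
  rw [← div_pow, ← Fin.prod_const, ← prod_mul_distrib]
  refine prod_congr rfl fun i _ => ?_
  rw [← mul_assoc, weight_eq_coef_mul_coef hq (by omega), neg_pow (x i)]
  ring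

theorem P_one {q : ℂ} (hq : NotRootOfUnity q) (n : ℕ) (x : Fin 1 → ℂ) :
    P n q x = rogers q n (x 0) := by
  rw [P_eq_sum hq, rogers, ← Fin.sum_univ_eq_sum_range
    (fun k => coef q k * coef q (n - k) * (-x 0) ^ k)]
  refine (Fintype.sum_equiv (Equiv.funUnique (Fin 1) _) _ _ fun k => ?_)
  simp [pairProd]

theorem P_zero (n : ℕ) (q : ℂ) (x : Fin 0 → ℂ) : P n q x = 1 := by
  simp [P, pairProd]

/-- In an even number of variables, `P` is the Pfaffian of its two-variable cases; this is the
expansion along the first variable. -/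
theorem P_expansion {q : ℂ} (hq : NotRootOfUnity q) (n : ℕ) {m : ℕ} (hm : Even m)
    (x : Fin (m + 2) → ℂ) :
    P n q x = ∑ j : Fin (m + 1), (-1) ^ (j : ℕ) * rogersTwo q n (x 0) (x j.succ) *
      P n q fun i => x (j.succAbove i).succ := by
  rw [P_eq_sum hq]
  have h := fun k : Fin (m + 2) → Fin (n + 1) => pairProd_schurFactor_expansion hm
    (t := fun i => q ^ (k i : ℕ)) fun i j => hq.pow_add_pow_ne _ _
  simp only [h, sum_mul]
  rw [sum_comm]
  refine sum_congr rfl fun j _ => ?_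
  let e : (Fin (n + 1) × Fin (n + 1) × (Fin m → Fin (n + 1))) ≃ (Fin (m + 2) → Fin (n + 1)) :=
    ((Equiv.refl _).prodCongr (Fin.insertNthEquiv (fun _ => Fin (n + 1)) j)).trans
      (Fin.consEquiv fun _ => Fin (n + 1))
  rw [← e.sum_comp, Fintype.sum_prod_type, rogersTwo, P_eq_sum hq, ← Fin.sum_univ_eq_sum_range
    (fun k => ∑ l ∈ range (n + 1), (q ^ l - q ^ k) / (q ^ l + q ^ k) *
    (coef q k * coef q (n - k) * (-x 0) ^ k * (coef q l * coef q (n - l) * (-x j.succ) ^ l))),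
    mul_assoc, sum_mul, mul_sum]
  refine sum_congr rfl fun a _ => ?_
  rw [Fintype.sum_prod_type, ← Fin.sum_univ_eq_sum_range (fun l =>
    (q ^ l - q ^ (a : ℕ)) / (q ^ l + q ^ (a : ℕ)) * (coef q (a : ℕ) * coef q (n - (a : ℕ)) *
      (-x 0) ^ (a : ℕ) * (coef q l * coef q (n - l) * (-x j.succ) ^ l))), sum_mul, mul_sum]
  refine sum_congr rfl fun b _ => ?_
  rw [mul_sum, mul_sum]
  refine sum_congr rfl fun k _ => ?_
  have e0 : e (a, b, k) 0 = a := rfl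
  have e1 : e (a, b, k) j.succ = b := by
    simp [e, Fin.insertNthEquiv]
  have e2 : ∀ i, e (a, b, k) (j.succAbove i).succ = k i := fun i => by
    simp [e, Fin.insertNthEquiv]
  rw [Fin.prod_univ_succ, Fin.prod_univ_succAbove _ j]
  simp only [e0, e1, e2, schurFactor]
  ring

/-- Setting a variable to zero removes it and lowers `n` by one. -/
theorem P_cons_zero {q : ℂ} (hq : NotRootOfUnity q) (n : ℕ) {m : ℕ} (x : Fin m → ℂ) :
    P (n + 1) q (Fin.cons 0 x : Fin (m + 1) → ℂ) =
      coef q ((n + 1 : ℕ) : ℤ) * (∏ i, x i) * P n q x := by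
  rw [P_eq_sum hq, P_eq_sum hq, mul_sum, ← (Fin.consEquiv fun _ => Fin (n + 1 + 1)).sum_comp,
    Fintype.sum_prod_type, sum_eq_single 0]
  -- only the terms with `k 0 = 0` survive; for these the new factors `(q^{k i} - 1)/(q^{k i} + 1)`
  -- turn `coef q (k i)` into `coef q (k i - 1)`, so that all other indices can be lowered by one
  · have key : ∀ k : Fin m → Fin (n + 1 + 1),
        pairProd (fun i j : Fin (m + 1) => schurFactor
          (q ^ ((Fin.cons 0 k : Fin (m + 1) → Fin (n + 1 + 1)) i : ℕ))
          (q ^ ((Fin.cons 0 k : Fin (m + 1) → Fin (n + 1 + 1)) j : ℕ))) *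
        ∏ i, coef q ((Fin.cons 0 k : Fin (m + 1) → Fin (n + 1 + 1)) i : ℕ) *
          coef q ((n + 1 : ℕ) - ((Fin.cons 0 k : Fin (m + 1) → Fin (n + 1 + 1)) i : ℕ)) *
          (-(Fin.cons 0 x : Fin (m + 1) → ℂ) i) ^
            ((Fin.cons 0 k : Fin (m + 1) → Fin (n + 1 + 1)) i : ℕ) =
        coef q ((n + 1 : ℕ) : ℤ) *
          (pairProd (fun i j => schurFactor (q ^ (k i : ℕ)) (q ^ (k j : ℕ))) *
            ∏ i, coef q ((k i : ℕ) - 1) * coef q ((n + 1 : ℕ) - (k i : ℕ)) *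
              ((-1) * (-x i) ^ (k i : ℕ))) := by
      intro k
      rw [pairProd_succ, Fin.prod_univ_succ]
      simp only [Fin.cons_zero, Fin.cons_succ, Fin.val_zero, pow_zero, schurFactor,
        Nat.cast_zero, coef_zero, sub_zero, one_mul, mul_one]
      rw [mul_mul_mul_comm, mul_comm (∏ l, _), mul_assoc, mul_left_comm _ (pairProd _)]
      congr 2
      rw [← prod_mul_distrib]
      refine prod_congr rfl fun i _ => ?_
      rw [coef_sub_one hq, zpow_natCast]
      have := hq.one_add_pow_ne (k i)
      rw [add_comm (q ^ _) 1]
      field_simp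
      ring
    simp only [Fin.consEquiv, Equiv.coe_fn_mk]
    rw [sum_congr rfl fun k _ => key k]
    symm
    refine Fintype.sum_of_injective (fun k i => (k i).succ) ?_ _ _ ?_ ?_
    · intro k k' h
      funext i
      exact Fin.succ_injective _ (congrFun h i)
    · intro k hk
      obtain ⟨i, hi⟩ : ∃ i, k i = 0 := by
        by_contra! h
        exact hk ⟨fun i => (k i).pred (h i), funext fun i => Fin.succ_pred _ _⟩
      rw [prod_eq_zero (mem_univ i)]
      · ring
      · rw [hi, coef_of_neg q (by simp)]
        ring
    · intro k
      rw [mul_assoc]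
      congr 1
      rw [mul_left_comm, ← prod_mul_distrib]
      congr 1
      · simp only [pairProd_eq_prod_ite]
        refine prod_congr rfl fun i _ => prod_congr rfl fun j _ => ?_
        simp only [schurFactor, Fin.val_succ, pow_succ]
        rw [← sub_mul, ← add_mul, mul_div_mul_right _ _ hq.ne_zero]
      · refine prod_congr rfl fun i _ => ?_
        simp only [Fin.val_succ, Nat.cast_add, Nat.cast_one, add_sub_cancel_right,
          add_sub_add_right_eq_sub, pow_succ]
        ring
  · intro a _ ha
    refine sum_eq_zero fun k _ => ?_
    rw [Fin.prod_univ_succ]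
    have : (a : ℕ) ≠ 0 := fun h => ha (Fin.ext h)
    simp [Fin.consEquiv, this]
  · simp

theorem continuous_P (n : ℕ) (q : ℂ) {m : ℕ} : Continuous fun x : Fin m → ℂ => P n q x := by
  unfold P
  fun_prop

/-- `P` is antisymmetric, hence vanishes when two variables coincide. -/
theorem P_eq_zero_of_eq {q : ℂ} (hq : NotRootOfUnity q) (n : ℕ) {m : ℕ} {x : Fin m → ℂ}
    {a b : Fin m} (hab : a ≠ b) (hx : x a = x b) : P n q x = 0 := by
  have hxs : ∀ i, x (Equiv.swap a b i) = x i := fun i => by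
    rcases eq_or_ne i a with rfl | hia
    · rw [Equiv.swap_apply_left, hx]
    rcases eq_or_ne i b with rfl | hib
    · rw [Equiv.swap_apply_right, hx]
    · rw [Equiv.swap_apply_of_ne_of_ne hia hib]
  rw [P_eq_sum hq]
  set T : (Fin m → Fin (n + 1)) → ℂ := fun k =>
    pairProd (fun i j => schurFactor (q ^ (k i : ℕ)) (q ^ (k j : ℕ))) *
      ∏ i, coef q (k i : ℕ) * coef q (n - (k i : ℕ)) * (-x i) ^ (k i : ℕ) with hT
  set e := (Equiv.swap a b).arrowCongr (Equiv.refl (Fin (n + 1))) with he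
  have h : ∀ k, T (e k) = -T k := fun k => by
    have hk : ∀ i, e k i = k (Equiv.swap a b i) := fun i => by simp [he, Equiv.arrowCongr]
    simp only [hT, hk]
    rw [pairProd_comp_perm (f := fun i j => schurFactor (q ^ (k i : ℕ)) (q ^ (k j : ℕ)))
      (fun _ _ => schurFactor_antisymm _ _), Equiv.Perm.sign_swap hab,
      ← Equiv.prod_comp (Equiv.swap a b) (fun i => coef q (k i : ℕ) * coef q (n - (k i : ℕ)) *
      (-x i) ^ (k i : ℕ))]
    simp only [hxs]
    push_cast
    ring
  have hsum : ∑ k, T k = -∑ k, T k := by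
    rw [← sum_neg_distrib, ← sum_congr rfl fun k _ => h k, e.sum_comp]
  linear_combination hsum / 2

/-! ### Determinants with rows `(g, h, g u, h u, …)` -/

/-- The matrix whose rows are `(g, h, g u, h u, g u², h u², …)`. -/
def pairMatrix {d : ℕ} (g h u : Fin d → ℂ) : Matrix (Fin d) (Fin d) ℂ :=
  Matrix.of fun i c => (if Even (c : ℕ) then g i else h i) * u i ^ ((c : ℕ) / 2)

/-- When two values of `u` agree, subtracting `u` times each column from the column two places
further on reduces the determinant to one with two rows less. -/
theorem det_pairMatrix_of_eq {d : ℕ} (g h u : Fin (d + 2) → ℂ) (j : Fin (d + 1))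
    (hu : u 0 = u j.succ) :
    (pairMatrix g h u).det = (-1) ^ (j : ℕ) * (g 0 * h j.succ - h 0 * g j.succ) *
      (∏ l : Fin d, (u (j.succAbove l).succ - u j.succ)) *
      (pairMatrix (fun l => g (j.succAbove l).succ) (fun l => h (j.succAbove l).succ)
        fun l => u (j.succAbove l).succ).det := by
  set v := u j.succ with hv
  let L : Matrix (Fin (d + 2)) (Fin (d + 2)) ℂ := Matrix.of fun a c =>
    (if a = c then 1 else 0) + if (a : ℕ) + 2 = c then -v else 0
  have hL : L.det = 1 := by
    rw [Matrix.det_of_isUpperTriangular]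
    · simp [L]
    · intro a c hac
      have h1 : a ≠ c := fun h => by simp [h] at hac
      have h2 : ¬ (a : ℕ) + 2 = c := fun h => by
        have : (c : ℕ) < a := hac
        omega
      simp [L, h1, h2]
  set M := pairMatrix g h u * L with hM
  have hdet : (pairMatrix g h u).det = M.det := by rw [hM, Matrix.det_mul, hL, mul_one]
  have hMc : ∀ i c, M i c = pairMatrix g h u i c +
      ∑ a : Fin (d + 2), pairMatrix g h u i a * if (a : ℕ) + 2 = c then -v else 0 := fun i c => by
    rw [hM, Matrix.mul_apply]
    simp only [L, Matrix.of_apply, mul_add, sum_add_distrib, mul_ite, mul_one, mul_zero,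
      sum_ite_eq', mem_univ, if_true]
  have hM0 : ∀ i, M i 0 = g i := fun i => by
    rw [hMc, sum_eq_zero fun a _ => by rw [if_neg (by simp), mul_zero]]
    simp [pairMatrix]
  have hM1 : ∀ i, M i 1 = h i := fun i => by
    have h1 : ((1 : Fin (d + 2)) : ℕ) = 1 := by simp
    rw [hMc, sum_eq_zero fun a _ => by rw [if_neg (by omega), mul_zero]]
    simp [pairMatrix]
  have hM2 : ∀ i (c : Fin d), M i c.succ.succ =
      (u i - v) * ((if Even (c : ℕ) then g i else h i) * u i ^ ((c : ℕ) / 2)) := fun i c => by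
    rw [hMc, sum_eq_single c.castSucc.castSucc]
    · have h1 : Even ((c : ℕ) + 1 + 1) ↔ Even (c : ℕ) := by simp [Nat.even_add_one]
      have h2 : ((c : ℕ) + 1 + 1) / 2 = (c : ℕ) / 2 + 1 := by omega
      simp only [pairMatrix, Matrix.of_apply, Fin.val_succ, Fin.val_castSucc, h1, h2, if_true]
      ring
    · intro a _ ha
      rw [if_neg, mul_zero]
      intro h
      apply ha
      ext
      simp at h ⊢
      omega
    · simp
  have hz0 : ∀ c : Fin d, M 0 c.succ.succ = 0 := fun c => by rw [hM2, hu, sub_self, zero_mul]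
  have hzj : ∀ c : Fin d, M j.succ c.succ.succ = 0 := fun c => by rw [hM2, sub_self, zero_mul]
  set R : Matrix (Fin d) (Fin d) ℂ :=
    M.submatrix (fun l => (j.succAbove l).succ) fun c => c.succ.succ with hR
  have hRdet : R.det = (∏ l : Fin d, (u (j.succAbove l).succ - v)) *
      (pairMatrix (fun l => g (j.succAbove l).succ) (fun l => h (j.succAbove l).succ)
        fun l => u (j.succAbove l).succ).det := by
    rw [← Matrix.det_mul_column]
    congr 1
    ext l c
    simp only [hR, Matrix.submatrix_apply, hM2, Matrix.of_apply, pairMatrix]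
  have hA : (M.submatrix Fin.succ (Fin.succAbove 0)).det = (-1) ^ (j : ℕ) * h j.succ * R.det := by
    rw [Matrix.det_succ_row _ j, Fin.sum_univ_succ, sum_eq_zero, add_zero]
    · have : (M.submatrix Fin.succ (Fin.succAbove 0)).submatrix j.succAbove (Fin.succAbove 0) =
        R := by
        ext l c
        simp [hR]
      rw [this]
      simp [hM1]
    · intro c _
      simp [hzj]
  have hB : (M.submatrix Fin.succ (Fin.succAbove 1)).det = (-1) ^ (j : ℕ) * g j.succ * R.det := by
    have h1 : ∀ c : Fin d, (1 : Fin (d + 2)).succAbove c.succ = c.succ.succ := fun c => by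
      rw [← Fin.succ_zero_eq_one, Fin.succ_succAbove_succ, Fin.zero_succAbove]
    rw [Matrix.det_succ_row _ j, Fin.sum_univ_succ, sum_eq_zero, add_zero]
    · have : (M.submatrix Fin.succ (Fin.succAbove 1)).submatrix j.succAbove (Fin.succAbove 0) =
        R := by
        ext l c
        simp [hR, h1]
      rw [this]
      simp [hM0]
    · intro c _
      simp [h1, hzj]
  rw [mul_assoc ((-1) ^ (j : ℕ) * _) (∏ l : Fin d, _) _, ← hRdet, hdet, Matrix.det_succ_row_zero,
    Fin.sum_univ_succ, Fin.sum_univ_succ, sum_eq_zero, hM0, Fin.succ_zero_eq_one, hM1, hA, hB]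
  · simp
    ring
  · intro c _
    rw [hz0]
    ring

open Polynomial in
/-- Expansion of the determinant with rows `(g, h, g u, h u, …)`, for `u = x + x⁻¹`, by Lagrange
interpolation in the variable `x 0` at the inverses of the other variables. -/
theorem det_pairMatrix_expansion {μ : ℕ} (g h : Fin (2 * μ + 2) → ℂ) {x : Fin (2 * μ + 2) → ℂ}
    (hx : ∀ i, x i ≠ 0) (hinj : ∀ i j : Fin (2 * μ + 1), x i.succ = x j.succ → i = j) :
    (pairMatrix g h fun i => x i + (x i)⁻¹).det =
      ∑ j : Fin (2 * μ + 1), (-1) ^ (j : ℕ) * (g 0 * h j.succ - h 0 * g j.succ) *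
        ((∏ l : Fin (2 * μ), (1 - x 0 * x (j.succAbove l).succ) *
          (1 - x j.succ * x (j.succAbove l).succ) / x (j.succAbove l).succ) /
          (x 0 * x j.succ) ^ μ) *
        (pairMatrix (fun l => g (j.succAbove l).succ) (fun l => h (j.succAbove l).succ)
          fun l => x (j.succAbove l).succ + (x (j.succAbove l).succ)⁻¹).det := by
  set r := fun j : Fin (2 * μ + 1) => (pairMatrix (fun l => g (j.succAbove l).succ)
    (fun l => h (j.succAbove l).succ)
    fun l => x (j.succAbove l).succ + (x (j.succAbove l).succ)⁻¹).det with hr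
  let y : ℂ → Fin (2 * μ + 2) → ℂ := fun z => Fin.cons z fun i => x i.succ
  let cof := fun c : Fin (2 * μ + 2) =>
    ((pairMatrix g h fun i => x i + (x i)⁻¹).submatrix Fin.succ c.succAbove).det
  have hdet : ∀ z : ℂ, (pairMatrix g h fun i => y z i + (y z i)⁻¹).det =
      ∑ c : Fin (2 * μ + 2), (-1) ^ (c : ℕ) *
        ((if Even (c : ℕ) then g 0 else h 0) * (z + z⁻¹) ^ ((c : ℕ) / 2)) * cof c := fun z => by
    rw [Matrix.det_succ_row_zero]
    rfl
  -- as functions of the first variable `z`, the two sides times `z ^ μ` are polynomials `A`, `B` of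
  -- degree at most `2 μ`; they agree at the inverses of the other `2 μ + 1` variables
  let A : ℂ[X] := ∑ c : Fin (2 * μ + 2), C ((-1) ^ (c : ℕ) * (if Even (c : ℕ) then g 0 else h 0) *
    cof c) * (X ^ (μ - (c : ℕ) / 2) * (X ^ 2 + 1) ^ ((c : ℕ) / 2))
  let B : ℂ[X] := ∑ j : Fin (2 * μ + 1), C ((-1) ^ (j : ℕ) * (g 0 * h j.succ - h 0 * g j.succ) *
    ((∏ l : Fin (2 * μ), (1 - x j.succ * x (j.succAbove l).succ) / x (j.succAbove l).succ) /
      x j.succ ^ μ) * r j) * ∏ l : Fin (2 * μ), (1 - X * C (x (j.succAbove l).succ))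
  have hA : ∀ z, z ≠ 0 → A.eval z = z ^ μ * (pairMatrix g h fun i => y z i + (y z i)⁻¹).det := by
    intro z hz
    simp only [hdet, A, eval_finsetSum, eval_mul, eval_C, eval_pow, eval_X, eval_add, eval_one,
      mul_sum]
    refine sum_congr rfl fun c _ => ?_
    have hc : (c : ℕ) / 2 ≤ μ := by omega
    have h1 : z + z⁻¹ = (z ^ 2 + 1) / z := by field_simp
    have h2 : z ^ μ = z ^ (μ - (c : ℕ) / 2) * z ^ ((c : ℕ) / 2) := by
      rw [← pow_add]; congr 1; omega
    rw [h1, h2, div_pow]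
    field_simp
  have hB : ∀ z, z ≠ 0 → B.eval z = z ^ μ * ∑ j : Fin (2 * μ + 1),
      (-1) ^ (j : ℕ) * (g 0 * h j.succ - h 0 * g j.succ) *
        ((∏ l : Fin (2 * μ), (1 - z * x (j.succAbove l).succ) *
          (1 - x j.succ * x (j.succAbove l).succ) / x (j.succAbove l).succ) /
          (z * x j.succ) ^ μ) * r j := by
    intro z hz
    simp only [B, eval_finsetSum, eval_mul, eval_C, eval_prod, eval_X, eval_sub, eval_one,
      mul_sum, mul_div_assoc, prod_mul_distrib, mul_pow]
    refine sum_congr rfl fun j _ => ?_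
    have := hx j.succ
    field_simp
  have hAB : A = B := by
    refine eq_of_natDegree_lt_card_of_eval_eq A B (f := fun j : Fin (2 * μ + 1) => (x j.succ)⁻¹)
      (fun i j hij => hinj i j (inv_injective hij)) ?_ ?_
    · intro j
      have hz := inv_ne_zero (hx j.succ)
      rw [hA _ hz, hB _ hz]
      congr 1
      rw [det_pairMatrix_of_eq _ _ _ j (by simp [y, add_comm]), sum_eq_single j]
      · simp only [y, Fin.cons_succ]
        rw [inv_mul_cancel₀ (hx j.succ), one_pow, div_one]
        congr 2
        refine prod_congr rfl fun l _ => ?_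
        have h1 := hx j.succ
        have h2 := hx (j.succAbove l).succ
        field_simp
        ring
      · intro i _ hij
        obtain ⟨l, hl⟩ := Fin.exists_succAbove_eq hij.symm
        rw [prod_eq_zero (mem_univ l)]
        · ring
        · rw [hl, inv_mul_cancel₀ (hx j.succ)]
          ring
      · simp
    · rw [Fintype.card_fin]
      refine Nat.lt_succ_of_le (max_le ?_ ?_)
      · refine natDegree_sum_le_of_forall_le _ _ fun c _ => (natDegree_C_mul_le _ _).trans ?_
        have h1 : (X ^ 2 + 1 : ℂ[X]).natDegree ≤ 2 := by compute_degree
        refine natDegree_mul_le.trans ((add_le_add (natDegree_X_pow_le _)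
          (natDegree_pow_le_of_le _ h1)).trans ?_)
        omega
      · refine natDegree_sum_le_of_forall_le _ _ fun c _ => (natDegree_C_mul_le _ _).trans ?_
        refine (natDegree_prod_le _ _).trans ((sum_le_sum fun l _ => ?_).trans
          (by simp : ∑ _ : Fin (2 * μ), 1 ≤ 2 * μ))
        compute_degree
  have h0 := hx 0
  have hy : y (x 0) = x := by
    funext i
    refine Fin.cases ?_ (fun i => ?_) i <;> simp [y]
  have h1 := hA _ h0
  rw [hAB, hB _ h0, hy] at h1
  exact (mul_left_cancel₀ (pow_ne_zero μ h0) h1).symm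

/-- In an even number of variables, the product of `P` and the `1 - x i * x j` is a determinant
with rows `(g, h, g u, h u, …)`: the expansion of the determinant along the first variable is that
of the Pfaffian `P`, and the `2 × 2` minors are those of `one_sub_mul_rogersTwo`. -/
theorem pairProd_mul_P_eq_det_pairMatrix {q : ℂ} (hq : NotRootOfUnity q) (n μ : ℕ)
    {x : Fin (2 * μ) → ℂ} (hx : ∀ i, x i ≠ 0) :
    (∏ i, x i) * (pairProd (fun i j => 1 - x i * x j) * P (n + 1) q x) =
      ((1 - q ^ (n + 2)) / (1 + q ^ (n + 2))) ^ μ * (∏ i, x i ^ μ) *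
        (pairMatrix (fun i => rogers q (n + 2) (x i)) (fun i => x i * rogers q n (x i))
          fun i => x i + (x i)⁻¹).det := by
  induction μ with
  | zero => simp [P_zero, pairProd]
  | succ μ ih =>
    suffices H : ∀ x : Fin (2 * μ + 2) → ℂ, (∀ i, x i ≠ 0) →
        (∏ i, x i) * (pairProd (fun i j => 1 - x i * x j) * P (n + 1) q x) =
          ((1 - q ^ (n + 2)) / (1 + q ^ (n + 2))) ^ (μ + 1) * (∏ i, x i ^ (μ + 1)) *
        (pairMatrix (fun i => rogers q (n + 2) (x i)) (fun i => x i * rogers q n (x i))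
          fun i => x i + (x i)⁻¹).det from H x hx
    clear hx x
    intro x hx
    by_cases hinj : ∀ i j : Fin (2 * μ + 1), x i.succ = x j.succ → i = j
    · rw [det_pairMatrix_expansion _ _ hx hinj, P_expansion hq _ (by simp), mul_sum, mul_sum,
        mul_sum]
      refine sum_congr rfl fun j _ => ?_
      have ih := ih (x := fun l => x (j.succAbove l).succ) fun l => hx _
      have h2 := one_sub_mul_rogersTwo hq n (x 0) (x j.succ)
      generalize (1 - q ^ (n + 2)) / (1 + q ^ (n + 2)) = κ at ih h2 ⊢
      rw [pairProd_succ, Fin.prod_univ_succAbove (fun l : Fin (2 * μ + 1) => 1 - x 0 * x l.succ) j,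
        pairProd_succAbove_of_symm (f := fun a b : Fin (2 * μ + 1) => 1 - x a.succ * x b.succ)
          (fun a b => by ring) j, Fin.prod_univ_succ (fun i : Fin (2 * μ + 2) => x i),
        Fin.prod_univ_succ (fun i : Fin (2 * μ + 2) => x i ^ (μ + 1)),
        Fin.prod_univ_succAbove (fun l : Fin (2 * μ + 1) => x l.succ) j,
        Fin.prod_univ_succAbove (fun l : Fin (2 * μ + 1) => x l.succ ^ (μ + 1)) j]
      simp only [mul_div_assoc, prod_mul_distrib, prod_div_distrib, pow_succ] at ih ⊢
      have h3 : ∏ l : Fin (2 * μ), x (j.succAbove l).succ ≠ 0 :=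
        prod_ne_zero_iff.mpr fun l _ => hx _
      have h0 := hx 0
      have hj := hx j.succ
      set p1 := ∏ l : Fin (2 * μ), (1 - x 0 * x (j.succAbove l).succ)
      set p2 := ∏ l : Fin (2 * μ), (1 - x j.succ * x (j.succAbove l).succ)
      calc _ = (-1) ^ (j : ℕ) * x 0 * x j.succ * p1 * p2 *
            ((1 - x 0 * x j.succ) * rogersTwo q (n + 1) (x 0) (x j.succ)) *
            ((∏ l : Fin (2 * μ), x (j.succAbove l).succ) *
              (pairProd (fun a b : Fin (2 * μ) =>
                1 - x (j.succAbove a).succ * x (j.succAbove b).succ) *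
              P (n + 1) q fun l => x (j.succAbove l).succ)) := by ring
        _ = _ := by
          rw [ih, h2]
          rw [mul_pow]
          generalize pairMatrix _ _ _ = K
          field_simp
    -- if two variables coincide, both sides vanish
    · push Not at hinj
      obtain ⟨i, j, hij, hne⟩ := hinj
      have hne' : i.succ ≠ j.succ := fun h => hne (Fin.succ_injective _ h)
      rw [P_eq_zero_of_eq hq _ hne' hij, Matrix.det_zero_of_row_eq hne']
      · ring
      · funext c
        simp only [pairMatrix, Matrix.of_apply, hij]

/-! ### The determinant of Rogers polynomials -/

/-- The determinant with rows `x^s f_{d+2(m-1-s)}(x)`, `0 ≤ s < m`, where the `f_n` are the Rogers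
polynomials. -/
def rogersDet (q : ℂ) (d : ℕ) {m : ℕ} (x : Fin m → ℂ) : ℂ :=
  (Matrix.of fun i s : Fin m => x i ^ (s : ℕ) * rogers q (d + 2 * (m - 1 - s)) (x i)).det

/-- The three-term recurrence in steps of two. As `γ ≠ 0`, it can be used in both directions. -/
theorem rogers_add_four {q : ℂ} (hq : NotRootOfUnity q) (k : ℕ) :
    ∃ α β γ : ℂ, γ ≠ 0 ∧ ∀ x, x ≠ 0 → rogers q (k + 4) x =
      x * ((α * (x + x⁻¹) + β) * rogers q (k + 2) x + γ * (x * rogers q k x)) := by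
  have h2 := hq.one_sub_pow_ne (k := k + 2) (by omega)
  have h4 := hq.one_sub_pow_ne (k := k + 4) (by omega)
  have g2 := hq.one_add_pow_ne (k + 2)
  have g4 := hq.one_add_pow_ne (k + 4)
  have e4 := rogers_succ_succ hq (k + 2)
  have e3 := rogers_succ_succ hq (k + 1)
  have e2 := rogers_succ_succ hq k
  have hr2 : (1 + q ^ (k + 2)) / (1 - q ^ (k + 2)) ≠ 0 := div_ne_zero g2 h2
  have hr4 : (1 + q ^ (k + 4)) / (1 - q ^ (k + 4)) ≠ 0 := div_ne_zero g4 h4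
  simp only [add_assoc, Nat.reduceAdd] at e4 e3
  generalize (1 + q ^ (k + 2)) / (1 - q ^ (k + 2)) = r2 at *
  generalize (1 + q ^ (k + 3)) / (1 - q ^ (k + 3)) = r3 at *
  generalize (1 + q ^ (k + 4)) / (1 - q ^ (k + 4)) = r4 at *
  refine ⟨r4 * r3, 1 + r4 / r2 - 2 * (r4 * r3), -(r4 / r2), neg_ne_zero.mpr (div_ne_zero hr4 hr2),
    fun x hx => ?_⟩
  have h1 : (1 - x) * rogers q (k + 1) x = (rogers q (k + 2) x - x * rogers q k x) / r2 := by
    rw [e2]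
    field_simp
    ring
  rw [e4, e3]
  field_simp at h1 ⊢
  linear_combination r4 * x * h1

open Polynomial in
/-- The function `F` is a combination of `g` and `h` whose coefficients are polynomials of degree
at most `j` in `u = x + x⁻¹`. -/
def IsCombination (g h : ℂ → ℂ) (j : ℕ) (F : ℂ → ℂ) : Prop :=
  ∃ A B : ℂ[X], A.natDegree ≤ j ∧ B.natDegree ≤ j ∧
    ∀ x, x ≠ 0 → F x = A.eval (x + x⁻¹) * g x + B.eval (x + x⁻¹) * h x

open Polynomial in
theorem IsCombination.step {g h F G : ℂ → ℂ} {j k : ℕ} (hF : IsCombination g h j F)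
    (hG : IsCombination g h k G) (hk : k ≤ j + 1) (α β γ : ℂ) :
    IsCombination g h (j + 1) fun x => (α * (x + x⁻¹) + β) * F x + γ * G x := by
  obtain ⟨A, B, hA, hB, e⟩ := hF
  obtain ⟨A', B', hA', hB', e'⟩ := hG
  have hl : (C α * X + C β : ℂ[X]).natDegree ≤ 1 := by compute_degree
  have hd : ∀ U V : ℂ[X], U.natDegree ≤ j → V.natDegree ≤ k →
      ((C α * X + C β) * U + C γ * V).natDegree ≤ j + 1 := fun U V hU hV =>
    natDegree_add_le_of_degree_le
      (natDegree_mul_le.trans ((add_le_add hl hU).trans (by omega)))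
      ((natDegree_C_mul_le _ _).trans (hV.trans hk))
  refine ⟨(C α * X + C β) * A + C γ * A', (C α * X + C β) * B + C γ * B', hd _ _ hA hA',
    hd _ _ hB hB', fun x hx => ?_⟩
  simp only [e x hx, e' x hx, eval_add, eval_mul, eval_C, eval_X]
  ring

theorem IsCombination.mono {g h F : ℂ → ℂ} {j k : ℕ} (hF : IsCombination g h j F) (hk : j ≤ k) :
    IsCombination g h k F := by
  obtain ⟨A, B, hA, hB, e⟩ := hF
  exact ⟨A, B, hA.trans hk, hB.trans hk, e⟩

theorem IsCombination.congr {g h F G : ℂ → ℂ} {j : ℕ} (hF : IsCombination g h j F)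
    (hFG : ∀ x, x ≠ 0 → G x = F x) : IsCombination g h j G := by
  obtain ⟨A, B, hA, hB, e⟩ := hF
  exact ⟨A, B, hA, hB, fun x hx => (hFG x hx).trans (e x hx)⟩

theorem IsCombination.left (g h : ℂ → ℂ) (j : ℕ) : IsCombination g h j g :=
  ⟨1, 0, by simp, by simp, fun x _ => by simp⟩

theorem IsCombination.right (g h : ℂ → ℂ) (j : ℕ) : IsCombination g h j h :=
  ⟨0, 1, by simp, by simp, fun x _ => by simp⟩

/-- The Rogers polynomials of degree at least `n + 2` and of the same parity, scaled by a power of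
`x`, are combinations of `f_{n+2}` and `x f_n`. -/
theorem isCombination_rogers_up {q : ℂ} (hq : NotRootOfUnity q) (n i : ℕ) :
    IsCombination (fun x => rogers q (n + 2) x) (fun x => x * rogers q n x) i
      fun x => (x ^ i)⁻¹ * rogers q (n + 2 + 2 * i) x := by
  induction i using Nat.twoStepInduction with
  | zero => exact (IsCombination.left _ _ 0).congr fun x _ => by simp
  | one =>
    obtain ⟨α, β, γ, -, e⟩ := rogers_add_four hq n
    refine ((IsCombination.left _ _ 0).step (IsCombination.right _ _ 0) zero_le_one α β γ).congr
      fun x hx => ?_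
    rw [show n + 2 + 2 * 1 = n + 4 by ring, e x hx]
    field_simp
  | more i h0 h1 =>
    obtain ⟨α, β, γ, -, e⟩ := rogers_add_four hq (n + 2 + 2 * i)
    refine (h1.step h0 (by omega) α β γ).congr fun x hx => ?_
    rw [show n + 2 + 2 * (i + 2) = n + 2 + 2 * i + 4 by ring, e x hx,
      show n + 2 + 2 * (i + 1) = n + 2 + 2 * i + 2 by ring]
    field_simp
    ring

/-- The Rogers polynomials of degree at most `n` and of the same parity, scaled by a power of `x`,
are combinations of `f_{n+2}` and `x f_n`. -/
theorem isCombination_rogers_down {q : ℂ} (hq : NotRootOfUnity q) (n i : ℕ) (hi : 2 * i ≤ n) :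
    IsCombination (fun x => rogers q (n + 2) x) (fun x => x * rogers q n x) i
      fun x => x ^ i * (x * rogers q (n - 2 * i) x) := by
  induction i using Nat.twoStepInduction with
  | zero => exact (IsCombination.right _ _ 0).congr fun x _ => by simp
  | one =>
    obtain ⟨k, rfl⟩ : ∃ k, n = k + 2 := ⟨n - 2, by omega⟩
    obtain ⟨α, β, γ, hγ, e⟩ := rogers_add_four hq k
    refine ((IsCombination.right _ _ 0).step (IsCombination.left _ _ 0) zero_le_one
      (-(α / γ)) (-(β / γ)) (1 / γ)).congr fun x hx => ?_
    rw [show k + 2 - 2 * 1 = k by omega, e x hx]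
    field_simp
    ring
  | more i h0 h1 =>
    obtain ⟨k, rfl⟩ : ∃ k, n = k + 2 * (i + 2) := ⟨n - 2 * (i + 2), by omega⟩
    obtain ⟨α, β, γ, hγ, e⟩ := rogers_add_four hq k
    refine ((h1 (by omega)).step (h0 (by omega)) (by omega)
      (-(α / γ)) (-(β / γ)) (1 / γ)).congr fun x hx => ?_
    rw [show k + 2 * (i + 2) - 2 * (i + 2) = k by omega,
      show k + 2 * (i + 2) - 2 * (i + 1) = k + 2 by omega,
      show k + 2 * (i + 2) - 2 * i = k + 4 by omega, e x hx]
    field_simp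
    ring

theorem sum_range_two_mul (F : ℕ → ℂ) (N : ℕ) :
    ∑ c ∈ range (2 * N), F c = ∑ j ∈ range N, (F (2 * j) + F (2 * j + 1)) := by
  induction N with
  | zero => simp
  | succ N ih => rw [mul_add, sum_range_succ, sum_range_succ, sum_range_succ, ih, add_assoc]

theorem IsCombination.exists_coeff {g h F : ℂ → ℂ} {μ : ℕ} (hF : IsCombination g h μ F) :
    ∃ K : ℕ → ℂ, ∀ x, x ≠ 0 → F x = ∑ c : Fin (2 * μ + 2),
      ((if Even (c : ℕ) then g x else h x) * (x + x⁻¹) ^ ((c : ℕ) / 2)) * K c := by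
  obtain ⟨A, B, hA, hB, e⟩ := hF
  refine ⟨fun c => if Even c then A.coeff (c / 2) else B.coeff (c / 2), fun x hx => ?_⟩
  rw [Fin.sum_univ_eq_sum_range (fun c => ((if Even c then g x else h x) *
    (x + x⁻¹) ^ (c / 2)) * if Even c then A.coeff (c / 2) else B.coeff (c / 2)),
    show 2 * μ + 2 = 2 * (μ + 1) by ring, sum_range_two_mul, e x hx,
    Polynomial.eval_eq_sum_range' (Nat.lt_succ_of_le hA),
    Polynomial.eval_eq_sum_range' (Nat.lt_succ_of_le hB), sum_mul, sum_mul, ← sum_add_distrib]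
  refine sum_congr rfl fun j _ => ?_
  have h1 : Even (2 * j) := by simp
  have h2 : ¬ Even (2 * j + 1) := by simp
  have h3 : (2 * j + 1) / 2 = j := by omega
  have h4 : 2 * j / 2 = j := by omega
  simp only [h1, h2, h3, h4, if_true, if_false]
  ring

/-- In an even number of variables, the columns of `rogersDet` are fixed combinations of those of a
`pairMatrix`, so that the two determinants are proportional. -/
theorem exists_rogersDet_eq {q : ℂ} (hq : NotRootOfUnity q) (d μ : ℕ) :
    ∃ κ : ℂ, ∀ x : Fin (2 * μ + 2) → ℂ, (∀ i, x i ≠ 0) → rogersDet q d x = (∏ i, x i ^ μ) *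
      (pairMatrix (fun i => rogers q (d + 2 * μ + 2) (x i))
        (fun i => x i * rogers q (d + 2 * μ) (x i)) fun i => x i + (x i)⁻¹).det * κ := by
  have h : ∀ s : Fin (2 * μ + 2), ∃ K : ℕ → ℂ, ∀ x, x ≠ 0 →
      x ^ (s : ℕ) * rogers q (d + 2 * (2 * μ + 2 - 1 - s)) x = x ^ μ * ∑ c : Fin (2 * μ + 2),
      ((if Even (c : ℕ) then rogers q (d + 2 * μ + 2) x else x * rogers q (d + 2 * μ) x) *
        (x + x⁻¹) ^ ((c : ℕ) / 2)) * K c := by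
    intro s
    rcases le_or_gt (s : ℕ) μ with hs | hs
    · obtain ⟨K, hK⟩ := ((isCombination_rogers_up hq (d + 2 * μ) (μ - s)).mono
        (Nat.sub_le μ s)).exists_coeff
      refine ⟨K, fun x hx => ?_⟩
      rw [← hK x hx, show d + 2 * μ + 2 + 2 * (μ - s) = d + 2 * (2 * μ + 2 - 1 - s) by omega,
        ← mul_assoc]
      congr 1
      rw [eq_mul_inv_iff_mul_eq₀ (pow_ne_zero _ hx), ← pow_add]
      congr 1
      omega
    · obtain ⟨K, hK⟩ := ((isCombination_rogers_down hq (d + 2 * μ) (s - μ - 1) (by omega)).mono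
        (show (s : ℕ) - μ - 1 ≤ μ by omega)).exists_coeff
      refine ⟨K, fun x hx => ?_⟩
      rw [← hK x hx, show d + 2 * μ - 2 * (s - μ - 1) = d + 2 * (2 * μ + 2 - 1 - s) by omega,
        ← mul_assoc, ← mul_assoc, ← pow_add, ← pow_succ]
      congr 2
      omega
  choose K hK using h
  refine ⟨(Matrix.of fun c s : Fin (2 * μ + 2) => K s c).det, fun x hx => ?_⟩
  rw [← Matrix.det_mul_column, ← Matrix.det_mul, rogersDet]
  congr 1
  ext i s
  simp only [Matrix.mul_apply, Matrix.of_apply, pairMatrix, hK s _ (hx i), mul_sum]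
  exact sum_congr rfl fun c _ => by ring

theorem continuous_rogersDet (q : ℂ) (d : ℕ) {m : ℕ} :
    Continuous fun x : Fin m → ℂ => rogersDet q d x := by
  unfold rogersDet
  refine Continuous.matrix_det (continuous_matrix fun i s => ?_)
  exact ((continuous_apply i).pow _).mul ((continuous_rogers q _).comp (continuous_apply i))

/-- Setting a variable to zero in `rogersDet` removes it, in the same manner as for `P`. -/
theorem rogersDet_cons_zero (q : ℂ) (d : ℕ) {m : ℕ} (x : Fin m → ℂ) :
    rogersDet q d (Fin.cons 0 x : Fin (m + 1) → ℂ) =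
      coef q ((d + 2 * m : ℕ) : ℤ) * (∏ i, x i) * rogersDet q d x := by
  rw [mul_assoc (coef q _) (∏ i, x i), rogersDet, rogersDet, ← Matrix.det_mul_column,
    Matrix.det_succ_row_zero, Fin.sum_univ_succ, sum_eq_zero, add_zero]
  · simp only [Fin.val_zero, pow_zero, Matrix.of_apply, Fin.cons_zero, one_mul, rogers_eval_zero,
      Nat.add_sub_cancel, Nat.sub_zero]
    congr 2
    ext i s
    simp only [Matrix.submatrix_apply, Matrix.of_apply, Fin.cons_succ, Fin.zero_succAbove,
      Fin.val_succ, pow_succ]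
    rw [show m - (s + 1) = m - 1 - (s : ℕ) by omega]
    ring
  · intro c _
    simp

theorem eventually_ne_zero_cons {m : ℕ} {x : Fin m → ℂ} (hx : ∀ i, x i ≠ 0) :
    ∀ᶠ y in nhdsWithin (0 : ℂ) {0}ᶜ, ∀ i, (Fin.cons y x : Fin (m + 1) → ℂ) i ≠ 0 := by
  filter_upwards [self_mem_nhdsWithin] with y hy i
  refine Fin.cases ?_ (fun i => ?_) i
  · simpa using hy
  · simpa using hx i

theorem continuous_cons {m : ℕ} (x : Fin m → ℂ) :
    Continuous fun y : ℂ => (Fin.cons y x : Fin (m + 1) → ℂ) := by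
  refine continuous_pi fun i => ?_
  refine Fin.cases ?_ (fun i => ?_) i
  · simpa using continuous_id'
  · simpa using continuous_const

/-- By induction: the variables found so far, together with a new one close to zero, will do. -/
theorem exists_rogersDet_ne_zero {q : ℂ} (hq : NotRootOfUnity q) (d m : ℕ) :
    ∃ x : Fin m → ℂ, (∀ i, x i ≠ 0) ∧ rogersDet q d x ≠ 0 := by
  induction m with
  | zero => exact ⟨fun i => i.elim0, fun i => i.elim0, by simp [rogersDet]⟩
  | succ m ih =>
    obtain ⟨x, hx, hD⟩ := ih
    have h0 : rogersDet q d (Fin.cons 0 x : Fin (m + 1) → ℂ) ≠ 0 := by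
      rw [rogersDet_cons_zero]
      exact mul_ne_zero (mul_ne_zero (coef_ne_zero hq _) (prod_ne_zero_iff.mpr fun i _ => hx i)) hD
    have hc := ((continuous_rogersDet q d).comp (continuous_cons x)).continuousAt.eventually_ne h0
    obtain ⟨y, hy1, hy2⟩ := ((eventually_ne_zero_cons hx).and (nhdsWithin_le_nhds hc)).exists
    exact ⟨_, hy1, hy2⟩

theorem continuous_pairProd_one_sub {m : ℕ} :
    Continuous fun x : Fin m → ℂ => pairProd fun i j => 1 - x i * x j := by
  unfold pairProd
  fun_prop

theorem pairProd_one_sub_cons_zero {m : ℕ} (x : Fin m → ℂ) :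
    (pairProd fun i j => 1 - (Fin.cons 0 x : Fin (m + 1) → ℂ) i *
      (Fin.cons 0 x : Fin (m + 1) → ℂ) j)
      = pairProd fun i j => 1 - x i * x j := by
  rw [pairProd_succ]
  simp

/-- Letting one of the variables tend to zero in a proportionality between `P` and `rogersDet`. -/
theorem proportional_of_succ {q : ℂ} (hq : NotRootOfUnity q) {d m : ℕ} {c : ℂ}
    (h : ∀ x : Fin (m + 2) → ℂ, (∀ i, x i ≠ 0) →
      pairProd (fun i j => 1 - x i * x j) * P (d + m + 1) q x = c * rogersDet q d x)
    {x : Fin (m + 1) → ℂ} (hx : ∀ i, x i ≠ 0) :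
    coef q ((d + m + 1 : ℕ) : ℤ) * (pairProd (fun i j => 1 - x i * x j) * P (d + m) q x) =
      c * coef q ((d + 2 * (m + 1) : ℕ) : ℤ) * rogersDet q d x := by
  have hL := (((continuous_pairProd_one_sub.mul (continuous_P (d + m + 1) q)).comp
    (continuous_cons x)).tendsto 0).mono_left (nhdsWithin_le_nhds (s := {0}ᶜ))
  have hR := (((continuous_rogersDet q d).const_mul c).comp
    (continuous_cons x)).continuousAt.tendsto.mono_left (nhdsWithin_le_nhds (a := 0) (s := {0}ᶜ))
  have key := tendsto_nhds_unique_of_eventuallyEq hL hR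
    ((eventually_ne_zero_cons hx).mono fun y hy => h _ hy)
  have hp : ∏ i, x i ≠ 0 := prod_ne_zero_iff.mpr fun i _ => hx i
  simp only [Function.comp, Pi.mul_apply] at key
  rw [pairProd_one_sub_cons_zero, P_cons_zero hq, rogersDet_cons_zero] at key
  apply mul_left_cancel₀ hp
  linear_combination key

/-- The proportionality of `P` and `rogersDet` in an even number `2 * μ + 2` of variables. The
constant found here depends on that of `exists_rogersDet_eq`; it is made explicit in
`pairProd_mul_P`. -/
theorem exists_proportional_of_even {q : ℂ} (hq : NotRootOfUnity q) (d μ : ℕ) :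
    ∃ c : ℂ, ∀ x : Fin (2 * μ + 2) → ℂ, (∀ i, x i ≠ 0) →
      pairProd (fun i j => 1 - x i * x j) * P (d + 2 * μ + 1) q x = c * rogersDet q d x := by
  obtain ⟨κ, hκ⟩ := exists_rogersDet_eq hq d μ
  obtain ⟨z, hz, hDz⟩ := exists_rogersDet_ne_zero hq d (2 * μ + 2)
  -- the constant of proportionality does not vanish, since `rogersDet` is not identically zero
  have hκ0 : κ ≠ 0 := by
    rintro rfl
    rw [hκ z hz, mul_zero] at hDz
    exact hDz rfl
  refine ⟨((1 - q ^ (d + 2 * μ + 2)) / (1 + q ^ (d + 2 * μ + 2))) ^ (μ + 1) / κ, fun x hx => ?_⟩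
  have hp : ∏ i, x i ≠ 0 := prod_ne_zero_iff.mpr fun i _ => hx i
  have h : (∏ i, x i) * (pairProd (fun i j => 1 - x i * x j) * P (d + 2 * μ + 1) q x) =
      ((1 - q ^ (d + 2 * μ + 2)) / (1 + q ^ (d + 2 * μ + 2))) ^ (μ + 1) * (∏ i, x i ^ (μ + 1)) *
        (pairMatrix (fun i => rogers q (d + 2 * μ + 2) (x i))
          (fun i => x i * rogers q (d + 2 * μ) (x i)) fun i => x i + (x i)⁻¹).det :=
    pairProd_mul_P_eq_det_pairMatrix hq (d + 2 * μ) (μ + 1) hx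
  apply mul_left_cancel₀ hp
  rw [h, hκ x hx]
  simp only [pow_succ (x _), prod_mul_distrib]
  generalize pairMatrix _ _ _ = K
  field_simp

/-- The product of `P` and the `1 - x i * x j` is a multiple of a determinant of Rogers polynomials.
An odd number of variables is obtained from the next even number by letting a variable tend to
zero; the same limit gives the constants by recursion. -/
theorem pairProd_mul_P {q : ℂ} (hq : NotRootOfUnity q) (d m : ℕ) {x : Fin (m + 1) → ℂ}
    (hx : ∀ i, x i ≠ 0) :
    pairProd (fun i j => 1 - x i * x j) * P (d + m) q x =
      (∏ t ∈ range (m + 1), coef q ((d + t : ℕ) : ℤ) / coef q ((d + 2 * t : ℕ) : ℤ)) *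
        rogersDet q d x := by
  have hex : ∀ m : ℕ, ∃ c : ℂ, ∀ x : Fin (m + 1) → ℂ, (∀ i, x i ≠ 0) →
      pairProd (fun i j => 1 - x i * x j) * P (d + m) q x = c * rogersDet q d x := by
    intro m
    obtain ⟨μ, rfl | rfl⟩ := Nat.even_or_odd' m
    · obtain ⟨c, hc⟩ := exists_proportional_of_even hq d μ
      refine ⟨c * coef q ((d + 2 * (2 * μ + 1) : ℕ) : ℤ) / coef q ((d + 2 * μ + 1 : ℕ) : ℤ),
        fun x hx => ?_⟩
      rw [div_mul_eq_mul_div, eq_div_iff (coef_ne_zero hq _), mul_comm,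
        proportional_of_succ hq hc hx]
    · exact exists_proportional_of_even hq d μ
  induction m with
  | zero =>
    have : coef q (d : ℤ) ≠ 0 := coef_ne_zero hq d
    simp [pairProd, P_one hq, rogersDet, this]
  | succ m ih =>
    obtain ⟨c, hc⟩ := hex (m + 1)
    obtain ⟨z, hz, hDz⟩ := exists_rogersDet_ne_zero hq d (m + 1)
    have h := proportional_of_succ hq hc hz
    rw [ih hz] at h
    have h1 := coef_ne_zero hq (d + 2 * (m + 1))
    have h2 : c = (∏ t ∈ range (m + 1 + 1),
        coef q ((d + t : ℕ) : ℤ) / coef q ((d + 2 * t : ℕ) : ℤ)) := by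
      rw [prod_range_succ, mul_div_assoc', eq_div_iff h1]
      apply mul_right_cancel₀ hDz
      rw [← h, ← add_assoc d m 1]
      ring
    rw [← h2]
    exact hc x hx

/-! ### Rogers polynomials as basic hypergeometric series -/

theorem qp_inv_pow_eq_zero {b : ℂ} (hb : b ≠ 0) {N k : ℕ} (h : N < k) : qp (b ^ N)⁻¹ b k = 0 :=
  prod_eq_zero (mem_range.mpr h) (by rw [inv_mul_cancel₀ (pow_ne_zero _ hb), sub_self])

/-- Two families of basic hypergeometric series in `(a x, a / x; b)_k` that satisfy the recurrence
of the Rogers polynomials coefficient by coefficient. The hypotheses `h₁` and `h₂` are the two steps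
of the recurrence after removal of common factors, with `X` in place of a power of `b`; the
denominators satisfy `den' k / den k = (1 - a b^k) / (1 - a)`. -/
theorem rogers_eq_series {q a b c d ε : ℂ} (hq : NotRootOfUnity q) (ha : a ≠ 0)
    (hb : NotRootOfUnity b) (hε : ∀ j : ℕ, 1 ≤ j → 1 - ε * b ^ j ≠ 0)
    (hab : ∀ j : ℕ, 1 - a * b ^ j ≠ 0) {den den' : ℕ → ℂ}
    (hden : ∀ k, den (k + 1) = den k * ((1 - b * b ^ k) * (1 - a * b ^ k) *
      (1 - a * c * b ^ k) * (1 - a * d * b ^ k)))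
    (hden_zero : den 0 = 1) (hden_ne : ∀ k, den k ≠ 0)
    (hden' : ∀ k, den' k = den k * (1 - a * b ^ k) / (1 - a)) {ν μ : ℕ → ℂ} (hν : ν 0 = 1)
    (hμ : μ 0 = (1 + q) / (1 - q))
    (h₁ : ∀ (N : ℕ) (X : ℂ), (1 - a) * (μ (N + 1) * (1 - (b ^ (N + 1))⁻¹) *
        (1 - ε * b ^ (N + 2) * X) - μ N * (1 - ε * b ^ (N + 2)) * (1 - (b ^ (N + 1))⁻¹ * X)) =
      (1 + q ^ (2 * N + 3)) / (1 - q ^ (2 * N + 3)) * ν (N + 1) * (1 - (b ^ (N + 1))⁻¹) *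
        (1 - ε * b ^ (N + 2)) * (1 - a * X))
    (h₂ : ∀ (N : ℕ) (X : ℂ), X ≠ 0 → ν (N + 1) * (1 - (b ^ (N + 1))⁻¹) * (1 - ε * b ^ (N + 2) * X)
        - ν N * (1 - (b ^ N)⁻¹ * X) * (1 - ε * b ^ (N + 1)) =
      (1 + q ^ (2 * N + 2)) / (1 - q ^ (2 * N + 2)) * μ N * (1 - a) / (a * b * X) *
        ((1 - (b ^ N)⁻¹ * X) * (1 - ε * b ^ (N + 2) * X) * (1 - a * b * X) -
          (1 - b * X) * (1 - a * c * X) * (1 - a * d * X)))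
    (N : ℕ) {x : ℂ} (hx : x ≠ 0) :
    rogers q (2 * N) x = ν N * x ^ N * ∑ k ∈ range (N + 1), qp (b ^ N)⁻¹ b k *
        qp (ε * b ^ (N + 1)) b k / den k * b ^ k * (qp (a * x) b k * qp (a / x) b k) ∧
    rogers q (2 * N + 1) x = μ N * (1 - x) * x ^ N * ∑ k ∈ range (N + 1), qp (b ^ N)⁻¹ b k *
        qp (ε * b ^ (N + 2)) b k / den' k * b ^ k * (qp (a * x) b k * qp (a / x) b k) := by
  set φ : ℕ → ℂ := fun k => qp (a * x) b k * qp (a / x) b k with hφ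
  set s : ℕ → ℕ → ℂ := fun N k =>
    ν N * (qp (b ^ N)⁻¹ b k * qp (ε * b ^ (N + 1)) b k / den k * b ^ k) with hs
  set r : ℕ → ℕ → ℂ := fun N k =>
    μ N * (qp (b ^ N)⁻¹ b k * qp (ε * b ^ (N + 2)) b k / den' k * b ^ k) with hr
  have hb0 := hb.ne_zero
  have ha1 : 1 - a ≠ 0 := by simpa using hab 0
  have hbN : ∀ N : ℕ, 1 - (b ^ (N + 1))⁻¹ ≠ 0 := fun N h => by
    refine hb.2 (N + 1) (by omega) ?_
    rw [sub_eq_zero, eq_comm, inv_eq_one] at h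
    exact h
  have hs_zero : ∀ N k, N < k → s N k = 0 := fun N k h => by
    simp only [hs, qp_inv_pow_eq_zero hb0 h]; ring
  have hr_zero : ∀ N k, N < k → r N k = 0 := fun N k h => by
    simp only [hr, qp_inv_pow_eq_zero hb0 h]; ring
  have hφ_succ : ∀ k, φ (k + 1) = φ k * (1 + a ^ 2 * b ^ (2 * k) - a * b ^ k * (x + x⁻¹)) :=
    fun k => by
      simp only [hφ, qp_succ]
      field_simp
      ring
  have hshift : ∀ N : ℕ, (b ^ (N + 1))⁻¹ * b = (b ^ N)⁻¹ := fun N => by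
    rw [pow_succ]
    field_simp
  have hshift' : ∀ N : ℕ, ε * b ^ N * b = ε * b ^ (N + 1) := fun N => by ring
  -- the recurrence of the coefficients, from even to odd degree
  have rec_r : ∀ N k, r (N + 1) k =
      r N k + (1 + q ^ (2 * N + 3)) / (1 - q ^ (2 * N + 3)) * s (N + 1) k := by
    intro N k
    have hN := hbN N
    have hE := hε (N + 2) (by omega)
    rcases k with _ | k
    · have h := h₁ N 1
      simp only [hr, hs, qp_zero, hden', hden_zero, pow_zero, mul_one] at h ⊢
      apply mul_left_cancel₀ (mul_ne_zero (mul_ne_zero ha1 hN) hE)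
      field_simp at h ⊢
      linear_combination h
    · have h := h₁ N (b ^ (k + 1))
      have hD := hden_ne (k + 1)
      have hA := hab (k + 1)
      have e1 : qp (b ^ (N + 1))⁻¹ b (k + 1) = (1 - (b ^ (N + 1))⁻¹) * qp (b ^ N)⁻¹ b k := by
        rw [qp_succ', hshift]
      have e2 : qp (b ^ N)⁻¹ b (k + 1) =
          qp (b ^ N)⁻¹ b k * (1 - (b ^ (N + 1))⁻¹ * b ^ (k + 1)) := by
        rw [qp_succ, ← hshift, pow_succ' b k, mul_assoc]
      have e3 : qp (ε * b ^ (N + 3)) b (k + 1) =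
          qp (ε * b ^ (N + 3)) b k * (1 - ε * b ^ (N + 2) * b ^ (k + 1)) := by
        rw [qp_succ]; ring
      have e4 : qp (ε * b ^ (N + 2)) b (k + 1) =
          (1 - ε * b ^ (N + 2)) * qp (ε * b ^ (N + 3)) b k := by
        rw [qp_succ', hshift']
      simp only [hr, hs, hden', add_assoc, Nat.reduceAdd, e1, e2, e3, e4]
      generalize b ^ (k + 1) = X at *
      generalize (b ^ (N + 1))⁻¹ = Y at *
      generalize (1 + q ^ (2 * N + 3)) / (1 - q ^ (2 * N + 3)) = ρ at *
      clear_value s r φ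
      generalize 1 - a * X = A at *
      generalize 1 - a = A' at *
      generalize qp (b ^ N)⁻¹ b k = p at *
      generalize qp (ε * b ^ (N + 3)) b k = e at *
      generalize den (k + 1) = D at *
      field_simp
      linear_combination (p * e * X) * h
  -- the recurrence of the coefficients, from odd to even degree: here `x + x⁻¹ - 2` multiplies
  -- the series, and `hφ_succ` expresses its effect on `φ k` through `φ k` and `φ (k + 1)`
  have rec_s : ∀ N k, s (N + 1) (k + 1) =
      s N (k + 1) + (1 + q ^ (2 * N + 2)) / (1 - q ^ (2 * N + 2)) *
        ((1 - a * b ^ (k + 1)) ^ 2 / (a * b ^ (k + 1)) * r N (k + 1) - r N k / (a * b ^ k)) := by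
    intro N k
    have hX : b ^ k ≠ 0 := pow_ne_zero _ hb0
    have h := h₂ N (b ^ k) hX
    have hD := hden_ne k
    have hD' := hden_ne (k + 1)
    have hA := hab (k + 1)
    have hA' := hab k
    have e1 : qp (b ^ (N + 1))⁻¹ b (k + 1) = (1 - (b ^ (N + 1))⁻¹) * qp (b ^ N)⁻¹ b k := by
      rw [qp_succ', hshift]
    have e2 : qp (b ^ N)⁻¹ b (k + 1) = qp (b ^ N)⁻¹ b k * (1 - (b ^ N)⁻¹ * b ^ k) := qp_succ _ _ _
    have e3 : qp (ε * b ^ (N + 2)) b (k + 1) =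
        qp (ε * b ^ (N + 2)) b k * (1 - ε * b ^ (N + 2) * b ^ k) := qp_succ _ _ _
    have e4 : qp (ε * b ^ (N + 1)) b (k + 1) =
        (1 - ε * b ^ (N + 1)) * qp (ε * b ^ (N + 2)) b k := by rw [qp_succ', hshift']
    simp only [hr, hs, hden', add_assoc, Nat.reduceAdd, e1, e2, e3, e4]
    have hG : (1 - b * b ^ k) * (1 - a * c * b ^ k) * (1 - a * d * b ^ k) ≠ 0 := by
      intro h0
      rw [hden k] at hD'
      apply hD'
      linear_combination den k * (1 - a * b ^ k) * h0
    rw [hden k, pow_succ b k]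
    rw [pow_succ b k] at hA
    clear_value s r φ
    generalize b ^ k = X at *
    generalize (b ^ (N + 1))⁻¹ = Y at *
    generalize (b ^ N)⁻¹ = Y' at *
    generalize (1 + q ^ (2 * N + 2)) / (1 - q ^ (2 * N + 2)) = ρ at *
    generalize qp Y' b k = p at *
    generalize qp (ε * b ^ (N + 2)) b k = e at *
    generalize den k = D at *
    generalize hZ : (1 - b * X) * (1 - a * c * X) * (1 - a * d * X) = G at *
    have hDG : D * ((1 - b * X) * (1 - a * X) * (1 - a * c * X) * (1 - a * d * X)) =
        D * G * (1 - a * X) := by rw [← hZ]; ring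
    rw [hDG]
    have h' : (ν (N + 1) * (1 - Y) * (1 - ε * b ^ (N + 2) * X)
        - ν N * (1 - Y' * X) * (1 - ε * b ^ (N + 1))) * (b * X) = ρ * μ N * (1 - a) / a *
        ((1 - Y' * X) * (1 - ε * b ^ (N + 2) * X) * (1 - a * b * X) - G) := by
      rw [h]
      field_simp
    have E1 : (1 - a * (X * b)) ^ 2 / (a * (X * b)) * (μ N * (p * (1 - Y' * X) *
        (e * (1 - ε * b ^ (N + 2) * X)) /
          (D * G * (1 - a * X) * (1 - a * (X * b)) / (1 - a)) * (X * b))) =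
        μ N * (1 - a) / a * ((1 - Y' * X) * (1 - ε * b ^ (N + 2) * X) * (1 - a * b * X)) *
          (p * e / (D * G * (1 - a * X))) := by
      have h1 : 1 - a * b * X = 1 - a * (X * b) := by ring
      rw [h1]
      generalize 1 - a * (X * b) = A at *
      generalize 1 - a * X = A' at *
      generalize 1 - a = A'' at *
      field_simp
    have E2 : μ N * (p * e / (D * (1 - a * X) / (1 - a)) * X) / (a * X) =
        μ N * (1 - a) / a * G * (p * e / (D * G * (1 - a * X))) := by
      generalize 1 - a * X = A' at *
      generalize 1 - a = A'' at *
      field_simp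
    rw [E1, E2]
    linear_combination (p * e / (D * G * (1 - a * X))) * h'
  have rec_s0 : ∀ N, s (N + 1) 0 = s N 0 + (1 + q ^ (2 * N + 2)) / (1 - q ^ (2 * N + 2)) *
      ((1 - a * b ^ 0) ^ 2 / (a * b ^ 0) * r N 0) := by
    intro N
    -- the coefficient of index `0` is the case `k = -1` of `rec_s`, so `X = b^k` is `b⁻¹`
    have h := h₂ N b⁻¹ (inv_ne_zero hb0)
    have hE := hε (N + 1) (by omega)
    simp only [hr, hs, qp_zero, hden', hden_zero, pow_zero, mul_one, one_mul, div_self ha1, div_one]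
    apply mul_left_cancel₀ (mul_ne_zero (hbN N) hE)
    have h1 : (b ^ N)⁻¹ * b⁻¹ = (b ^ (N + 1))⁻¹ := by rw [pow_succ, mul_inv]
    have h2 : ε * b ^ (N + 2) * b⁻¹ = ε * b ^ (N + 1) := by rw [pow_succ b (N + 1)]; field_simp
    rw [h1, h2, mul_inv_cancel₀ hb0, mul_assoc a b, mul_inv_cancel₀ hb0] at h
    generalize (b ^ (N + 1))⁻¹ = Y at *
    generalize (1 + q ^ (2 * N + 2)) / (1 - q ^ (2 * N + 2)) = ρ at *
    linear_combination h
  have hsum_r : ∀ N, ∑ k ∈ range (N + 2), r (N + 1) k * φ k = ∑ k ∈ range (N + 1), r N k * φ k +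
      (1 + q ^ (2 * N + 3)) / (1 - q ^ (2 * N + 3)) * ∑ k ∈ range (N + 2), s (N + 1) k * φ k := by
    intro N
    rw [← sum_range_succ_eq_of_zero (n := N + 1) (f := fun k => r N k * φ k)
      (by rw [hr_zero N (N + 1) (by omega), zero_mul]), mul_sum, ← sum_add_distrib]
    exact sum_congr rfl fun k _ => by rw [rec_r]; ring
  have hsum_s : ∀ N, ∑ k ∈ range (N + 2), s (N + 1) k * φ k = ∑ k ∈ range (N + 1), s N k * φ k +
      (1 + q ^ (2 * N + 2)) / (1 - q ^ (2 * N + 2)) *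
        ((x + x⁻¹ - 2) * ∑ k ∈ range (N + 1), r N k * φ k) := by
    intro N
    have h1 : (x + x⁻¹ - 2) * ∑ k ∈ range (N + 1), r N k * φ k =
        ∑ k ∈ range (N + 2), (1 - a * b ^ k) ^ 2 / (a * b ^ k) * r N k * φ k -
          ∑ k ∈ range (N + 1), r N k / (a * b ^ k) * φ (k + 1) := by
      rw [sum_range_succ_eq_of_zero (n := N + 1)
        (by rw [hr_zero N (N + 1) (by omega), mul_zero, zero_mul]), mul_sum, ← sum_sub_distrib]
      refine sum_congr rfl fun k _ => ?_
      have hX : b ^ k ≠ 0 := pow_ne_zero _ hb0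
      rw [hφ_succ, mul_comm 2 k, pow_mul]
      field_simp
      ring
    rw [h1, ← sum_range_succ_eq_of_zero (n := N + 1) (f := fun k => s N k * φ k)
      (by rw [hs_zero N (N + 1) (by omega), zero_mul]), sum_range_succ', sum_range_succ' _ (N + 1),
      sum_range_succ' _ (N + 1), rec_s0]
    have h2 : ∀ k, s (N + 1) (k + 1) * φ (k + 1) = s N (k + 1) * φ (k + 1) +
        (1 + q ^ (2 * N + 2)) / (1 - q ^ (2 * N + 2)) *
          ((1 - a * b ^ (k + 1)) ^ 2 / (a * b ^ (k + 1)) * r N (k + 1) * φ (k + 1) -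
            r N k / (a * b ^ k) * φ (k + 1)) := fun k => by rw [rec_s]; ring
    rw [sum_congr rfl fun k _ => h2 k, sum_add_distrib, ← mul_sum, sum_sub_distrib]
    ring
  have key : rogers q (2 * N) x = x ^ N * ∑ k ∈ range (N + 1), s N k * φ k ∧
      rogers q (2 * N + 1) x = (1 - x) * x ^ N * ∑ k ∈ range (N + 1), r N k * φ k := by
    induction N with
    | zero => simp [rogers_zero, rogers_one hq, hs, hr, hφ, qp_zero, hden_zero, hν, hden', hμ, ha1,
        mul_comm]
    | succ N ih =>
      have h1 : rogers q (2 * (N + 1)) x =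
          x ^ (N + 1) * ∑ k ∈ range (N + 1 + 1), s (N + 1) k * φ k := by
        rw [hsum_s, show 2 * (N + 1) = 2 * N + 2 by ring, rogers_succ_succ hq, ih.1, ih.2]
        generalize (1 + q ^ (2 * N + 2)) / (1 - q ^ (2 * N + 2)) = ρ
        field_simp
        ring
      refine ⟨h1, ?_⟩
      rw [show 2 * (N + 1) + 1 = 2 * N + 1 + 2 by ring, rogers_succ_succ hq,
        show 2 * N + 1 + 1 = 2 * (N + 1) by ring, h1, ih.2, hsum_r]
      ring
  rw [key.1, key.2]
  constructor
  · rw [mul_comm (ν N), mul_assoc, mul_sum (a := ν N)]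
    congr 1
    exact sum_congr rfl fun k _ => by rw [hs]; ring
  · rw [mul_assoc (μ N), mul_comm (μ N), mul_assoc _ (μ N), mul_sum (a := μ N)]
    congr 1
    exact sum_congr rfl fun k _ => by rw [hr]; ring

/-! ### From a series in one variable to a multiple series -/

theorem qp_add (a q : ℂ) (k l : ℕ) : qp a q (k + l) = qp a q k * qp (a * q ^ k) q l := by
  simp only [qp, prod_range_add]
  congr 1
  exact prod_congr rfl fun j _ => by ring

/-- `(b^{-N}; b)_s` in terms of `(b; b)_N / (b; b)_{N-s}`. -/
theorem qp_inv_pow_mul {b : ℂ} (hb : b ≠ 0) {N s : ℕ} (hs : s ≤ N) :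
    qp (b ^ N)⁻¹ b s * qp b b (N - s) = (-(b ^ N)⁻¹) ^ s * b ^ s.choose 2 * qp b b N := by
  induction s with
  | zero => simp [qp_zero]
  | succ s ih =>
    have ih := ih (by omega)
    have h1 : qp b b (N - s) = qp b b (N - (s + 1)) * (1 - b ^ (N - s)) := by
      rw [show N - s = N - (s + 1) + 1 by omega, qp_succ, pow_succ']
    have h2 : b ^ N = b ^ (N - s) * b ^ s := by rw [← pow_add]; congr 1; omega
    have h3 : 1 - (b ^ N)⁻¹ * b ^ s = -(b ^ N)⁻¹ * b ^ s * (1 - b ^ (N - s)) := by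
      rw [h2]
      field_simp
      ring
    rw [h1] at ih
    rw [qp_succ, h3, Nat.choose_succ_succ' s 1, Nat.choose_one_right, pow_succ, pow_add]
    linear_combination (-(b ^ N)⁻¹ * b ^ s) * ih

theorem pairProd_eq_prod_range {m : ℕ} (f : ℕ → ℕ → ℂ) :
    (pairProd fun i j : Fin m => f i j) = ∏ j ∈ range m, ∏ i ∈ range j, f i j := by
  rw [pairProd_eq_prod_ite, prod_comm, ← Fin.prod_univ_eq_prod_range
    (fun j => ∏ i ∈ range j, f i j)]
  refine prod_congr rfl fun j _ => ?_
  simp only [Fin.lt_def]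
  rw [Fin.prod_univ_eq_prod_range (fun i => if i < (j : ℕ) then f i j else 1) m, ← prod_filter]
  refine prod_congr ?_ fun _ _ => rfl
  ext i
  simp only [mem_filter, mem_range]
  omega

open Polynomial in
/-- The determinant of the polynomials `(αX; b)_s (γX; b)_{m-s}`, `0 ≤ s ≤ m`, at `m + 1` points:
its ratio to the Vandermonde determinant is found at the points `α⁻¹ b⁻ⁱ`, where the matrix is
triangular. -/
theorem det_qp_mul_qp {b α γ : ℂ} (hb : NotRootOfUnity b) (hα : α ≠ 0) {m : ℕ}
    (X : Fin (m + 1) → ℂ) :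
    (Matrix.of fun i s : Fin (m + 1) => qp (α * X i) b s * qp (γ * X i) b (m - s)).det =
      (∏ s ∈ range (m + 1),
        (-α) ^ s * b ^ s.choose 2 * qp (γ / (α * b ^ s)) b (m - s)) *
        pairProd fun i j => X j - X i := by
  let lin : ℂ → ℕ → ℂ[X] := fun a k => ∏ j ∈ range k, (1 - C (a * b ^ j) * Polynomial.X)
  have hlin : ∀ a k z, (lin a k).eval z = qp (a * z) b k := fun a k z => by
    simp only [lin, eval_prod, eval_sub, eval_one, eval_mul, eval_C, eval_X, qp]
    exact prod_congr rfl fun j _ => by ring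
  have dlin : ∀ a k, (lin a k).natDegree ≤ k := fun a k => by
    refine (natDegree_prod_le _ _).trans ((sum_le_sum fun j _ => ?_).trans
      (by simp : ∑ _ ∈ range k, 1 ≤ k))
    compute_degree
  let p : Fin (m + 1) → ℂ[X] := fun s => lin α s * lin γ (m - s)
  have dp : ∀ s, (p s).natDegree < m + 1 := fun s => by
    have : (p s).natDegree ≤ s + (m - s) :=
        natDegree_mul_le.trans (add_le_add (dlin α s) (dlin γ (m - s)))
    omega
  let K : Matrix (Fin (m + 1)) (Fin (m + 1)) ℂ := Matrix.of fun j s => (p s).coeff j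
  have hK : ∀ X : Fin (m + 1) → ℂ,
      (Matrix.of fun i s : Fin (m + 1) => qp (α * X i) b s * qp (γ * X i) b (m - s)).det =
        (pairProd fun i j => X j - X i) * K.det := fun X => by
    have hv : (Matrix.vandermonde X).det = pairProd fun i j => X j - X i := Matrix.det_vandermonde X
    rw [← hv, ← Matrix.det_mul]
    congr 1
    ext i s
    rw [Matrix.mul_apply, Matrix.of_apply, ← hlin, ← hlin, ← eval_mul,
      eval_eq_sum_range' (dp s), ← Fin.sum_univ_eq_sum_range (fun j => (p s).coeff j * X i ^ j)]
    exact sum_congr rfl fun j _ => mul_comm _ _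
  rw [hK, mul_comm]
  congr 1
  have hb0 := hb.ne_zero
  set Y : ℕ → ℂ := fun i => (α * b ^ i)⁻¹ with hY
  have h1 : ∀ s, α * Y s = (b ^ s)⁻¹ := fun s => by
    simp only [hY, mul_inv]
    field_simp
  have hYne : (pairProd fun i j : Fin (m + 1) => Y j - Y i) ≠ 0 := by
    refine prod_ne_zero_iff.mpr fun i _ => prod_ne_zero_iff.mpr fun j hj h => ?_
    have hij : i < j := mem_Ioi.mp hj
    have h2 : (b ^ (j : ℕ))⁻¹ = (b ^ (i : ℕ))⁻¹ := by rw [← h1, ← h1, sub_eq_zero.mp h]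
    have h3 : b ^ (j : ℕ) = b ^ (i : ℕ) * b ^ ((j : ℕ) - i) := by
      rw [← pow_add]; congr 1; omega
    rw [inv_inj, h3, mul_eq_left₀ (pow_ne_zero _ hb0)] at h2
    exact hb.2 _ (by omega) h2
  apply mul_left_cancel₀ hYne
  rw [← hK fun i => Y i, Matrix.det_of_isLowerTriangular]
  · rw [pairProd_eq_prod_range (fun i j => Y j - Y i), ← prod_mul_distrib]
    simp only [Matrix.of_apply]
    rw [Fin.prod_univ_eq_prod_range (fun s => qp (α * Y s) b s * qp (γ * Y s) b (m - s))]
    refine prod_congr rfl fun s _ => ?_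
    rw [← mul_assoc]
    congr 1
    have h2 : ∀ i ∈ range s, 1 - α * Y s * b ^ i = (-α) * b ^ i * (Y s - Y i) := fun i _ => by
      have h3 : α * Y i * b ^ i = 1 := by
        rw [h1, inv_mul_cancel₀ (pow_ne_zero _ hb0)]
      linear_combination -h3
    rw [qp, prod_congr rfl h2, prod_mul_distrib, prod_mul_distrib, prod_const, card_range,
      prod_pow_eq_pow_sum, sum_range_id, Nat.choose_two_right]
    ring
  · intro i s his
    have his : (i : ℕ) < s := his
    rw [Matrix.of_apply, h1, qp_inv_pow_eq_zero hb0 his, zero_mul]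

/-- Expansion of a determinant of sums by multilinearity in the rows. -/
theorem det_sum_mul {m N : ℕ} (w : Fin m → Fin N → ℂ) (p : Fin N → Fin m → ℂ) :
    (Matrix.of fun i s => ∑ k, w i k * p k s).det =
      ∑ k : Fin m → Fin N, (∏ i, w i (k i)) * (Matrix.of fun i s => p (k i) s).det := by
  have h := (Matrix.detRowAlternating (n := Fin m) (R := ℂ)).toMultilinearMap.map_sum
    (fun (i : Fin m) (k : Fin N) => w i k • p k)
  have e : (Matrix.of fun i s => ∑ k, w i k * p k s) = fun i => ∑ k, w i k • p k := by
    ext i s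
    simp [Finset.sum_apply]
  refine (congrArg Matrix.det e).trans (h.trans (sum_congr rfl fun k _ => ?_))
  rw [MultilinearMap.map_smul_univ, smul_eq_mul]
  rfl

/-- If the Rogers polynomials of one parity are given by the series with coefficients
`(b^{-N}, ε b^{N+1+δ}; b)_k / den k`, then the product of `P` and the `1 - x i * x j` is given by
the corresponding multiple series, with a factor in front determined by `h_pref`. -/
theorem pairProd_mul_P_eq_series {q b ε a : ℂ} {δ : ℕ} (hq : NotRootOfUnity q)
    (hb : NotRootOfUnity b) {den : ℕ → ℂ} {u : ℂ → ℂ} {η : ℕ → ℂ} (hη : ∀ N, η N ≠ 0)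
    (hε : ε ≠ 0) (hε' : ∀ j : ℕ, 1 ≤ j → 1 - ε * b ^ j ≠ 0)
    (hf : ∀ N x, x ≠ 0 → rogers q (2 * N + δ) x = η N * u x * x ^ N *
      ∑ k ∈ range (N + 1), qp (b ^ N)⁻¹ b k * qp (ε * b ^ (N + 1 + δ)) b k / den k * b ^ k *
        (qp (a * x) b k * qp (a / x) b k)) (e m : ℕ) {pref : ℂ}
    (h_pref : pref * ∏ t ∈ range (m + 1), (qp b b (e + m) * qp (ε * b ^ (e + 1 + δ)) b t) =
      ∏ t ∈ range (m + 1), (qp (ε * b ^ (2 * e + δ + 1 + t)) b t *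
        (coef q ((2 * e + δ + t : ℕ) : ℤ) / coef q ((2 * e + δ + 2 * t : ℕ) : ℤ)) * η (e + t) *
          qp b b (e + t)))
    {x : Fin (m + 1) → ℂ} (hx : ∀ i, x i ≠ 0) :
    pairProd (fun i j => 1 - x i * x j) * P (2 * e + δ + m) q x =
      pref * (∏ i, u (x i) * x i ^ (e + m)) * ∑ k : Fin (m + 1) → Fin (e + m + 1),
        pairProd (fun i j => b ^ (k j : ℕ) - b ^ (k i : ℕ)) *
        ∏ i, (qp (b ^ (e + m))⁻¹ b (k i) * qp (ε * b ^ (e + 1 + δ)) b (k i) / den (k i) *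
          b ^ (k i : ℕ) * (qp (a * x i) b (k i) * qp (a / x i) b (k i))) := by
  set N := e + m with hN
  set α := (b ^ N)⁻¹ with hα
  set γ := ε * b ^ (e + 1 + δ) with hγ
  have hb0 := hb.ne_zero
  have hα0 : α ≠ 0 := inv_ne_zero (pow_ne_zero _ hb0)
  set w : Fin (m + 1) → Fin (N + 1) → ℂ := fun i k => qp α b k * qp γ b k / den k * b ^ (k : ℕ) *
    (qp (a * x i) b k * qp (a / x i) b k) with hw
  set p : Fin (N + 1) → Fin (m + 1) → ℂ := fun k s =>
    qp (α * b ^ (k : ℕ)) b s * qp (γ * b ^ (k : ℕ)) b (m - s) with hp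
  set T := ∑ k : Fin (m + 1) → Fin (N + 1),
    pairProd (fun i j => b ^ (k j : ℕ) - b ^ (k i : ℕ)) * ∏ i, w i (k i) with hT
  set κ := ∏ s ∈ range (m + 1),
        (-α) ^ s * b ^ s.choose 2 * qp (γ / (α * b ^ s)) b (m - s) with hκ
  -- all determinants in the expansion are multiples of Vandermonde determinants, by the
  -- same factor `κ`
  have h1 : (Matrix.of fun i s => ∑ k, w i k * p k s).det = κ * T := by
    rw [det_sum_mul, hT, mul_sum]
    refine sum_congr rfl fun k _ => ?_
    rw [hκ]
    have := det_qp_mul_qp (γ := γ) hb hα0 fun i => b ^ (k i : ℕ)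
    simp only [hp]
    rw [this]
    ring
  -- each entry of the matrix is a multiple of an entry of `rogersDet`
  have h2 : ∀ i s : Fin (m + 1), u (x i) * x i ^ N * ∑ k, w i k * p k s =
      qp α b s * qp γ b (m - s) / η (N - s) *
        (x i ^ (s : ℕ) * rogers q (2 * e + δ + 2 * (m + 1 - 1 - s)) (x i)) := by
    intro i s
    have hs : (s : ℕ) ≤ m := by omega
    have hsum : ∑ k, w i k * p k s = qp α b s * qp γ b (m - s) *
        ∑ k ∈ range (N - s + 1), qp (b ^ (N - s))⁻¹ b k * qp (ε * b ^ (N - s + 1 + δ)) b k / den k *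
          b ^ k * (qp (a * x i) b k * qp (a / x i) b k) := by
      have hrange : range (N - s + 1) ⊆ range (N + 1) := range_mono (by omega)
      rw [mul_sum, sum_subset hrange fun k _ hk => ?_, ← Fin.sum_univ_eq_sum_range
        (fun k => qp α b s * qp γ b (m - s) * (qp (b ^ (N - s))⁻¹ b k *
          qp (ε * b ^ (N - s + 1 + δ)) b k / den k *
          b ^ k * (qp (a * x i) b k * qp (a / x i) b k)))]
      · refine sum_congr rfl fun k _ => ?_
        have e1 : qp α b k * qp (α * b ^ (k : ℕ)) b s =
            qp α b s * qp (b ^ (N - s))⁻¹ b k := by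
          rw [← qp_add, add_comm, qp_add]
          congr 2
          rw [hα, show N = N - s + s by omega, pow_add, Nat.add_sub_cancel, mul_inv, mul_assoc,
            inv_mul_cancel₀ (pow_ne_zero _ hb0), mul_one]
        have e2 : qp γ b k * qp (γ * b ^ (k : ℕ)) b (m - s) =
            qp γ b (m - s) * qp (ε * b ^ (N - s + 1 + δ)) b k := by
          rw [← qp_add, add_comm, qp_add]
          congr 2
          rw [hγ, mul_assoc, ← pow_add]
          congr 2
          omega
        simp only [hw, hp]
        linear_combination
          (qp γ b k * qp (γ * b ^ (k : ℕ)) b (m - s) / den k * b ^ (k : ℕ) *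
            (qp (a * x i) b k * qp (a / x i) b k)) * e1 +
          (qp α b s * qp (b ^ (N - s))⁻¹ b k / den k * b ^ (k : ℕ) *
            (qp (a * x i) b k * qp (a / x i) b k)) * e2
      · rw [qp_inv_pow_eq_zero (N := N - s) hb0 (by simp at hk; omega)]
        ring
    rw [hsum, show 2 * e + δ + 2 * (m + 1 - 1 - s) = 2 * (N - s) + δ by omega, hf _ _ (hx i)]
    have hxN : x i ^ N = x i ^ (s : ℕ) * x i ^ (N - s) := by rw [← pow_add]; congr 1; omega
    have := hη (N - s)
    rw [hxN]
    field_simp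
  have h3 : (∏ i, u (x i) * x i ^ N) * (κ * T) = (∏ s ∈ range (m + 1),
      qp α b s * qp γ b (m - s) / η (N - s)) * rogersDet q (2 * e + δ) x := by
    rw [← h1, ← Matrix.det_mul_column, ← Fin.prod_univ_eq_prod_range
      (fun s => qp α b s * qp γ b (m - s) / η (N - s)), rogersDet, ← Matrix.det_mul_row]
    congr 1
    ext i s
    simp only [Matrix.of_apply, h2]
  have hκ0 : κ ≠ 0 := by
    refine prod_ne_zero_iff.mpr fun s hs => mul_ne_zero (mul_ne_zero
      (pow_ne_zero _ (neg_ne_zero.mpr hα0)) (pow_ne_zero _ hb0)) (qp_ne_zero fun j hj h => ?_)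
    have hs : s ≤ m := by simpa [Nat.lt_succ_iff] using hs
    refine hε' (2 * e + 1 + δ + (m - s) + j) (by omega) ?_
    rw [sub_eq_zero, ← h, hγ, hα, div_mul_eq_mul_div, div_eq_iff
      (mul_ne_zero (inv_ne_zero (pow_ne_zero _ hb0)) (pow_ne_zero _ hb0))]
    have : b ^ N * b ^ (e + 1 + δ) = b ^ (2 * e + 1 + δ + (m - s)) * b ^ s := by
      rw [← pow_add, ← pow_add]; congr 1; omega
    field_simp
    rw [pow_add]
    linear_combination (b ^ j) * this
  rw [pairProd_mul_P hq (2 * e + δ) m hx]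
  apply mul_left_cancel₀ hκ0
  rw [show κ * (pref * (∏ i, u (x i) * x i ^ N) * T) =
    pref * ((∏ i, u (x i) * x i ^ N) * (κ * T)) by ring, h3, ← mul_assoc, ← mul_assoc]
  congr 1
  -- comparison of the constants
  have hbN : ∀ k, qp b b k ≠ 0 := qp_self_ne_zero hb
  have h4 : κ * ∏ t ∈ range (m + 1), qp b b N = (∏ s ∈ range (m + 1), qp α b s) *
      ∏ t ∈ range (m + 1), (qp (ε * b ^ (2 * e + δ + 1 + t)) b t * qp b b (e + t)) := by
    rw [hκ, ← prod_mul_distrib, ← prod_range_reflect (fun t =>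
      qp (ε * b ^ (2 * e + δ + 1 + t)) b t * qp b b (e + t)), ← prod_mul_distrib]
    refine prod_congr rfl fun s hs => ?_
    have hs : s ≤ m := by simpa [Nat.lt_succ_iff] using hs
    have e1 := qp_inv_pow_mul hb0 (show s ≤ N by omega)
    have e2 : γ / (α * b ^ s) = ε * b ^ (2 * e + δ + 1 + (m - s)) := by
      rw [div_eq_iff (mul_ne_zero hα0 (pow_ne_zero _ hb0)), hγ, hα]
      have : b ^ N * b ^ (e + 1 + δ) = b ^ (2 * e + δ + 1 + (m - s)) * b ^ s := by
        rw [← pow_add, ← pow_add]; congr 1; omega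
      field_simp
      linear_combination this
    rw [show m + 1 - 1 - s = m - s by omega, e2, show e + (m - s) = N - s by omega]
    linear_combination (-qp (ε * b ^ (2 * e + δ + 1 + (m - s))) b (m - s)) * e1
  have h5 : ∏ s ∈ range (m + 1), qp α b s * qp γ b (m - s) / η (N - s) =
      (∏ s ∈ range (m + 1), qp α b s) * (∏ t ∈ range (m + 1), qp γ b t) /
        ∏ t ∈ range (m + 1), η (e + t) := by
    rw [prod_div_distrib, prod_mul_distrib, ← prod_range_reflect (fun t => qp γ b t),
      ← prod_range_reflect (fun t => η (e + t))]
    congr 1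
    refine prod_congr rfl fun s hs => ?_
    have hs : s ≤ m := by simpa [Nat.lt_succ_iff] using hs
    congr 1
    omega
  have h6 : ∏ t ∈ range (m + 1), η (e + t) ≠ 0 := prod_ne_zero_iff.mpr fun t _ => hη _
  have h7 : ∏ t ∈ range (m + 1), qp b b N ≠ 0 := prod_ne_zero_iff.mpr fun t _ => hbN _
  rw [h5, mul_div_assoc', eq_div_iff h6]
  apply mul_right_cancel₀ h7
  simp only [prod_mul_distrib] at h_pref h4 ⊢
  generalize (∏ t ∈ range (m + 1),
    coef q ((2 * e + δ + t : ℕ) : ℤ) / coef q ((2 * e + δ + 2 * t : ℕ) : ℤ)) = cc at *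
  linear_combination (cc * ∏ t ∈ range (m + 1), η (e + t)) * h4 -
    (∏ s ∈ range (m + 1), qp α b s) * h_pref

/-! ### The four series for the Rogers polynomials -/

theorem NotRootOfUnity.pow {q : ℂ} (hq : NotRootOfUnity q) {k : ℕ} (hk : 1 ≤ k) :
    NotRootOfUnity (q ^ k) :=
  ⟨pow_ne_zero _ hq.ne_zero, fun j hj => by
    rw [← pow_mul]; exact hq.2 _ (Nat.mul_pos hk hj)⟩

theorem NotRootOfUnity.of_pow {q : ℂ} {k : ℕ} (hq : NotRootOfUnity (q ^ k)) (hk : k ≠ 0) :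
    NotRootOfUnity q :=
  ⟨fun h => hq.ne_zero (by rw [h, zero_pow hk]), fun j hj h => hq.2 j hj (by
    rw [← pow_mul, mul_comm, pow_mul, h, one_pow])⟩

theorem NotRootOfUnity.qp_ne_zero {q : ℂ} (hq : NotRootOfUnity q) {k j : ℕ} (h : k ≠ 0) (l : ℕ) :
    qp (q ^ k) (q ^ j) l ≠ 0 :=
  SchurQ.qp_ne_zero fun i _ => by
    rw [← pow_mul, ← pow_add]
    exact hq.2 _ (by omega)

theorem NotRootOfUnity.qp_neg_ne_zero {q : ℂ} (hq : NotRootOfUnity q) (k j l : ℕ) :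
    qp (-q ^ k) (q ^ j) l ≠ 0 :=
  SchurQ.qp_ne_zero fun i _ h => by
    rw [← pow_mul, neg_mul, ← pow_add] at h
    exact hq.one_add_pow_ne (k + j * i) (by linear_combination -h)

/-- `(1 - a) (a b; b)_k = (1 - a b^k) (a; b)_k`. -/
theorem qp_shift (a b : ℂ) (k : ℕ) : (1 - a) * qp (a * b) b k = qp a b k * (1 - a * b ^ k) := by
  rw [← qp_succ', qp_succ]

/-- The series of base `q` with `a = q`, for even and for odd degree. -/
theorem rogers_eq_series_self {q r : ℂ} (hr : NotRootOfUnity r) (hrq : r ^ 2 = q) (N : ℕ) {x : ℂ}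
    (hx : x ≠ 0) :
    rogers q (2 * N) x = (q ^ N)⁻¹ * (1 - q ^ (2 * N + 1)) / (1 - q) * x ^ N *
      ∑ k ∈ range (N + 1), qp (q ^ N)⁻¹ q k * qp (-1 * q ^ (N + 1)) q k /
        (qp q q k * qp q q k * (qp (r ^ 3) q k * qp (-r ^ 3) q k)) * q ^ k *
          (qp (q * x) q k * qp (q / x) q k) ∧
    rogers q (2 * N + 1) x = (q ^ N)⁻¹ * (1 - q ^ (2 * N + 2)) / (1 - q) ^ 2 * (1 - x) * x ^ N *
      ∑ k ∈ range (N + 1), qp (q ^ N)⁻¹ q k * qp (-1 * q ^ (N + 2)) q k /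
        (qp q q k * qp (q ^ 2) q k * (qp (r ^ 3) q k * qp (-r ^ 3) q k)) * q ^ k *
          (qp (q * x) q k * qp (q / x) q k) := by
  have hq : NotRootOfUnity q := hrq ▸ hr.pow (by norm_num)
  have h1 : 1 - q ≠ 0 := by simpa using hq.one_sub_pow_ne one_ne_zero
  have hq0 := hq.ne_zero
  have hr3 : r ^ 3 = q * r := by rw [← hrq]; ring
  have hne : ∀ k, qp (r ^ 3) q k * qp (-r ^ 3) q k ≠ 0 := fun k => by
    rw [← hrq]
    exact mul_ne_zero (hr.qp_ne_zero (by norm_num) k) (hr.qp_neg_ne_zero 3 2 k)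
  refine rogers_eq_series (a := q) (b := q) (c := r) (d := -r) (ε := -1)
    (ν := fun N => (q ^ N)⁻¹ * (1 - q ^ (2 * N + 1)) / (1 - q))
    (μ := fun N => (q ^ N)⁻¹ * (1 - q ^ (2 * N + 2)) / (1 - q) ^ 2) hq hq0 hq
    (fun j _ => ?_) (fun j => ?_) (fun k => ?_) (by simp [qp_zero])
    (fun k => ?_) (fun k => ?_) ?_ ?_ (fun N X => ?_) (fun N X hX => ?_) N hx
  · simpa using hq.one_add_pow_ne j
  · rw [← pow_succ']; exact hq.one_sub_pow_ne (by omega)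
  · simp only [qp_succ, hr3]
    ring
  · exact mul_ne_zero (mul_ne_zero (qp_self_ne_zero hq _) (qp_self_ne_zero hq _)) (hne k)
  · have h := qp_shift q q k
    rw [← pow_two] at h
    rw [eq_div_iff h1]
    linear_combination (qp q q k * (qp (r ^ 3) q k * qp (-r ^ 3) q k)) * h
  · simp [h1]
  · simp only [pow_zero, mul_zero, zero_add, inv_one, one_mul]
    field_simp
    ring
  · have h3 := hq.one_sub_pow_ne (k := 2 * N + 3) (by omega)
    have hQ : q ^ N ≠ 0 := pow_ne_zero _ hq0
    obtain ⟨D, hD⟩ : ∃ D, D = 1 - q ^ (2 * N + 3) := ⟨_, rfl⟩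
    rw [← hD] at h3 ⊢
    simp only [mul_add, mul_one, pow_add, pow_mul' q 2 N] at hD ⊢
    generalize q ^ N = Q at *
    field_simp
    rw [hD]
    ring
  · have h3 := hq.one_sub_pow_ne (k := 2 * N + 2) (by omega)
    have e : ∀ j, q ^ (2 * N + j) = (q ^ N) ^ 2 * q ^ j := fun j => by ring
    have hQ : q ^ N ≠ 0 := pow_ne_zero _ hq0
    have hqr : (1 - q * r * X) * (1 - q * -r * X) = 1 - q ^ 3 * X ^ 2 := by rw [← hrq]; ring
    rw [mul_assoc (1 - q * X), hqr]
    simp only [mul_add, add_assoc, pow_add q N, e] at h3 ⊢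
    generalize q ^ N = Q at *
    field_simp
    ring

/-- The series of base `q` with `a = q^{1/2}`, for even and for odd degree; `r` stands for
`q^{1/2}`. -/
theorem rogers_eq_series_half {q r : ℂ} (hr : NotRootOfUnity r) (hrq : r ^ 2 = q) (N : ℕ) {x : ℂ}
    (hx : x ≠ 0) :
    rogers q (2 * N) x = (r ^ N)⁻¹ * (qp (-q) q N * qp (r ^ 3) q N) / (qp q q N * qp (-r) q N) *
      x ^ N * ∑ k ∈ range (N + 1), qp (q ^ N)⁻¹ q k * qp (-1 * q ^ (N + 1)) q k /
        (qp q q k * qp r q k * (qp (r ^ 3) q k * qp (-q) q k)) * q ^ k *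
          (qp (r * x) q k * qp (r / x) q k) ∧
    rogers q (2 * N + 1) x = (r ^ N)⁻¹ * (qp (-q) q (N + 1) * qp (r ^ 3) q N) /
        ((1 - q) * (qp q q N * qp (-r ^ 3) q N)) * (1 - x) * x ^ N *
      ∑ k ∈ range (N + 1), qp (q ^ N)⁻¹ q k * qp (-1 * q ^ (N + 2)) q k /
        (qp q q k * qp (r ^ 3) q k * (qp (r ^ 3) q k * qp (-q) q k)) * q ^ k *
          (qp (r * x) q k * qp (r / x) q k) := by
  have hq : NotRootOfUnity q := hrq ▸ hr.pow (by norm_num)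
  have h1 : 1 - q ≠ 0 := by simpa using hq.one_sub_pow_ne one_ne_zero
  have h2 : 1 - r ≠ 0 := by simpa using hr.one_sub_pow_ne one_ne_zero
  have h2' : 1 + r ≠ 0 := by simpa using hr.one_add_pow_ne 1
  have hr0 := hr.ne_zero
  have hq0 := hq.ne_zero
  have hr3 : r ^ 3 = r * q := by rw [← hrq]; ring
  have hne : ∀ k, qp (r ^ 3) q k ≠ 0 := fun k => by
    rw [← hrq]; exact hr.qp_ne_zero (by norm_num) k
  have hne1 : ∀ k, qp r q k ≠ 0 := fun k => by
    rw [← hrq, ← pow_one r, ← pow_mul]; exact hr.qp_ne_zero (by norm_num) k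
  have hne2 : ∀ k, qp (-r) q k ≠ 0 := fun k => by
    rw [← hrq]; simpa using hr.qp_neg_ne_zero 1 2 k
  have hne3 : ∀ k, qp (-r ^ 3) q k ≠ 0 := fun k => by rw [← hrq]; exact hr.qp_neg_ne_zero 3 2 k
  have hmin : ∀ k, 1 + r * q ^ k ≠ 0 := fun k => by
    have := hr.one_add_pow_ne (2 * k + 1)
    rwa [pow_succ', pow_mul, hrq] at this
  -- unlike in the other cases, `ν` and `μ` contain products of growing length, which enter the
  -- recurrence through the quotients `ν (N + 1) / ν N` and `μ N / ν N`
  set ν : ℕ → ℂ := fun N => (r ^ N)⁻¹ * (qp (-q) q N * qp (r ^ 3) q N) /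
    (qp q q N * qp (-r) q N) with hν
  set μ : ℕ → ℂ := fun N => (r ^ N)⁻¹ * (qp (-q) q (N + 1) * qp (r ^ 3) q N) /
        ((1 - q) * (qp q q N * qp (-r ^ 3) q N)) with hμ
  have hνs : ∀ N, ν (N + 1) = ν N * ((1 + q ^ N * q) * (1 - r * q * q ^ N) /
      (r * ((1 - q ^ N * q) * (1 + r * q ^ N)))) := fun N => by
    have e1 := hq.one_sub_pow_ne (k := N + 1) (by omega)
    have e2 := hmin N
    have e3 := qp_self_ne_zero hq N
    rw [pow_succ] at e1
    simp only [hν, qp_succ, neg_mul, sub_neg_eq_add, hr3, mul_comm q (q ^ N)]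
    have e4 := hne2 N
    have e5 : 1 - -r * q ^ N = 1 + r * q ^ N := by ring
    generalize 1 - q ^ N * q = D at *
    generalize 1 + r * q ^ N = E at *
    field_simp
    ring
  have hμν : ∀ N, μ N = ν N * ((1 + q ^ N * q) / ((1 - r) * (1 + r * q ^ N))) := fun N => by
    have e2 := hmin N
    have e3 := qp_self_ne_zero hq N
    have e4 := qp_shift (-r) q N
    have e5 := hne3 N
    have e6 := hne2 N
    have e7 : 1 - q = (1 - r) * (1 + r) := by rw [← hrq]; ring
    rw [neg_mul, ← hr3, sub_neg_eq_add, neg_mul, sub_neg_eq_add] at e4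
    have e8 := pow_ne_zero N hr0
    simp only [hμ, hν, qp_succ, neg_mul, sub_neg_eq_add, mul_comm q (q ^ N)]
    rw [e7]
    generalize 1 + r * q ^ N = E at *
    field_simp
    linear_combination (-(qp (-q) q N * qp (r ^ 3) q N * (1 + q ^ N * q))) * e4
  refine rogers_eq_series (a := r) (b := q) (c := q) (d := -r) (ε := -1) (ν := ν) (μ := μ)
    hq hr0 hq (fun j _ => ?_) (fun j => ?_) (fun k => ?_) (by simp [qp_zero])
    (fun k => ?_) (fun k => ?_) ?_ ?_ (fun N X => ?_) (fun N X hX => ?_) N hx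
  · simpa using hq.one_add_pow_ne j
  · rw [← hrq, ← pow_mul, ← pow_succ']; exact hr.one_sub_pow_ne (by omega)
  · have : r * -r = -q := by rw [← hrq]; ring
    simp only [qp_succ, hr3, this]
    ring
  · exact mul_ne_zero (mul_ne_zero (qp_self_ne_zero hq _) (hne1 k))
      (mul_ne_zero (hne k) (qp_neg_self_ne_zero hq k))
  · have h := qp_shift r q k
    rw [← hr3] at h
    rw [eq_div_iff h2]
    linear_combination (qp q q k * (qp (r ^ 3) q k * qp (-q) q k)) * h
  · simp [hν, qp_zero]
  · simp [hμ, qp_zero, qp_succ]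
  · have h3 := hq.one_sub_pow_ne (k := 2 * N + 3) (by omega)
    have h4 := hmin N
    have h5 := hmin (N + 1)
    have h6 := hq.one_sub_pow_ne (k := N + 1) (by omega)
    have hQ : q ^ N ≠ 0 := pow_ne_zero _ hq0
    rw [hμν, hμν, hνs]
    generalize ν N = v
    simp only [pow_succ q N] at h5 h6 ⊢
    obtain ⟨D, hD⟩ : ∃ D, D = 1 - q ^ (2 * N + 3) := ⟨_, rfl⟩
    rw [← hD] at h3 ⊢
    simp only [pow_add, mul_comm 2 N, pow_mul q N 2] at hD ⊢
    generalize q ^ N = Q at *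
    obtain ⟨A, hA⟩ : ∃ A, A = 1 + r * Q := ⟨_, rfl⟩
    obtain ⟨B, hB⟩ : ∃ B, B = 1 + r * (Q * q) := ⟨_, rfl⟩
    obtain ⟨E, hE⟩ : ∃ E, E = 1 - Q * q := ⟨_, rfl⟩
    rw [← hA] at h4 ⊢
    rw [← hB] at h5 ⊢
    rw [← hE] at h6 ⊢
    field_simp
    rw [hD, hB, hE, ← hrq]
    ring
  · have h3 := hq.one_sub_pow_ne (k := 2 * N + 2) (by omega)
    have h4 := hmin N
    have h6 := hq.one_sub_pow_ne (k := N + 1) (by omega)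
    have hQ : q ^ N ≠ 0 := pow_ne_zero _ hq0
    rw [hμν, hνs]
    generalize ν N = v
    simp only [pow_succ q N] at h6 ⊢
    obtain ⟨D, hD⟩ : ∃ D, D = 1 - q ^ (2 * N + 2) := ⟨_, rfl⟩
    rw [← hD] at h3 ⊢
    simp only [pow_add, mul_comm 2 N, pow_mul q N 2] at hD ⊢
    generalize q ^ N = Q at *
    obtain ⟨A, hA⟩ : ∃ A, A = 1 + r * Q := ⟨_, rfl⟩
    obtain ⟨E, hE⟩ : ∃ E, E = 1 - Q * q := ⟨_, rfl⟩
    rw [← hA] at h4 ⊢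
    rw [← hE] at h6 ⊢
    field_simp
    rw [hD, hA, hE, ← hrq]
    ring

/-- The series of base `q²` with `a = q`, for even and for odd degree. -/
theorem rogers_eq_series_sq_self {q : ℂ} (hq : NotRootOfUnity q) (N : ℕ) {x : ℂ}
    (hx : x ≠ 0) :
    rogers q (2 * N) x = (q ^ N)⁻¹ * (1 - q ^ (2 * N + 1)) / (1 - q) * x ^ N *
      ∑ k ∈ range (N + 1), qp ((q ^ 2) ^ N)⁻¹ (q ^ 2) k * qp (1 * (q ^ 2) ^ (N + 1)) (q ^ 2) k /
        (qp q (q ^ 2) k * qp (q ^ 2) (q ^ 2) k * (qp (q ^ 2) (q ^ 2) k * qp (q ^ 3) (q ^ 2) k)) *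
          (q ^ 2) ^ k * (qp (q * x) (q ^ 2) k * qp (q / x) (q ^ 2) k) ∧
    rogers q (2 * N + 1) x = (q ^ N)⁻¹ * (1 - q ^ (2 * N + 2)) / (1 - q) ^ 2 * (1 - x) * x ^ N *
      ∑ k ∈ range (N + 1), qp ((q ^ 2) ^ N)⁻¹ (q ^ 2) k * qp (1 * (q ^ 2) ^ (N + 2)) (q ^ 2) k /
        (qp (q ^ 2) (q ^ 2) k * qp (q ^ 2) (q ^ 2) k *
          (qp (q ^ 3) (q ^ 2) k * qp (q ^ 3) (q ^ 2) k)) *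
          (q ^ 2) ^ k * (qp (q * x) (q ^ 2) k * qp (q / x) (q ^ 2) k) := by
  have hb : NotRootOfUnity (q ^ 2) := hq.pow (by norm_num)
  have h1 : 1 - q ≠ 0 := by simpa using hq.one_sub_pow_ne one_ne_zero
  have hq0 := hq.ne_zero
  have hne : ∀ k, qp q (q ^ 2) k ≠ 0 := fun k => by
    simpa using hq.qp_ne_zero (k := 1) (j := 2) (by norm_num) k
  have hne2 : ∀ k, qp (q ^ 2) (q ^ 2) k ≠ 0 := qp_self_ne_zero hb
  have hne3 : ∀ k, qp (q ^ 3) (q ^ 2) k ≠ 0 := fun k => hq.qp_ne_zero (by norm_num) k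
  refine rogers_eq_series (a := q) (b := q ^ 2) (c := q) (d := q ^ 2) (ε := 1)
    (ν := fun N => (q ^ N)⁻¹ * (1 - q ^ (2 * N + 1)) / (1 - q))
    (μ := fun N => (q ^ N)⁻¹ * (1 - q ^ (2 * N + 2)) / (1 - q) ^ 2) hq hq0 hb
    (fun j _ => ?_) (fun j => ?_) (fun k => ?_) (by simp [qp_zero])
    (fun k => ?_) (fun k => ?_) ?_ ?_ (fun N X => ?_) (fun N X hX => ?_) N hx
  · simpa using hb.one_sub_pow_ne (k := j) (by omega)
  · rw [← pow_mul, ← pow_succ']; exact hq.one_sub_pow_ne (by omega)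
  · simp only [qp_succ, show q * q = q ^ 2 by ring, show q * q ^ 2 = q ^ 3 by ring]
    ring
  · exact mul_ne_zero (mul_ne_zero (hne k) (hne2 k)) (mul_ne_zero (hne2 k) (hne3 k))
  · have h := qp_shift q (q ^ 2) k
    rw [← pow_succ'] at h
    rw [eq_div_iff h1]
    linear_combination (qp (q ^ 2) (q ^ 2) k * qp (q ^ 2) (q ^ 2) k * qp (q ^ 3) (q ^ 2) k) * h
  · simp [h1]
  · simp only [pow_zero, mul_zero, zero_add, inv_one, one_mul]
    field_simp
    ring
  · have h3 := hq.one_sub_pow_ne (k := 2 * N + 3) (by omega)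
    have hQ : q ^ N ≠ 0 := pow_ne_zero _ hq0
    obtain ⟨D, hD⟩ : ∃ D, D = 1 - q ^ (2 * N + 3) := ⟨_, rfl⟩
    rw [← hD] at h3 ⊢
    simp only [← pow_mul q 2, mul_add, mul_one, pow_add, mul_comm 2 N, pow_mul q N 2] at hD ⊢
    generalize q ^ N = Q at *
    field_simp
    rw [hD]
    ring
  · have h3 := hq.one_sub_pow_ne (k := 2 * N + 2) (by omega)
    have e : ∀ j, q ^ (2 * N + j) = (q ^ N) ^ 2 * q ^ j := fun j => by ring
    have hQ : q ^ N ≠ 0 := pow_ne_zero _ hq0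
    simp only [mul_add, add_assoc, ← pow_mul, pow_add q N, e] at h3 ⊢
    simp only [mul_comm 2 N, pow_mul] at h3 ⊢
    generalize q ^ N = Q at *
    field_simp
    ring

/-- The series of base `q²` with `a = q²`, for even and for odd degree. -/
theorem rogers_eq_series_sq_sq {q : ℂ} (hq : NotRootOfUnity q) (N : ℕ) {x : ℂ}
    (hx : x ≠ 0) :
    rogers q (2 * N) x = ((q ^ N)⁻¹ * (1 - q ^ (2 * N + 1)) / (1 - q)) ^ 2 * x ^ N *
      ∑ k ∈ range (N + 1), qp ((q ^ 2) ^ N)⁻¹ (q ^ 2) k * qp (1 * (q ^ 2) ^ (N + 1)) (q ^ 2) k /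
        (qp (q ^ 2) (q ^ 2) k * qp (q ^ 2) (q ^ 2) k *
          (qp (q ^ 3) (q ^ 2) k * qp (q ^ 3) (q ^ 2) k)) *
          (q ^ 2) ^ k * (qp (q ^ 2 * x) (q ^ 2) k * qp (q ^ 2 / x) (q ^ 2) k) ∧
    rogers q (2 * N + 1) x = ((q ^ N)⁻¹ * (1 - q ^ (2 * N + 2)) / (1 - q)) ^ 2 / (1 - q ^ 2) *
        (1 - x) * x ^ N *
      ∑ k ∈ range (N + 1), qp ((q ^ 2) ^ N)⁻¹ (q ^ 2) k * qp (1 * (q ^ 2) ^ (N + 2)) (q ^ 2) k /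
        (qp (q ^ 2) (q ^ 2) k * qp (q ^ 3) (q ^ 2) k *
          (qp (q ^ 3) (q ^ 2) k * qp (q ^ 4) (q ^ 2) k)) *
          (q ^ 2) ^ k * (qp (q ^ 2 * x) (q ^ 2) k * qp (q ^ 2 / x) (q ^ 2) k) := by
  have hb : NotRootOfUnity (q ^ 2) := hq.pow (by norm_num)
  have h1 : 1 - q ≠ 0 := by simpa using hq.one_sub_pow_ne one_ne_zero
  have h2 : 1 - q ^ 2 ≠ 0 := hq.one_sub_pow_ne two_ne_zero
  have hq0 := hq.ne_zero
  have hne2 : ∀ k, qp (q ^ 2) (q ^ 2) k ≠ 0 := qp_self_ne_zero hb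
  have hne3 : ∀ k, qp (q ^ 3) (q ^ 2) k ≠ 0 := fun k => hq.qp_ne_zero (by norm_num) k
  refine rogers_eq_series (a := q ^ 2) (b := q ^ 2) (c := q) (d := q) (ε := 1)
    (ν := fun N => ((q ^ N)⁻¹ * (1 - q ^ (2 * N + 1)) / (1 - q)) ^ 2)
    (μ := fun N => ((q ^ N)⁻¹ * (1 - q ^ (2 * N + 2)) / (1 - q)) ^ 2 / (1 - q ^ 2)) hq hb.ne_zero hb
    (fun j _ => ?_) (fun j => ?_) (fun k => ?_) (by simp [qp_zero])
    (fun k => ?_) (fun k => ?_) ?_ ?_ (fun N X => ?_) (fun N X hX => ?_) N hx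
  · simpa using hb.one_sub_pow_ne (k := j) (by omega)
  · rw [← pow_succ']; exact hb.one_sub_pow_ne (by omega)
  · simp only [qp_succ, ← pow_succ, Nat.reduceAdd]
    ring
  · exact mul_ne_zero (mul_ne_zero (hne2 k) (hne2 k)) (mul_ne_zero (hne3 k) (hne3 k))
  · have h := qp_shift (q ^ 2) (q ^ 2) k
    rw [← pow_add] at h
    rw [eq_div_iff h2]
    linear_combination (qp (q ^ 2) (q ^ 2) k * qp (q ^ 3) (q ^ 2) k * qp (q ^ 3) (q ^ 2) k) * h
  · simp [h1]
  · simp only [pow_zero, mul_zero, zero_add, inv_one, one_mul]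
    field_simp
    ring
  · have h3 := hq.one_sub_pow_ne (k := 2 * N + 3) (by omega)
    have hQ : q ^ N ≠ 0 := pow_ne_zero _ hq0
    obtain ⟨D, hD⟩ : ∃ D, D = 1 - q ^ (2 * N + 3) := ⟨_, rfl⟩
    rw [← hD] at h3 ⊢
    simp only [← pow_mul q 2, mul_add, mul_one, pow_add, mul_comm 2 N, pow_mul q N 2] at hD ⊢
    generalize q ^ N = Q at *
    field_simp
    rw [hD]
    ring
  · have h3 := hq.one_sub_pow_ne (k := 2 * N + 2) (by omega)
    have e : ∀ j, q ^ (2 * N + j) = (q ^ N) ^ 2 * q ^ j := fun j => by ring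
    have hQ : q ^ N ≠ 0 := pow_ne_zero _ hq0
    simp only [mul_add, add_assoc, ← pow_mul, pow_add q N, e] at h3 ⊢
    simp only [mul_comm 2 N, pow_mul] at h3 ⊢
    generalize q ^ N = Q at *
    field_simp
    ring

/-! ### The factors in front of the multiple series -/

theorem sum_range_add_mul_two (e m : ℕ) :
    (∑ t ∈ range (m + 1), (e + t)) * 2 = (2 * e + m) * (m + 1) := by
  induction m with
  | zero => simp; ring
  | succ m ih => rw [sum_range_succ, add_mul, ih]; ring

theorem prod_inv_pow_eq_zpow (r : ℂ) (e m : ℕ) :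
    ∏ t ∈ range (m + 1), (r ^ (e + t))⁻¹ =
        r ^ (-(((2 * e + m : ℕ) : ℤ) * ((m + 1 : ℕ) : ℤ) / 2)) := by
  have h := sum_range_add_mul_two e m
  rw [prod_inv_distrib, prod_pow_eq_pow_sum, ← Nat.cast_mul, ← h, zpow_neg]
  congr 1
  rw [← zpow_natCast]
  congr 1
  push_cast
  omega

theorem prod_inv_sq_pow_eq_zpow (r : ℂ) (e m : ℕ) :
    ∏ t ∈ range (m + 1), ((r ^ 2) ^ (e + t))⁻¹ =
      r ^ (-(((2 * e + m : ℕ) : ℤ) * ((m + 1 : ℕ) : ℤ))) := by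
  have h := sum_range_add_mul_two e m
  rw [prod_inv_distrib, prod_pow_eq_pow_sum, ← Nat.cast_mul, ← h, zpow_neg, zpow_natCast, mul_comm,
    pow_mul]

/-- Sign and power of `q` in the product of the `(q^{-N}; q)_t`. -/
theorem prod_neg_inv_pow_mul_choose {r : ℂ} (hr : r ≠ 0) (e m : ℕ) :
    ∏ t ∈ range (m + 1), (((r ^ 2) ^ (e + t))⁻¹ *
        ((-((r ^ 2) ^ (e + m))⁻¹) ^ t * (r ^ 2) ^ t.choose 2)) =
      (-1) ^ (m + 1).choose 2 * r ^ (-((m + 1 + 1).choose 3 : ℤ) -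
        ((2 * e + m : ℕ) : ℤ) * ((m + 1 + 1).choose 2 : ℤ)) := by
  have key : ∀ k : ℕ, ∏ t ∈ range k, (((r ^ 2) ^ (e + t))⁻¹ *
        ((-((r ^ 2) ^ (e + m))⁻¹) ^ t * (r ^ 2) ^ t.choose 2)) = (-1) ^ k.choose 2 *
          r ^ (2 * (-(e * k + k.choose 2 : ℤ) - (e + m) * k.choose 2 + k.choose 3)) := by
    intro k
    induction k with
    | zero => simp
    | succ k ih =>
      rw [prod_range_succ, ih, Nat.choose_succ_succ' k 1, Nat.choose_succ_succ' k 2,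
        Nat.choose_one_right, neg_pow ((r ^ 2) ^ (e + m))⁻¹, pow_add]
      have : ((r ^ 2) ^ (e + k))⁻¹ * ((((r ^ 2) ^ (e + m))⁻¹) ^ k * (r ^ 2) ^ k.choose 2) =
          r ^ (2 * (-(e + k : ℤ) - (e + m) * k + k.choose 2)) := by
        rw [← pow_mul, ← pow_mul, ← pow_mul, inv_pow, ← pow_mul, ← zpow_natCast, ← zpow_natCast,
          ← zpow_natCast, ← zpow_neg, ← zpow_neg, ← zpow_add₀ hr, ← zpow_add₀ hr]
        congr 1
        push_cast
        ring
      rw [show (2 : ℤ) * (-(e * (k + 1 : ℕ) + (k + k.choose 2 : ℕ)) - (e + m) *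
          (k + k.choose 2 : ℕ) +
          (k.choose 2 + k.choose 3 : ℕ)) = 2 * (-(e * k + k.choose 2 : ℤ) - (e + m) * k.choose 2 +
          k.choose 3) + 2 * (-(e + k : ℤ) - (e + m) * k + k.choose 2) by push_cast; ring,
        zpow_add₀ hr, ← this]
      ring
  have c2 : ∀ m : ℕ, (2 : ℤ) * ((m + 1).choose 2 : ℤ) = (m + 1) * m := fun m => by
    induction m with
    | zero => simp
    | succ m ih =>
      rw [Nat.choose_succ_succ' (m + 1) 1, Nat.choose_one_right]
      push_cast
      linear_combination ih
  have c3 : ∀ m : ℕ, (3 : ℤ) * ((m + 1).choose 3 : ℤ) = (m - 1) * ((m + 1).choose 2 : ℤ) :=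
      fun m => by
    induction m with
    | zero => simp [Nat.choose]
    | succ m ih =>
      rw [Nat.choose_succ_succ' (m + 1) 2, Nat.choose_succ_succ' (m + 1) 1, Nat.choose_one_right]
      have := c2 m
      push_cast
      linear_combination ih + this
  rw [key]
  congr 2
  rw [Nat.choose_succ_succ' (m + 1) 2, Nat.choose_succ_succ' (m + 1) 1, Nat.choose_one_right]
  have h2 := c2 m
  have h3 := c3 m
  push_cast
  linear_combination h3 - h2

/-- The quotients of coefficients in `pairProd_mul_P` turn `(-q^{d+1+t}; q)_t` into `(q^{d+1+t};
q)_t`. -/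
theorem qp_neg_mul_coef_div_coef {q : ℂ} (hq : NotRootOfUnity q) (d t : ℕ) :
    qp (-1 * q ^ (d + 1 + t)) q t *
      (coef q ((d + t : ℕ) : ℤ) / coef q ((d + 2 * t : ℕ) : ℤ)) = qp (q ^ (d + 1 + t)) q t := by
  have h1 := qp_self_ne_zero hq (d + t)
  have h2 := qp_neg_self_ne_zero hq (d + t)
  have e1 := qp_add (-q) q (d + t) t
  have e2 := qp_add q q (d + t) t
  have e3 : -q * q ^ (d + t) = -1 * q ^ (d + 1 + t) := by ring
  have e4 : q * q ^ (d + t) = q ^ (d + 1 + t) := by ring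
  rw [e3] at e1
  rw [e4] at e2
  have h3 := qp_self_ne_zero hq (d + t + t)
  have h4 := qp_neg_self_ne_zero hq (d + t + t)
  rw [coef_natCast, coef_natCast, show d + 2 * t = d + t + t by ring]
  rw [e1] at h4 ⊢
  rw [e2] at h3 ⊢
  have h5 := right_ne_zero_of_mul h3
  have h6 := right_ne_zero_of_mul h4
  generalize qp (-1 * q ^ (d + 1 + t)) q t = z at *
  field_simp

theorem qp_sq (z q : ℂ) (k : ℕ) : qp (z ^ 2) (q ^ 2) k = qp z q k * qp (-z) q k := by
  simp only [qp, ← prod_mul_distrib]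
  exact prod_congr rfl fun j _ => by ring

theorem qp_sq_mul_coef_div_coef {q : ℂ} (hq : NotRootOfUnity q) (d t : ℕ) :
    qp (1 * (q ^ 2) ^ (d + 1 + t)) (q ^ 2) t *
      (coef q ((d + t : ℕ) : ℤ) / coef q ((d + 2 * t : ℕ) : ℤ)) = qp (q ^ (d + 1 + t)) q t ^ 2 := by
  rw [one_mul, pow_right_comm, qp_sq, mul_assoc, ← neg_one_mul, qp_neg_mul_coef_div_coef hq,
      pow_two]

/-- The two sides are the product of `1 - q^{d + 1 + i + j}` over all pairs of `i`, `j` below `m`,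
and the same product split into diagonal and off-diagonal pairs. -/
theorem prod_qp_eq_prod_sq (q : ℂ) (d m : ℕ) :
    ∏ i ∈ range m, qp (q ^ (d + 1 + i)) q m =
      ∏ t ∈ range m, (qp (q ^ (d + 1 + t)) q t ^ 2 * (1 - q ^ (d + 1 + 2 * t))) := by
  induction m with
  | zero => simp
  | succ m ih =>
    have h : ∏ i ∈ range m, (1 - q ^ (d + 1 + i) * q ^ m) = qp (q ^ (d + 1 + m)) q m := by
      rw [qp]
      exact prod_congr rfl fun i _ => by ring
    rw [prod_range_succ, prod_range_succ _ m, ← ih]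
    simp only [qp_succ, prod_mul_distrib]
    rw [h]
    ring

/-- The two parities are `δ = 0` and `δ = 1`. The negative index `-1` occurs for `δ = 1` and `m =
0`. -/
theorem qpInt_pow_mul {b : ℂ} (hb : NotRootOfUnity b) (e m : ℕ) {δ : ℕ} (hδ : δ = 0 ∨ δ = 1) :
    qpInt (b ^ (e + 1 + δ)) b ((m : ℤ) - δ) * qp b b (e + δ) = qp b b (e + m) := by
  by_cases h : δ ≤ m
  · have e1 : ((m : ℤ) - δ) = ((m - δ : ℕ) : ℤ) := by omega
    rw [e1, qpInt, if_pos (by positivity), Int.toNat_natCast, show e + m = e + δ + (m - δ) by omega,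
      qp_add b b (e + δ), mul_comm]
    congr 2
    ring
  · obtain rfl : m = 0 := by omega
    obtain rfl : δ = 1 := by omega
    have h1 := hb.one_sub_pow_ne (k := e + 1) (by omega)
    have e1 : b ^ (e + 1 + 1) * b⁻¹ = b ^ (e + 1) := by
      rw [pow_succ, mul_inv_cancel_right₀ hb.ne_zero]
    have e2 : qpInt (b ^ (e + 1 + 1)) b (((0 : ℕ) : ℤ) - (1 : ℕ)) = (1 - b ^ (e + 1))⁻¹ := by
      rw [qpInt, if_neg (by norm_num)]
      simp [e1]
    rw [e2, qp_succ, ← pow_succ', add_zero, mul_comm (qp b b e), inv_mul_cancel_left₀ h1]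

section

variable {q r : ℂ} {e m δ : ℕ}

theorem qp_pow_mul_qp {a q : ℂ} (k t : ℕ) :
    qp (a * q ^ k) q t * qp a q k = qp a q (k + t) := by
  rw [qp_add, mul_comm]

/-- The factor in front of the series of base `q` with `a = q`. The product of the `(q^{-(e+m)};
q)_t` in the denominator is evaluated by `qp_inv_pow_mul`, after reversal of the order of the
factors. -/
theorem prefactor_self (hr : NotRootOfUnity r) (hrq : r ^ 2 = q) (c : ℂ) :
    (-1) ^ (m + 1).choose 2 * r ^ (-((m + 1 + 1).choose 3 : ℤ) -
        ((2 * e + m : ℕ) : ℤ) * ((m + 1 + 1).choose 2 : ℤ)) / c ^ (m + 1) *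
      (∏ t ∈ range (m + 1), qp (q ^ (2 * e + δ + 1 + t)) q (t + 1) /
        (qp (q ^ (e + m))⁻¹ q t * qp (-1 * q ^ (e + 1 + δ)) q t)) *
      ∏ t ∈ range (m + 1), (qp q q (e + m) * qp (-1 * q ^ (e + 1 + δ)) q t) =
    ∏ t ∈ range (m + 1), (qp (-1 * q ^ (2 * e + δ + 1 + t)) q t *
        (coef q ((2 * e + δ + t : ℕ) : ℤ) / coef q ((2 * e + δ + 2 * t : ℕ) : ℤ)) *
        ((q ^ (e + t))⁻¹ * (1 - q ^ (2 * (e + t) + 1 + δ)) / c) * qp q q (e + t)) := by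
  have hq : NotRootOfUnity q := hrq ▸ hr.pow (by norm_num)
  have hqN := qp_self_ne_zero hq
  have h1 := prod_neg_inv_pow_mul_choose hr.ne_zero e m
  rw [hrq] at h1
  have hγ : ∀ t, qp (-1 * q ^ (e + 1 + δ)) q t ≠ 0 := fun t => by
    simpa using hq.qp_neg_ne_zero (e + 1 + δ) 1 t
  have h2 : ∀ t ∈ range (m + 1), qp (q ^ (e + m))⁻¹ q t * qp q q (e + (m - t)) =
      (-(q ^ (e + m))⁻¹) ^ t * q ^ t.choose 2 * qp q q (e + m) := fun t ht => by
    have ht : t ≤ m := by simpa [Nat.lt_succ_iff] using ht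
    rw [show e + (m - t) = e + m - t by omega]
    exact qp_inv_pow_mul hq.ne_zero (by omega)
  have h3 : ∏ t ∈ range (m + 1), qp (q ^ (e + m))⁻¹ q t ≠ 0 := by
    refine prod_ne_zero_iff.mpr fun t ht h0 => ?_
    have := h2 t ht
    rw [h0, zero_mul] at this
    exact mul_ne_zero (mul_ne_zero (pow_ne_zero _ (neg_ne_zero.mpr (inv_ne_zero (pow_ne_zero _
      hq.ne_zero)))) (pow_ne_zero _ hq.ne_zero)) (hqN _) this.symm
  have h4 : (∏ t ∈ range (m + 1), qp (q ^ (e + m))⁻¹ q t) * ∏ t ∈ range (m + 1), qp q q (e + t) =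
      (∏ t ∈ range (m + 1), (-(q ^ (e + m))⁻¹) ^ t * q ^ t.choose 2) *
        ∏ t ∈ range (m + 1), qp q q (e + m) := by
    rw [← prod_range_reflect (fun t => qp q q (e + t)), ← prod_mul_distrib, ← prod_mul_distrib]
    refine prod_congr rfl fun t ht => ?_
    rw [← h2 t ht]
    rfl
  have h5 : ∀ t, qp (q ^ (2 * e + δ + 1 + t)) q (t + 1) =
      qp (q ^ (2 * e + δ + 1 + t)) q t * (1 - q ^ (2 * (e + t) + 1 + δ)) := fun t => by
    rw [qp_succ]; congr 2; ring
  simp only [qp_neg_mul_coef_div_coef hq, h5, ← h1]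
  have h6 : ∏ t ∈ range (m + 1), qp (-1 * q ^ (e + 1 + δ)) q t ≠ 0 :=
    prod_ne_zero_iff.mpr fun t _ => hγ t
  simp only [prod_mul_distrib, prod_div_distrib, prod_const, card_range] at h4 ⊢
  generalize (∏ t ∈ range (m + 1), qp (q ^ (e + m))⁻¹ q t) = A at *
  generalize (∏ t ∈ range (m + 1), qp (-1 * q ^ (e + 1 + δ)) q t) = B at *
  generalize (∏ t ∈ range (m + 1), (-(q ^ (e + m))⁻¹) ^ t) = C at *
  generalize (∏ t ∈ range (m + 1), (q ^ (e + t))⁻¹) = D at *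
  field_simp
  linear_combination (-(D * (∏ t ∈ range (m + 1), qp (q ^ (2 * e + δ + 1 + t)) q t) *
    (∏ t ∈ range (m + 1), (1 - q ^ (2 * (e + t) + 1 + δ))) / c ^ (m + 1))) * h4

/-- The factor in front of the series of base `q` with `a = q^{1/2}`, where `A N` stands for
`(q^{3/2}; q)_N / (-q^{1/2}; q)_N` in even degree and `(q^{3/2}; q)_N / (-q^{3/2}; q)_N` in odd
degree. -/
theorem prefactor_half (hq : NotRootOfUnity q) (A : ℕ → ℂ) (c : ℂ) :
    r ^ (-(((2 * e + m : ℕ) : ℤ) * ((m + 1 : ℕ) : ℤ) / 2)) * qp (-q) q (e + δ) ^ (m + 1) /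
        (c ^ (m + 1) * qp q q (e + m) ^ (m + 1)) *
      (∏ t ∈ range (m + 1), qp (q ^ (2 * e + δ + 1 + t)) q t * A (e + m - t)) *
      ∏ t ∈ range (m + 1), (qp q q (e + m) * qp (-1 * q ^ (e + 1 + δ)) q t) =
    ∏ t ∈ range (m + 1), (qp (-1 * q ^ (2 * e + δ + 1 + t)) q t *
        (coef q ((2 * e + δ + t : ℕ) : ℤ) / coef q ((2 * e + δ + 2 * t : ℕ) : ℤ)) *
        ((r ^ (e + t))⁻¹ * (qp (-q) q (e + t + δ) * A (e + t)) / (c * qp q q (e + t))) *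
          qp q q (e + t)) := by
  have hqN := qp_self_ne_zero hq
  have h1 : ∏ t ∈ range (m + 1), A (e + m - t) = ∏ t ∈ range (m + 1), A (e + t) := by
    rw [← prod_range_reflect (fun t => A (e + t))]
    refine prod_congr rfl fun t ht => ?_
    have ht : t ≤ m := by simpa [Nat.lt_succ_iff] using ht
    congr 1
    omega
  have h2 : ∀ t, qp (-q) q (e + t + δ) = qp (-1 * q ^ (e + 1 + δ)) q t * qp (-q) q (e + δ) :=
    fun t => by
      rw [show e + t + δ = e + δ + t by ring, ← qp_pow_mul_qp]
      congr 2
      ring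
  have h3 : ∀ t, (r ^ (e + t))⁻¹ * (qp (-q) q (e + t + δ) * A (e + t)) / (c * qp q q (e + t)) *
      qp q q (e + t) = (r ^ (e + t))⁻¹ * (qp (-1 * q ^ (e + 1 + δ)) q t * qp (-q) q (e + δ) *
        A (e + t)) / c := fun t => by
    have := hqN (e + t)
    rw [h2]
    generalize (r ^ (e + t))⁻¹ = R
    field_simp
  simp only [qp_neg_mul_coef_div_coef hq, mul_assoc _ _ (qp q q _), h3, ← prod_inv_pow_eq_zpow]
  simp only [prod_mul_distrib, prod_div_distrib, prod_const, card_range, h1]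
  have := pow_ne_zero (m + 1) (hqN (e + m))
  generalize (∏ t ∈ range (m + 1), (r ^ (e + t))⁻¹) = R
  field_simp

/-- The condition on the factor in front of a series of base `q²`, with the part common to all of
them removed: what is left, in `h`, no longer contains the power of `qpInt`. -/
theorem prefactor_sq (hq : NotRootOfUnity q) (hδ : δ = 0 ∨ δ = 1) {pref : ℂ} {η : ℕ → ℂ}
    (h : pref * ∏ t ∈ range (m + 1), qp (q ^ 2) (q ^ 2) (e + t + δ) = ∏ t ∈ range (m + 1),
      (qp (q ^ (2 * e + δ + 1 + t)) q t ^ 2 * η (e + t) * qp (q ^ 2) (q ^ 2) (e + t))) :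
    pref / qpInt ((q ^ 2) ^ (e + 1 + δ)) (q ^ 2) ((m : ℤ) - δ) ^ (m + 1) *
      ∏ t ∈ range (m + 1), (qp (q ^ 2) (q ^ 2) (e + m) *
        qp (1 * (q ^ 2) ^ (e + 1 + δ)) (q ^ 2) t) =
    ∏ t ∈ range (m + 1), (qp (1 * (q ^ 2) ^ (2 * e + δ + 1 + t)) (q ^ 2) t *
        (coef q ((2 * e + δ + t : ℕ) : ℤ) / coef q ((2 * e + δ + 2 * t : ℕ) : ℤ)) * η (e + t) *
          qp (q ^ 2) (q ^ 2) (e + t)) := by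
  have hb : NotRootOfUnity (q ^ 2) := hq.pow (by norm_num)
  have hqN := qp_self_ne_zero hb
  simp only [qp_sq_mul_coef_div_coef hq]
  rw [← h]
  have h1 := qpInt_pow_mul hb e m hδ
  have h2 : ∀ t, qp (q ^ 2) (q ^ 2) (e + t + δ) =
      qp (1 * (q ^ 2) ^ (e + 1 + δ)) (q ^ 2) t * qp (q ^ 2) (q ^ 2) (e + δ) :=
    fun t => by
      rw [show e + t + δ = e + δ + t by ring, ← qp_pow_mul_qp]
      congr 2
      ring
  have h3 : qpInt ((q ^ 2) ^ (e + 1 + δ)) (q ^ 2) ((m : ℤ) - δ) ≠ 0 :=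
    left_ne_zero_of_mul (b := qp (q ^ 2) (q ^ 2) (e + δ)) (by rw [h1]; exact hqN _)
  simp only [h2, ← h1, prod_mul_distrib, prod_const, card_range]
  field_simp

theorem prefactor_oddC (hrq : r ^ 2 = q) :
    r ^ (-(((2 * e + m : ℕ) : ℤ) * ((m + 1 : ℕ) : ℤ))) / (1 - q) ^ (m + 1) *
      (∏ t ∈ range (m + 1), qp (q ^ (2 * e + 0 + 1 + t)) q (m + 1)) *
        ∏ t ∈ range (m + 1), qp (q ^ 2) (q ^ 2) (e + t + 0) = ∏ t ∈ range (m + 1),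
      (qp (q ^ (2 * e + 0 + 1 + t)) q t ^ 2 * ((q ^ (e + t))⁻¹ * (1 - q ^ (2 * (e + t) + 1)) /
        (1 - q)) * qp (q ^ 2) (q ^ 2) (e + t)) := by
  rw [← prod_inv_sq_pow_eq_zpow, hrq, prod_qp_eq_prod_sq]
  simp only [show ∀ t, 2 * e + 0 + 1 + 2 * t = 2 * (e + t) + 1 by intro t; ring, add_zero]
  simp only [prod_mul_distrib, prod_div_distrib, prod_const, card_range]
  ring

theorem prefactor_oddD :
    q ^ (-(((2 * e + m : ℕ) : ℤ) * ((m + 1 : ℕ) : ℤ))) / (1 - q) ^ (2 * (m + 1)) *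
      (∏ t ∈ range (m + 1), qp (q ^ (2 * e + 0 + 1 + t)) q (t + 1) ^ 2) *
        ∏ t ∈ range (m + 1), qp (q ^ 2) (q ^ 2) (e + t + 0) = ∏ t ∈ range (m + 1),
      (qp (q ^ (2 * e + 0 + 1 + t)) q t ^ 2 * ((q ^ (e + t))⁻¹ * (1 - q ^ (2 * (e + t) + 1)) /
        (1 - q)) ^ 2 * qp (q ^ 2) (q ^ 2) (e + t)) := by
  have h : ∀ t, qp (q ^ (2 * e + 0 + 1 + t)) q (t + 1) =
      qp (q ^ (2 * e + 0 + 1 + t)) q t * (1 - q ^ (2 * (e + t) + 1)) := fun t => by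
    rw [qp_succ]; congr 2; ring
  have h1 : ∀ t, ((q ^ (e + t))⁻¹) ^ 2 = ((q ^ 2) ^ (e + t))⁻¹ := fun t => by
    rw [inv_pow, pow_right_comm]
  rw [← prod_inv_sq_pow_eq_zpow]
  simp only [h, h1, mul_pow, div_pow, prod_mul_distrib, prod_div_distrib, prod_const, card_range,
    pow_mul, add_zero]
  ring

theorem prefactor_evenC (hrq : r ^ 2 = q) :
    r ^ (-(((2 * e + m : ℕ) : ℤ) * ((m + 1 : ℕ) : ℤ))) / (1 - q) ^ (2 * (m + 1)) *
      (∏ t ∈ range (m + 1), qp (q ^ (2 * e + 1 + 1 + t)) q t ^ 2) *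
        ∏ t ∈ range (m + 1), qp (q ^ 2) (q ^ 2) (e + t + 1) = ∏ t ∈ range (m + 1),
      (qp (q ^ (2 * e + 1 + 1 + t)) q t ^ 2 * ((q ^ (e + t))⁻¹ * (1 - q ^ (2 * (e + t) + 2)) /
        (1 - q) ^ 2) * qp (q ^ 2) (q ^ 2) (e + t)) := by
  have h : ∀ t, qp (q ^ 2) (q ^ 2) (e + t + 1) =
      qp (q ^ 2) (q ^ 2) (e + t) * (1 - q ^ (2 * (e + t) + 2)) := fun t => by
    rw [qp_succ]; congr 2; ring
  rw [← prod_inv_sq_pow_eq_zpow, hrq]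
  simp only [h, prod_mul_distrib, prod_div_distrib, prod_const, card_range, pow_mul]
  ring

theorem prefactor_evenD :
    q ^ (-(((2 * e + m : ℕ) : ℤ) * ((m + 1 : ℕ) : ℤ))) / ((1 - q) ^ (2 * (m + 1)) *
        (1 - q ^ 2) ^ (m + 1)) *
      (∏ t ∈ range (m + 1), qp (q ^ (2 * e + 1 + 1 + t)) q (m + 1)) *
        ∏ t ∈ range (m + 1), qp (q ^ 2) (q ^ 2) (e + t + 1) = ∏ t ∈ range (m + 1),
      (qp (q ^ (2 * e + 1 + 1 + t)) q t ^ 2 * (((q ^ (e + t))⁻¹ * (1 - q ^ (2 * (e + t) + 2)) /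
        (1 - q)) ^ 2 / (1 - q ^ 2)) * qp (q ^ 2) (q ^ 2) (e + t)) := by
  have h : ∀ t, qp (q ^ 2) (q ^ 2) (e + t + 1) =
      qp (q ^ 2) (q ^ 2) (e + t) * (1 - q ^ (2 * (e + t) + 2)) := fun t => by
    rw [qp_succ]; congr 2; ring
  have h1 : ∀ t, ((q ^ (e + t))⁻¹) ^ 2 = ((q ^ 2) ^ (e + t))⁻¹ := fun t => by
    rw [inv_pow, pow_right_comm]
  rw [← prod_inv_sq_pow_eq_zpow, prod_qp_eq_prod_sq]
  simp only [show ∀ t, 2 * e + 1 + 1 + 2 * t = 2 * (e + t) + 2 by intro t; ring]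
  simp only [h, h1, mul_pow, div_pow, prod_mul_distrib, prod_div_distrib, prod_const, card_range,
    pow_mul, prod_pow]
  generalize 1 - q = u
  generalize 1 - q ^ 2 = v
  ring

end

/-! ### The eight multiple series -/

section

variable {q r : ℂ} {e m : ℕ}

theorem zpow_eq_inv_pow (hrq : r ^ 2 = q) {z : ℤ} {N : ℕ} (h : z = -(2 * N : ℤ)) :
    r ^ z = (q ^ N)⁻¹ := by
  rw [h, zpow_neg, ← hrq, ← pow_mul]
  exact_mod_cast rfl

theorem zpow_eq_pow (hrq : r ^ 2 = q) {z : ℤ} {N : ℕ} (h : z = 2 * N) : r ^ z = q ^ N := by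
  rw [h, ← hrq, ← pow_mul]
  exact_mod_cast rfl

theorem schlosserSummand_eq {b α γ a c₁ c₂ c₃ c₄ : ℂ} (x : Fin m → ℂ) (k : Fin m → ℕ) :
    schlosserSummand b (fun i => [α, γ, a * x i, a / x i]) [c₁, c₂, c₃, c₄] k =
      pairProd (fun i j => b ^ k j - b ^ k i) * ∏ i, (qp α b (k i) * qp γ b (k i) /
        (qp c₁ b (k i) * qp c₂ b (k i) * (qp c₃ b (k i) * qp c₄ b (k i))) * b ^ k i *
          (qp (a * x i) b (k i) * qp (a / x i) b (k i))) := by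
  simp only [schlosserSummand, qps_four]
  congr 1
  exact prod_congr rfl fun i _ => by ring

/-! In this part there are `m + 1` variables. As `m + 1 ≤ n + 1`, the parity of the sum of `n` and
the number of variables leaves the cases `n = 2 e + m` and `n = 2 e + 1 + m`, and the summation
indices run up to `e + m` in both. -/

theorem value_oddA (hr : NotRootOfUnity r) (hrq : r ^ 2 = q) (e : ℕ)
    {x : Fin (m + 1) → ℂ} (hx : ∀ i, x i ≠ 0) :
    pairProd (fun i j => 1 - x i * x j) * P (2 * e + m) q x =
      (oddA (2 * e + m) q r x).value ((2 * e + m + (m + 1) - 1) / 2) := by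
  have hq : NotRootOfUnity q := hrq ▸ hr.pow (by norm_num)
  have h1 : 1 - q ≠ 0 := by simpa using hq.one_sub_pow_ne one_ne_zero
  have hN : (2 * e + m + (m + 1) - 1) / 2 = e + m := by omega
  have hα : r ^ (1 - ((2 * e + m : ℕ) : ℤ) - ((m + 1 : ℕ) : ℤ)) = (q ^ (e + m))⁻¹ :=
    zpow_eq_inv_pow hrq (by push_cast; ring)
  have hγ : -r ^ (3 + ((2 * e + m : ℕ) : ℤ) - ((m + 1 : ℕ) : ℤ)) = -1 * q ^ (e + 1 + 0) := by
    rw [zpow_eq_pow hrq (N := e + 1 + 0) (by push_cast; ring), neg_one_mul]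
  have hβ : ∀ i : ℕ, q ^ (((2 * e + m : ℕ) : ℤ) + 1 - ((m + 1 : ℕ) : ℤ) + (i + 1)) =
      q ^ (2 * e + 0 + 1 + i) := fun i => by
    rw [← zpow_natCast]; congr 1; push_cast; ring
  set η : ℕ → ℂ := fun N => (q ^ N)⁻¹ * (1 - q ^ (2 * N + 1 + 0)) / (1 - q) with hη
  have hη0 : ∀ N, η N ≠ 0 := fun N =>
    div_ne_zero (mul_ne_zero (inv_ne_zero (pow_ne_zero _ hq.ne_zero))
    (hq.one_sub_pow_ne (by omega))) h1
  have hf : ∀ N x, x ≠ 0 → rogers q (2 * N + 0) x = η N * 1 * x ^ N *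
      ∑ k ∈ range (N + 1), qp (q ^ N)⁻¹ q k * qp (-1 * q ^ (N + 1 + 0)) q k /
        (qp q q k * qp q q k * (qp (r ^ 3) q k * qp (-r ^ 3) q k)) * q ^ k *
          (qp (q * x) q k * qp (q / x) q k) := fun N x hx =>
    (rogers_eq_series_self hr hrq N hx).1.trans (by simp only [hη, add_zero, mul_one])
  have key := pairProd_mul_P_eq_series (δ := 0) (u := fun _ => 1) hq hq hη0
    (neg_ne_zero.mpr one_ne_zero) (fun j _ => by simpa using hq.one_add_pow_ne j) hf e m
    (prefactor_self (δ := 0) hr hrq (1 - q)) hx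
  have hn : 2 * e + 0 + m = 2 * e + m := rfl
  rw [hn] at key
  rw [key, hN, MultiSeries.value]
  congr 1
  · simp only [oddA, qps_two, hα, hγ, hβ, prod_mul_distrib, hN]
    rw [Fin.prod_univ_eq_prod_range (fun i => qp (q ^ (2 * e + 0 + 1 + i)) q (i + 1) /
        (qp (q ^ (e + m))⁻¹ q i * qp (-1 * q ^ (e + 1 + 0)) q i))]
    simp only [prod_const_one, one_mul, mul_assoc]
  · exact sum_congr rfl fun k _ => by simp only [oddA, schlosserSummand_eq, hα, hγ]

theorem value_evenA (hr : NotRootOfUnity r) (hrq : r ^ 2 = q) (e : ℕ)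
    {x : Fin (m + 1) → ℂ} (hx : ∀ i, x i ≠ 0) :
    pairProd (fun i j => 1 - x i * x j) * P (2 * e + 1 + m) q x =
      (evenA (2 * e + 1 + m) q r x).value ((2 * e + 1 + m + (m + 1) - 2) / 2) := by
  have hq : NotRootOfUnity q := hrq ▸ hr.pow (by norm_num)
  have h1 : 1 - q ≠ 0 := by simpa using hq.one_sub_pow_ne one_ne_zero
  have hN : (2 * e + 1 + m + (m + 1) - 2) / 2 = e + m := by omega
  have hα : r ^ (2 - ((2 * e + 1 + m : ℕ) : ℤ) - ((m + 1 : ℕ) : ℤ)) = (q ^ (e + m))⁻¹ :=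
    zpow_eq_inv_pow hrq (by push_cast; ring)
  have hγ : -r ^ (4 + ((2 * e + 1 + m : ℕ) : ℤ) - ((m + 1 : ℕ) : ℤ)) = -1 * q ^ (e + 1 + 1) := by
    rw [zpow_eq_pow hrq (N := e + 1 + 1) (by push_cast; ring), neg_one_mul]
  have hβ : ∀ i : ℕ, q ^ (((2 * e + 1 + m : ℕ) : ℤ) + 1 - ((m + 1 : ℕ) : ℤ) + (i + 1)) =
      q ^ (2 * e + 1 + 1 + i) := fun i => by
    rw [← zpow_natCast]; congr 1; push_cast; ring
  have hn : ((2 * e + 1 + m : ℕ) : ℤ) - 1 = ((2 * e + m : ℕ) : ℤ) := by push_cast; ring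
  set η : ℕ → ℂ := fun N => (q ^ N)⁻¹ * (1 - q ^ (2 * N + 1 + 1)) / (1 - q) ^ 2 with hη
  have hη0 : ∀ N, η N ≠ 0 := fun N =>
    div_ne_zero (mul_ne_zero (inv_ne_zero (pow_ne_zero _ hq.ne_zero))
    (hq.one_sub_pow_ne (by omega))) (pow_ne_zero _ h1)
  have hf : ∀ N x, x ≠ 0 → rogers q (2 * N + 1) x = η N * (1 - x) * x ^ N *
      ∑ k ∈ range (N + 1), qp (q ^ N)⁻¹ q k * qp (-1 * q ^ (N + 1 + 1)) q k /
        (qp q q k * qp (q ^ 2) q k * (qp (r ^ 3) q k * qp (-r ^ 3) q k)) * q ^ k *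
          (qp (q * x) q k * qp (q / x) q k) := fun N x hx =>
    (rogers_eq_series_self hr hrq N hx).2.trans (by simp only [hη, add_assoc, Nat.reduceAdd])
  have key := pairProd_mul_P_eq_series (δ := 1) (u := fun x => 1 - x) hq hq hη0
    (neg_ne_zero.mpr one_ne_zero) (fun j _ => by simpa using hq.one_add_pow_ne j) hf e m
    (prefactor_self (δ := 1) hr hrq ((1 - q) ^ 2)) hx
  rw [key, hN, MultiSeries.value]
  congr 1
  · simp only [evenA, qps_two, hα, hγ, hβ, hn, prod_mul_distrib, hN]
    rw [Fin.prod_univ_eq_prod_range (fun i => qp (q ^ (2 * e + 1 + 1 + i)) q (i + 1) /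
        (qp (q ^ (e + m))⁻¹ q i * qp (-1 * q ^ (e + 1 + 1)) q i))]
    rw [pow_mul]
  · exact sum_congr rfl fun k _ => by simp only [evenA, schlosserSummand_eq, hα, hγ]

theorem value_oddB (hr : NotRootOfUnity r) (hrq : r ^ 2 = q) (e : ℕ)
    {x : Fin (m + 1) → ℂ} (hx : ∀ i, x i ≠ 0) :
    pairProd (fun i j => 1 - x i * x j) * P (2 * e + m) q x =
      (oddB (2 * e + m) q r x).value ((2 * e + m + (m + 1) - 1) / 2) := by
  have hq : NotRootOfUnity q := hrq ▸ hr.pow (by norm_num)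
  have h1 : 1 - q ≠ 0 := by simpa using hq.one_sub_pow_ne one_ne_zero
  have hN : (2 * e + m + (m + 1) - 1) / 2 = e + m := by omega
  have hα : r ^ (1 - ((2 * e + m : ℕ) : ℤ) - ((m + 1 : ℕ) : ℤ)) = (q ^ (e + m))⁻¹ :=
    zpow_eq_inv_pow hrq (by push_cast; ring)
  have hγ : -r ^ (3 + ((2 * e + m : ℕ) : ℤ) - ((m + 1 : ℕ) : ℤ)) = -1 * q ^ (e + 1 + 0) := by
    rw [zpow_eq_pow hrq (N := e + 1 + 0) (by push_cast; ring), neg_one_mul]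
  have hβ : ∀ i : ℕ, q ^ (((2 * e + m : ℕ) : ℤ) + 1 - ((m + 1 : ℕ) : ℤ) + (i + 1)) =
      q ^ (2 * e + 0 + 1 + i) := fun i => by
    rw [← zpow_natCast]; congr 1; push_cast; ring
  have he : (2 * e + m + 1 - (m + 1)) / 2 = e + 0 := by omega
  have hi : ∀ i, (2 * e + m + (m + 1) + 1 - 2 * (i + 1)) / 2 = e + m - i := fun i => by omega
  set η : ℕ → ℂ := fun N => (r ^ N)⁻¹ * (qp (-q) q (N + 0) * (qp (r ^ 3) q N / qp (-r) q N)) /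
      (1 * qp q q N) with hη
  have hη0 : ∀ N, η N ≠ 0 := fun N =>
    div_ne_zero (mul_ne_zero (inv_ne_zero (pow_ne_zero _ hr.ne_zero))
    (mul_ne_zero (qp_neg_self_ne_zero hq _) (div_ne_zero
      (by rw [← hrq]; exact hr.qp_ne_zero three_ne_zero N)
      (by rw [← hrq]; simpa using hr.qp_neg_ne_zero 1 2 N))))
    (mul_ne_zero one_ne_zero (qp_self_ne_zero hq _))
  have hf : ∀ N x, x ≠ 0 → rogers q (2 * N + 0) x = η N * 1 * x ^ N *
      ∑ k ∈ range (N + 1), qp (q ^ N)⁻¹ q k * qp (-1 * q ^ (N + 1 + 0)) q k /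
        (qp q q k * qp r q k * (qp (r ^ 3) q k * qp (-q) q k)) * q ^ k *
          (qp (r * x) q k * qp (r / x) q k) := fun N x hx =>
    (rogers_eq_series_half hr hrq N hx).1.trans (by simp only [hη, add_zero, mul_one]; ring)
  have key := pairProd_mul_P_eq_series (δ := 0) (u := fun _ => 1) hq hq hη0
    (neg_ne_zero.mpr one_ne_zero) (fun j _ => by simpa using hq.one_add_pow_ne j) hf e m
    (prefactor_half (δ := 0) hq (fun N => qp (r ^ 3) q N / qp (-r) q N) 1) hx
  have hn : 2 * e + 0 + m = 2 * e + m := rfl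
  rw [hn] at key
  rw [key, hN, MultiSeries.value]
  congr 1
  · simp only [oddB, hβ, he, hi, prod_mul_distrib, hN]
    rw [Fin.prod_univ_eq_prod_range (fun i => qp (q ^ (2 * e + 0 + 1 + i)) q i *
      qp (r ^ 3) q (e + m - i) / qp (-r) q (e + m - i))]
    simp only [mul_div_assoc, prod_mul_distrib, prod_const_one, one_pow, one_mul, mul_assoc]
  · exact sum_congr rfl fun k _ => by simp only [oddB, schlosserSummand_eq, hα, hγ]

theorem value_evenB (hr : NotRootOfUnity r) (hrq : r ^ 2 = q) (e : ℕ)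
    {x : Fin (m + 1) → ℂ} (hx : ∀ i, x i ≠ 0) :
    pairProd (fun i j => 1 - x i * x j) * P (2 * e + 1 + m) q x =
      (evenB (2 * e + 1 + m) q r x).value ((2 * e + 1 + m + (m + 1) - 2) / 2) := by
  have hq : NotRootOfUnity q := hrq ▸ hr.pow (by norm_num)
  have h1 : 1 - q ≠ 0 := by simpa using hq.one_sub_pow_ne one_ne_zero
  have hN : (2 * e + 1 + m + (m + 1) - 2) / 2 = e + m := by omega
  have hα : r ^ (2 - ((2 * e + 1 + m : ℕ) : ℤ) - ((m + 1 : ℕ) : ℤ)) = (q ^ (e + m))⁻¹ :=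
    zpow_eq_inv_pow hrq (by push_cast; ring)
  have hγ : -r ^ (4 + ((2 * e + 1 + m : ℕ) : ℤ) - ((m + 1 : ℕ) : ℤ)) = -1 * q ^ (e + 1 + 1) := by
    rw [zpow_eq_pow hrq (N := e + 1 + 1) (by push_cast; ring), neg_one_mul]
  have hβ : ∀ i : ℕ, q ^ (((2 * e + 1 + m : ℕ) : ℤ) + 1 - ((m + 1 : ℕ) : ℤ) + (i + 1)) =
      q ^ (2 * e + 1 + 1 + i) := fun i => by
    rw [← zpow_natCast]; congr 1; push_cast; ring
  have hn : ((2 * e + 1 + m : ℕ) : ℤ) - 1 = ((2 * e + m : ℕ) : ℤ) := by push_cast; ring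
  have he : (2 * e + 1 + m + 2 - (m + 1)) / 2 = e + 1 := by omega
  have hi : ∀ i, (2 * e + 1 + m + (m + 1) - 2 * (i + 1)) / 2 = e + m - i := fun i => by omega
  set η : ℕ → ℂ := fun N => (r ^ N)⁻¹ * (qp (-q) q (N + 1) * (qp (r ^ 3) q N / qp (-r ^ 3) q N)) /
      ((1 - q) * qp q q N) with hη
  have hη0 : ∀ N, η N ≠ 0 := fun N =>
    div_ne_zero (mul_ne_zero (inv_ne_zero (pow_ne_zero _ hr.ne_zero))
    (mul_ne_zero (qp_neg_self_ne_zero hq _) (div_ne_zero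
      (by rw [← hrq]; exact hr.qp_ne_zero three_ne_zero N)
      (by rw [← hrq]; exact hr.qp_neg_ne_zero 3 2 N))))
    (mul_ne_zero h1 (qp_self_ne_zero hq _))
  have hf : ∀ N x, x ≠ 0 → rogers q (2 * N + 1) x = η N * (1 - x) * x ^ N *
      ∑ k ∈ range (N + 1), qp (q ^ N)⁻¹ q k * qp (-1 * q ^ (N + 1 + 1)) q k /
        (qp q q k * qp (r ^ 3) q k * (qp (r ^ 3) q k * qp (-q) q k)) * q ^ k *
          (qp (r * x) q k * qp (r / x) q k) := fun N x hx =>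
    (rogers_eq_series_half hr hrq N hx).2.trans (by
      simp only [hη, add_assoc, Nat.reduceAdd]; generalize 1 - q = u; ring)
  have key := pairProd_mul_P_eq_series (δ := 1) (u := fun x => 1 - x) hq hq hη0
    (neg_ne_zero.mpr one_ne_zero) (fun j _ => by simpa using hq.one_add_pow_ne j) hf e m
    (prefactor_half (δ := 1) hq (fun N => qp (r ^ 3) q N / qp (-r ^ 3) q N) (1 - q)) hx
  rw [key, hN, MultiSeries.value]
  congr 1
  · simp only [evenB, hβ, he, hi, hn, prod_mul_distrib, hN]
    rw [Fin.prod_univ_eq_prod_range (fun i => qp (q ^ (2 * e + 1 + 1 + i)) q i *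
      qp (r ^ 3) q (e + m - i) / qp (-r ^ 3) q (e + m - i))]
    simp only [mul_div_assoc, prod_mul_distrib]
  · exact sum_congr rfl fun k _ => by simp only [evenB, schlosserSummand_eq, hα, hγ]

theorem value_oddC (hq : NotRootOfUnity q) (hrq : r ^ 2 = q) (e : ℕ)
    {x : Fin (m + 1) → ℂ} (hx : ∀ i, x i ≠ 0) :
    pairProd (fun i j => 1 - x i * x j) * P (2 * e + m) q x =
      (oddC (2 * e + m) q r x).value ((2 * e + m + (m + 1) - 1) / 2) := by
  have h1 : 1 - q ≠ 0 := by simpa using hq.one_sub_pow_ne one_ne_zero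
  have hN : (2 * e + m + (m + 1) - 1) / 2 = e + m := by omega
  have hα : q ^ (1 - ((2 * e + m : ℕ) : ℤ) - ((m + 1 : ℕ) : ℤ)) = ((q ^ 2) ^ (e + m))⁻¹ :=
    zpow_eq_inv_pow rfl (by push_cast; ring)
  have hγ : q ^ (3 + ((2 * e + m : ℕ) : ℤ) - ((m + 1 : ℕ) : ℤ)) = (q ^ 2) ^ (e + 1 + 0) :=
    zpow_eq_pow rfl (by push_cast; ring)
  have hγ' : q ^ (3 + ((2 * e + m : ℕ) : ℤ) - ((m + 1 : ℕ) : ℤ)) = 1 * (q ^ 2) ^ (e + 1 + 0) := by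
    rw [hγ, one_mul]
  have hm : ((m + 1 : ℕ) : ℤ) - 1 = (m : ℤ) - (0 : ℕ) := by push_cast; ring
  have hβ : ∀ i : ℕ, q ^ (((2 * e + m : ℕ) : ℤ) + 1 - ((m + 1 : ℕ) : ℤ) + (i + 1)) =
      q ^ (2 * e + 0 + 1 + i) := fun i => by
    rw [← zpow_natCast]; congr 1; push_cast; ring
  set η : ℕ → ℂ := fun N => (q ^ N)⁻¹ * (1 - q ^ (2 * N + 1)) / (1 - q) with hη
  have hη0 : ∀ N, η N ≠ 0 := fun N =>
    div_ne_zero (mul_ne_zero (inv_ne_zero (pow_ne_zero _ hq.ne_zero))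
    (hq.one_sub_pow_ne (by omega))) h1
  have hf : ∀ N x, x ≠ 0 → rogers q (2 * N + 0) x = η N * 1 * x ^ N *
      ∑ k ∈ range (N + 1), qp ((q ^ 2) ^ N)⁻¹ (q ^ 2) k * qp (1 * (q ^ 2) ^ (N + 1 + 0)) (q ^ 2) k /
        (qp q (q ^ 2) k * qp (q ^ 2) (q ^ 2) k * (qp (q ^ 2) (q ^ 2) k * qp (q ^ 3) (q ^ 2) k)) *
          (q ^ 2) ^ k *
          (qp (q * x) (q ^ 2) k * qp (q / x) (q ^ 2) k) := fun N x hx =>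
    (rogers_eq_series_sq_self hq N hx).1.trans (by simp only [hη, add_zero, mul_one])
  have key := pairProd_mul_P_eq_series (δ := 0) (u := fun _ => 1) hq (hq.pow two_ne_zero.bot_lt) hη0
    one_ne_zero
    (fun j hj => by rw [one_mul, ← pow_mul]; exact hq.one_sub_pow_ne (by omega)) hf e m
    (prefactor_sq (η := η) hq (Or.inl rfl) (prefactor_oddC hrq)) hx
  have hn : 2 * e + 0 + m = 2 * e + m := rfl
  rw [hn] at key
  rw [key, hN, MultiSeries.value]
  congr 1
  · simp only [oddC, hγ, hm, hβ, prod_mul_distrib, hN]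
    rw [Fin.prod_univ_eq_prod_range (fun i => qp (q ^ (2 * e + 0 + 1 + i)) q (m + 1))]
    generalize qpInt _ _ _ = z
    generalize 1 - q = u
    simp only [prod_const_one]
    ring
  · exact sum_congr rfl fun k _ => by simp only [oddC, schlosserSummand_eq, hα, hγ']

theorem value_evenC (hq : NotRootOfUnity q) (hrq : r ^ 2 = q) (e : ℕ)
    {x : Fin (m + 1) → ℂ} (hx : ∀ i, x i ≠ 0) :
    pairProd (fun i j => 1 - x i * x j) * P (2 * e + 1 + m) q x =
      (evenC (2 * e + 1 + m) q r x).value ((2 * e + 1 + m + (m + 1) - 2) / 2) := by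
  have h1 : 1 - q ≠ 0 := by simpa using hq.one_sub_pow_ne one_ne_zero
  have hN : (2 * e + 1 + m + (m + 1) - 2) / 2 = e + m := by omega
  have hα : q ^ (2 - ((2 * e + 1 + m : ℕ) : ℤ) - ((m + 1 : ℕ) : ℤ)) = ((q ^ 2) ^ (e + m))⁻¹ :=
    zpow_eq_inv_pow rfl (by push_cast; ring)
  have hγ : q ^ (4 + ((2 * e + 1 + m : ℕ) : ℤ) - ((m + 1 : ℕ) : ℤ)) = (q ^ 2) ^ (e + 1 + 1) :=
    zpow_eq_pow rfl (by push_cast; ring)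
  have hγ' : q ^ (4 + ((2 * e + 1 + m : ℕ) : ℤ) - ((m + 1 : ℕ) : ℤ)) =
      1 * (q ^ 2) ^ (e + 1 + 1) := by
    rw [hγ, one_mul]
  have hm : ((m + 1 : ℕ) : ℤ) - 2 = (m : ℤ) - (1 : ℕ) := by push_cast; ring
  have hβ : ∀ i : ℕ, q ^ (((2 * e + 1 + m : ℕ) : ℤ) + 1 - ((m + 1 : ℕ) : ℤ) + (i + 1)) =
      q ^ (2 * e + 1 + 1 + i) := fun i => by
    rw [← zpow_natCast]; congr 1; push_cast; ring
  have hn : ((2 * e + 1 + m : ℕ) : ℤ) - 1 = ((2 * e + m : ℕ) : ℤ) := by push_cast; ring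
  set η : ℕ → ℂ := fun N => (q ^ N)⁻¹ * (1 - q ^ (2 * N + 2)) / (1 - q) ^ 2 with hη
  have hη0 : ∀ N, η N ≠ 0 := fun N =>
    div_ne_zero (mul_ne_zero (inv_ne_zero (pow_ne_zero _ hq.ne_zero))
    (hq.one_sub_pow_ne (by omega))) (pow_ne_zero _ h1)
  have hf : ∀ N x, x ≠ 0 → rogers q (2 * N + 1) x = η N * (1 - x) * x ^ N *
      ∑ k ∈ range (N + 1), qp ((q ^ 2) ^ N)⁻¹ (q ^ 2) k * qp (1 * (q ^ 2) ^ (N + 1 + 1)) (q ^ 2) k /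
        (qp (q ^ 2) (q ^ 2) k * qp (q ^ 2) (q ^ 2) k *
          (qp (q ^ 3) (q ^ 2) k * qp (q ^ 3) (q ^ 2) k)) * (q ^ 2) ^ k *
          (qp (q * x) (q ^ 2) k * qp (q / x) (q ^ 2) k) := fun N x hx =>
    (rogers_eq_series_sq_self hq N hx).2.trans (by simp only [hη, add_assoc, Nat.reduceAdd])
  have key := pairProd_mul_P_eq_series (δ := 1) (u := fun x => 1 - x) hq
    (hq.pow two_ne_zero.bot_lt) hη0
    one_ne_zero
    (fun j hj => by rw [one_mul, ← pow_mul]; exact hq.one_sub_pow_ne (by omega)) hf e m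
    (prefactor_sq (η := η) hq (Or.inr rfl) (prefactor_evenC hrq)) hx
  rw [key, hN, MultiSeries.value]
  congr 1
  · simp only [evenC, hγ, hm, hβ, hn, prod_mul_distrib, hN]
    rw [Fin.prod_univ_eq_prod_range (fun i => qp (q ^ (2 * e + 1 + 1 + i)) q i ^ 2)]
    generalize qpInt _ _ _ = z
    generalize 1 - q = u
    ring
  · exact sum_congr rfl fun k _ => by simp only [evenC, schlosserSummand_eq, hα, hγ']

theorem value_oddD (hq : NotRootOfUnity q) (e : ℕ)
    {x : Fin (m + 1) → ℂ} (hx : ∀ i, x i ≠ 0) :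
    pairProd (fun i j => 1 - x i * x j) * P (2 * e + m) q x =
      (oddD (2 * e + m) q x).value ((2 * e + m + (m + 1) - 1) / 2) := by
  have h1 : 1 - q ≠ 0 := by simpa using hq.one_sub_pow_ne one_ne_zero
  have hN : (2 * e + m + (m + 1) - 1) / 2 = e + m := by omega
  have hα : q ^ (1 - ((2 * e + m : ℕ) : ℤ) - ((m + 1 : ℕ) : ℤ)) = ((q ^ 2) ^ (e + m))⁻¹ :=
    zpow_eq_inv_pow rfl (by push_cast; ring)
  have hγ : q ^ (3 + ((2 * e + m : ℕ) : ℤ) - ((m + 1 : ℕ) : ℤ)) = (q ^ 2) ^ (e + 1 + 0) :=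
    zpow_eq_pow rfl (by push_cast; ring)
  have hγ' : q ^ (3 + ((2 * e + m : ℕ) : ℤ) - ((m + 1 : ℕ) : ℤ)) = 1 * (q ^ 2) ^ (e + 1 + 0) := by
    rw [hγ, one_mul]
  have hm : ((m + 1 : ℕ) : ℤ) - 1 = (m : ℤ) - (0 : ℕ) := by push_cast; ring
  have hβ : ∀ i : ℕ, q ^ (((2 * e + m : ℕ) : ℤ) + 1 - ((m + 1 : ℕ) : ℤ) + (i + 1)) =
      q ^ (2 * e + 0 + 1 + i) := fun i => by
    rw [← zpow_natCast]; congr 1; push_cast; ring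
  set η : ℕ → ℂ := fun N => ((q ^ N)⁻¹ * (1 - q ^ (2 * N + 1)) / (1 - q)) ^ 2 with hη
  have hη0 : ∀ N, η N ≠ 0 := fun N => pow_ne_zero _ (div_ne_zero (mul_ne_zero
    (inv_ne_zero (pow_ne_zero _ hq.ne_zero)) (hq.one_sub_pow_ne (by omega))) h1)
  have hf : ∀ N x, x ≠ 0 → rogers q (2 * N + 0) x = η N * 1 * x ^ N *
      ∑ k ∈ range (N + 1), qp ((q ^ 2) ^ N)⁻¹ (q ^ 2) k * qp (1 * (q ^ 2) ^ (N + 1 + 0)) (q ^ 2) k /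
        (qp (q ^ 2) (q ^ 2) k * qp (q ^ 2) (q ^ 2) k *
          (qp (q ^ 3) (q ^ 2) k * qp (q ^ 3) (q ^ 2) k)) * (q ^ 2) ^ k *
          (qp (q ^ 2 * x) (q ^ 2) k * qp (q ^ 2 / x) (q ^ 2) k) := fun N x hx =>
    (rogers_eq_series_sq_sq hq N hx).1.trans (by simp only [hη, add_zero, mul_one])
  have key := pairProd_mul_P_eq_series (δ := 0) (u := fun _ => 1) hq (hq.pow two_ne_zero.bot_lt) hη0
    one_ne_zero
    (fun j hj => by rw [one_mul, ← pow_mul]; exact hq.one_sub_pow_ne (by omega)) hf e m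
    (prefactor_sq (η := η) hq (Or.inl rfl) prefactor_oddD) hx
  have hn : 2 * e + 0 + m = 2 * e + m := rfl
  rw [hn] at key
  rw [key, hN, MultiSeries.value]
  congr 1
  · simp only [oddD, hγ, hm, hβ, prod_mul_distrib, hN]
    rw [Fin.prod_univ_eq_prod_range (fun i => qp (q ^ (2 * e + 0 + 1 + i)) q (i + 1) ^ 2)]
    generalize qpInt _ _ _ = z
    generalize 1 - q = u
    simp only [prod_const_one]
    ring
  · exact sum_congr rfl fun k _ => by simp only [oddD, schlosserSummand_eq, hα, hγ']

theorem value_evenD (hq : NotRootOfUnity q) (e : ℕ)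
    {x : Fin (m + 1) → ℂ} (hx : ∀ i, x i ≠ 0) :
    pairProd (fun i j => 1 - x i * x j) * P (2 * e + 1 + m) q x =
      (evenD (2 * e + 1 + m) q x).value ((2 * e + 1 + m + (m + 1) - 2) / 2) := by
  have h1 : 1 - q ≠ 0 := by simpa using hq.one_sub_pow_ne one_ne_zero
  have hN : (2 * e + 1 + m + (m + 1) - 2) / 2 = e + m := by omega
  have hα : q ^ (2 - ((2 * e + 1 + m : ℕ) : ℤ) - ((m + 1 : ℕ) : ℤ)) = ((q ^ 2) ^ (e + m))⁻¹ :=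
    zpow_eq_inv_pow rfl (by push_cast; ring)
  have hγ : q ^ (4 + ((2 * e + 1 + m : ℕ) : ℤ) - ((m + 1 : ℕ) : ℤ)) = (q ^ 2) ^ (e + 1 + 1) :=
    zpow_eq_pow rfl (by push_cast; ring)
  have hγ' : q ^ (4 + ((2 * e + 1 + m : ℕ) : ℤ) - ((m + 1 : ℕ) : ℤ)) =
      1 * (q ^ 2) ^ (e + 1 + 1) := by
    rw [hγ, one_mul]
  have hm : ((m + 1 : ℕ) : ℤ) - 2 = (m : ℤ) - (1 : ℕ) := by push_cast; ring
  have hβ : ∀ i : ℕ, q ^ (((2 * e + 1 + m : ℕ) : ℤ) + 1 - ((m + 1 : ℕ) : ℤ) + (i + 1)) =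
      q ^ (2 * e + 1 + 1 + i) := fun i => by
    rw [← zpow_natCast]; congr 1; push_cast; ring
  have hn : ((2 * e + 1 + m : ℕ) : ℤ) - 1 = ((2 * e + m : ℕ) : ℤ) := by push_cast; ring
  set η : ℕ → ℂ := fun N => ((q ^ N)⁻¹ * (1 - q ^ (2 * N + 2)) / (1 - q)) ^ 2 / (1 - q ^ 2) with hη
  have hη0 : ∀ N, η N ≠ 0 := fun N => div_ne_zero (pow_ne_zero _ (div_ne_zero
    (mul_ne_zero (inv_ne_zero (pow_ne_zero _ hq.ne_zero)) (hq.one_sub_pow_ne (by omega))) h1))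
      (hq.one_sub_pow_ne two_ne_zero)
  have hf : ∀ N x, x ≠ 0 → rogers q (2 * N + 1) x = η N * (1 - x) * x ^ N *
      ∑ k ∈ range (N + 1), qp ((q ^ 2) ^ N)⁻¹ (q ^ 2) k * qp (1 * (q ^ 2) ^ (N + 1 + 1)) (q ^ 2) k /
        (qp (q ^ 2) (q ^ 2) k * qp (q ^ 3) (q ^ 2) k *
          (qp (q ^ 3) (q ^ 2) k * qp (q ^ 4) (q ^ 2) k)) * (q ^ 2) ^ k *
          (qp (q ^ 2 * x) (q ^ 2) k * qp (q ^ 2 / x) (q ^ 2) k) := fun N x hx =>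
    (rogers_eq_series_sq_sq hq N hx).2.trans (by simp only [hη, add_assoc, Nat.reduceAdd])
  have key := pairProd_mul_P_eq_series (δ := 1) (u := fun x => 1 - x) hq
    (hq.pow two_ne_zero.bot_lt) hη0
    one_ne_zero
    (fun j hj => by rw [one_mul, ← pow_mul]; exact hq.one_sub_pow_ne (by omega)) hf e m
    (prefactor_sq (η := η) hq (Or.inr rfl) prefactor_evenD) hx
  rw [key, hN, MultiSeries.value]
  congr 1
  · simp only [evenD, hγ, hm, hβ, hn, prod_mul_distrib, hN]
    rw [Fin.prod_univ_eq_prod_range (fun i => qp (q ^ (2 * e + 1 + 1 + i)) q (m + 1))]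
    generalize qpInt _ _ _ = z
    generalize 1 - q = u
    generalize 1 - q ^ 2 = v
    ring
  · exact sum_congr rfl fun k _ => by simp only [evenD, schlosserSummand_eq, hα, hγ']

end

/-! ### Orders of vanishing at `q = 1` -/

section

open Filter Topology

/-- `f` vanishes at `1` to the order `d` at least: `f q / (q - 1)^d` has a limit. -/
def OrderGE (f : ℂ → ℂ) (d : ℤ) : Prop :=
  ∃ L, Tendsto (fun q => f q * (q - 1) ^ (-d)) (𝓝[≠] 1) (𝓝 L)

/-- `f` vanishes at `1` to the order `d` exactly: `f q / (q - 1)^d` has a non-zero limit. -/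
def OrderEq (f : ℂ → ℂ) (d : ℤ) : Prop :=
  ∃ L, L ≠ 0 ∧ Tendsto (fun q => f q * (q - 1) ^ (-d)) (𝓝[≠] 1) (𝓝 L)

/-- `u` has the value `1` and the derivative `c` at `1`. -/
def UnitAtOne (u : ℂ → ℂ) (c : ℂ) : Prop := u 1 = 1 ∧ HasDerivAt u c 1

variable {f g u v b : ℂ → ℂ} {d d' : ℤ} {c c' : ℂ}

theorem eventually_sub_one_ne_zero : ∀ᶠ q : ℂ in 𝓝[≠] 1, q - 1 ≠ 0 :=
  eventually_mem_nhdsWithin.mono fun _ h => sub_ne_zero.mpr h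

theorem OrderEq.ge (h : OrderEq f d) : OrderGE f d := let ⟨L, _, hL⟩ := h; ⟨L, hL⟩

theorem tendsto_mul_order {L L' : ℂ}
    (hf : Tendsto (fun q => f q * (q - 1) ^ (-d)) (𝓝[≠] 1) (𝓝 L))
    (hg : Tendsto (fun q => g q * (q - 1) ^ (-d')) (𝓝[≠] 1) (𝓝 L')) :
    Tendsto (fun q => f q * g q * (q - 1) ^ (-(d + d'))) (𝓝[≠] 1) (𝓝 (L * L')) := by
  refine (hf.mul hg).congr' (eventually_sub_one_ne_zero.mono fun q hq => ?_)
  dsimp only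
  rw [neg_add, zpow_add₀ hq]
  ring

theorem OrderGE.mul (hf : OrderGE f d) (hg : OrderGE g d') :
    OrderGE (fun q => f q * g q) (d + d') :=
  let ⟨_, hL⟩ := hf; let ⟨_, hL'⟩ := hg; ⟨_, tendsto_mul_order hL hL'⟩

theorem OrderEq.mul (hf : OrderEq f d) (hg : OrderEq g d') :
    OrderEq (fun q => f q * g q) (d + d') :=
  let ⟨_, h, hL⟩ := hf; let ⟨_, h', hL'⟩ := hg; ⟨_, mul_ne_zero h h', tendsto_mul_order hL hL'⟩

theorem OrderEq.inv (hf : OrderEq f d) : OrderEq (fun q => (f q)⁻¹) (-d) := by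
  obtain ⟨L, h, hL⟩ := hf
  refine ⟨L⁻¹, inv_ne_zero h, (hL.inv₀ h).congr fun q => ?_⟩
  rw [mul_inv, zpow_neg, zpow_neg, zpow_neg, inv_inv]

theorem OrderGE.div (hf : OrderGE f d) (hg : OrderEq g d') :
    OrderGE (fun q => f q / g q) (d - d') := by
  simpa only [div_eq_mul_inv, sub_eq_add_neg] using hf.mul hg.inv.ge

theorem orderEq_of_continuousAt (hf : ContinuousAt f 1) (h : f 1 ≠ 0) : OrderEq f 0 :=
  ⟨f 1, h, by simpa using hf.tendsto.mono_left nhdsWithin_le_nhds⟩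

theorem OrderGE.prod {ι : Type*} {s : Finset ι} {f : ι → ℂ → ℂ} {d : ι → ℤ}
    (h : ∀ i ∈ s, OrderGE (f i) (d i)) : OrderGE (fun q => ∏ i ∈ s, f i q) (∑ i ∈ s, d i) := by
  classical
  induction s using Finset.induction_on with
  | empty => simpa using
      (orderEq_of_continuousAt (f := fun _ => 1) continuousAt_const one_ne_zero).ge
  | insert a s ha ih =>
    simp only [prod_insert ha, sum_insert ha]
    exact (h a (mem_insert_self a s)).mul (ih fun i hi => h i (mem_insert_of_mem hi))

theorem OrderEq.prod {ι : Type*} {s : Finset ι} {f : ι → ℂ → ℂ} {d : ι → ℤ}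
    (h : ∀ i ∈ s, OrderEq (f i) (d i)) : OrderEq (fun q => ∏ i ∈ s, f i q) (∑ i ∈ s, d i) := by
  classical
  induction s using Finset.induction_on with
  | empty => simpa using orderEq_of_continuousAt (f := fun _ => 1) continuousAt_const one_ne_zero
  | insert a s ha ih =>
    simp only [prod_insert ha, sum_insert ha]
    exact (h a (mem_insert_self a s)).mul (ih fun i hi => h i (mem_insert_of_mem hi))

theorem OrderEq.pow (h : OrderEq f d) (k : ℕ) : OrderEq (fun q => f q ^ k) (k * d) := by
  simpa using OrderEq.prod (s := range k) fun _ _ => h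

theorem OrderGE.pow (h : OrderGE f d) (k : ℕ) : OrderGE (fun q => f q ^ k) (k * d) := by
  simpa using OrderGE.prod (s := range k) fun _ _ => h

theorem OrderGE.congr (h : OrderGE f d) (hfg : ∀ q, f q = g q) : OrderGE g d := funext hfg ▸ h

theorem OrderGE.of_eq (h : OrderGE f d) (hd : d = d') : OrderGE f d' := hd ▸ h

theorem OrderEq.of_eq (h : OrderEq f d) (hd : d = d') : OrderEq f d' := hd ▸ h

namespace UnitAtOne

theorem id : UnitAtOne (fun q => q) 1 := ⟨rfl, hasDerivAt_id 1⟩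

theorem mul (hu : UnitAtOne u c) (hv : UnitAtOne v c') :
    UnitAtOne (fun q => u q * v q) (c + c') :=
  ⟨by simp [hu.1, hv.1], (hu.2.mul hv.2).congr_deriv (by simp [hu.1, hv.1])⟩

theorem inv (hu : UnitAtOne u c) : UnitAtOne (fun q => (u q)⁻¹) (-c) :=
  ⟨by simp [hu.1], (hu.2.inv (by rw [hu.1]; exact one_ne_zero)).congr_deriv (by simp [hu.1])⟩

theorem div (hu : UnitAtOne u c) (hv : UnitAtOne v c') :
    UnitAtOne (fun q => u q / v q) (c - c') := by
  simpa only [div_eq_mul_inv, sub_eq_add_neg] using hu.mul hv.inv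

theorem pow (hu : UnitAtOne u c) (k : ℕ) : UnitAtOne (fun q => u q ^ k) (k * c) :=
  ⟨by simp [hu.1], (hu.2.pow k).congr_deriv (by simp [hu.1])⟩

theorem zpow (hu : UnitAtOne u c) (z : ℤ) : UnitAtOne (fun q => u q ^ z) (z * c) := by
  obtain ⟨k, rfl | rfl⟩ := z.eq_nat_or_neg
  · simpa using hu.pow k
  · simpa using (hu.pow k).inv

theorem cpow (l : ℂ) : UnitAtOne (fun q => q ^ l) l :=
  ⟨Complex.one_cpow l, by
    simpa using (hasDerivAt_id (1 : ℂ)).cpow_const (c := l) (by simp)⟩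

theorem orderEq (hu : UnitAtOne u c) : OrderEq u 0 :=
  orderEq_of_continuousAt hu.2.continuousAt (by rw [hu.1]; exact one_ne_zero)

theorem tendsto_sub (hu : UnitAtOne u c) (hv : UnitAtOne v c') :
    Tendsto (fun q => (u q - v q) * (q - 1) ^ (-1 : ℤ)) (𝓝[≠] 1) (𝓝 (c - c')) := by
  refine ((hasDerivAt_iff_tendsto_slope.mp (hu.2.sub hv.2))).congr fun q => ?_
  simp only [slope, Pi.sub_apply, hu.1, hv.1, sub_self, vsub_eq_sub, sub_zero, smul_eq_mul,
    zpow_neg_one, mul_comm]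

theorem sub_ge (hu : UnitAtOne u c) (hv : UnitAtOne v c') : OrderGE (fun q => u q - v q) 1 :=
  ⟨_, hu.tendsto_sub hv⟩

theorem one : UnitAtOne (fun _ => 1) 0 := ⟨rfl, hasDerivAt_const _ _⟩

theorem one_sub_ge (hu : UnitAtOne u c) : OrderGE (fun q => 1 - u q) 1 := one.sub_ge hu

theorem one_sub_eq (hu : UnitAtOne u c) (hc : c ≠ 0) : OrderEq (fun q => 1 - u q) 1 :=
  ⟨0 - c, by simpa using hc, one.tendsto_sub hu⟩

theorem qp_ge (hu : UnitAtOne u c) (hb : UnitAtOne b c') (k : ℕ) :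
    OrderGE (fun q => qp (u q) (b q) k) k := by
  simpa [qp] using OrderGE.prod (s := range k) fun j _ => (hu.mul (hb.pow j)).one_sub_ge

theorem qp_eq (hu : UnitAtOne u c) (hb : UnitAtOne b c') {k : ℕ}
    (h : ∀ j < k, c + j * c' ≠ 0) : OrderEq (fun q => qp (u q) (b q) k) k := by
  simpa [qp] using OrderEq.prod (s := range k) fun j hj =>
    (hu.mul (hb.pow j)).one_sub_eq (h j (mem_range.mp hj))

theorem qp_neg (hu : UnitAtOne u c) (hb : UnitAtOne b c') (k : ℕ) :
    OrderEq (fun q => qp (-u q) (b q) k) 0 := by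
  have h : ∀ j ∈ range k, OrderEq (fun q => 1 - -u q * b q ^ j) 0 := fun j _ => by
    have hj := hu.mul (hb.pow j)
    simp only [neg_mul, sub_neg_eq_add]
    exact orderEq_of_continuousAt (continuousAt_const.add hj.2.continuousAt) (by
      simp [hu.1, hb.1, one_add_one_eq_two])
  simpa [qp] using OrderEq.prod h

theorem qpInt_eq (hu : UnitAtOne u c) (hb : UnitAtOne b c') {k : ℤ}
    (h : ∀ j : ℕ, (j : ℤ) < k → c + j * c' ≠ 0)
    (h' : ∀ j : ℕ, (j : ℤ) < -k → c + (-((j : ℤ) + 1) : ℤ) * c' ≠ 0) :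
    OrderEq (fun q => qpInt (u q) (b q) k) k := by
  by_cases hk : 0 ≤ k
  · simp only [qpInt, if_pos hk]
    exact (hu.qp_eq hb fun j hj => h j (by omega)).of_eq (by omega)
  · simp only [qpInt, if_neg hk]
    have := (OrderEq.prod (s := range (-k).toNat) fun j hj =>
      (hu.mul (hb.zpow (-((j : ℤ) + 1)))).one_sub_eq (h' j (by simp at hj; omega))).inv
    exact this.of_eq (by simp; omega)

end UnitAtOne

theorem OrderGE.pairProd {m : ℕ} {f : ℂ → Fin m → Fin m → ℂ}
    (h : ∀ i j, i < j → OrderGE (fun q => f q i j) 0) : OrderGE (fun q => pairProd (f q)) 0 := by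
  have := OrderGE.prod (s := univ) fun i _ => OrderGE.prod (s := Ioi i) fun j hj =>
    h i j (mem_Ioi.mp hj)
  simpa [SchurQ.pairProd] using this

/-- A summand divided by the product of the `1 - q^{l i + l j}` has a limit at `1`: the shifted
factorials in numerator and denominator vanish to the same order, and each factor `b^{k j} - b^{k
i}` vanishes at least to the order one of `1 - q^{l i + l j}`. -/
theorem orderGE_summand {m : ℕ} {l : Fin m → ℂ} (hl : ∀ i j, i < j → l i + l j ≠ 0)
    (hb : UnitAtOne b c) {num : ℂ → Fin m → List ℂ} {den : ℂ → List ℂ} {D : ℤ}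
    (hnum : ∀ i k, OrderGE (fun q => qps (num q i) (b q) k) (D * k))
    (hden : ∀ k, OrderEq (fun q => qps (den q) (b q) k) (D * k)) (k : Fin m → ℕ) :
    OrderGE (fun q => schlosserSummand (b q) (num q) (den q) k /
      pairProd (fun i j => 1 - q ^ l i * q ^ l j)) 0 := by
  have h1 : OrderGE (fun q => pairProd fun i j => (b q ^ k j - b q ^ k i) /
      (1 - q ^ l i * q ^ l j)) 0 := by
    refine OrderGE.pairProd fun i j hij => ?_
    have h3 : OrderGE (fun q => b q ^ k j - b q ^ k i) 1 := (hb.pow (k j)).sub_ge (hb.pow (k i))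
    have h4 : OrderEq (fun q => 1 - q ^ l i * q ^ l j) 1 :=
      ((UnitAtOne.cpow (l i)).mul (UnitAtOne.cpow (l j))).one_sub_eq (hl i j hij)
    have h5 := h3.div h4
    rwa [sub_self] at h5
  have h2 : OrderGE (fun q => ∏ i, qps (num q i) (b q) (k i) / qps (den q) (b q) (k i) *
      b q ^ k i) (∑ _ : Fin m, 0) := OrderGE.prod fun i _ => by
    have h3 := ((hnum i (k i)).div (hden (k i))).mul (hb.pow (k i)).orderEq.ge
    rwa [sub_self, add_zero] at h3
  have h3 := h1.mul h2
  rw [sum_const_zero, add_zero] at h3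
  refine h3.congr fun q => ?_
  simp only [schlosserSummand, pairProd, prod_div_distrib]
  ring

theorem regularAtOne_of_order {m N : ℕ} {l : Fin m → ℂ} {E : ℂ → ℂ → (Fin m → ℂ) → MultiSeries m}
    (h₁ : OrderGE (fun q => (E q (q ^ (1 / 2 : ℂ)) (fun i => q ^ l i)).prefactor) 0)
    (h₂ : ∀ k, OrderGE (fun q => (E q (q ^ (1 / 2 : ℂ)) (fun i => q ^ l i)).summand k /
      pairProd (fun i j => 1 - q ^ l i * q ^ l j)) 0) : RegularAtOne l N E := fun k _ => by
  obtain ⟨L, hL⟩ := h₁.mul (h₂ k)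
  exact ⟨L, by simpa [mul_div_assoc] using hL⟩

end

/-! ### Regularity of the eight series at `q = 1` -/

section

variable {u v w u' x b : ℂ → ℂ} {c₁ c₂ c₃ c₄ c' : ℂ}

theorem UnitAtOne.qp_eq_of_pos (hu : UnitAtOne u c₁) (hb : UnitAtOne b c') (h : 0 < c₁.re)
    (h' : 0 ≤ c'.re) (k : ℕ) : OrderEq (fun q => qp (u q) (b q) k) k :=
  hu.qp_eq hb fun j _ h0 => by
    have h1 := congrArg Complex.re h0
    have h2 : 0 ≤ (j : ℝ) * c'.re := by positivity
    simp at h1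
    linarith

theorem orderGE_num_neg (hu : UnitAtOne u c₁) (hv : UnitAtOne v c₂) (hw : UnitAtOne w c₃)
    (hx : UnitAtOne x c₄) (hb : UnitAtOne b c') (k : ℕ) :
    OrderGE (fun q => qps [u q, -v q, w q * x q, w q / x q] (b q) k) (3 * k) := by
  simp only [qps_four]
  exact (((hu.qp_ge hb k).mul (hv.qp_neg hb k).ge).mul
    (((hw.mul hx).qp_ge hb k).mul ((hw.div hx).qp_ge hb k))).of_eq (by ring)

theorem orderGE_num (hu : UnitAtOne u c₁) (hv : UnitAtOne v c₂) (hw : UnitAtOne w c₃)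
    (hx : UnitAtOne x c₄) (hb : UnitAtOne b c') (k : ℕ) :
    OrderGE (fun q => qps [u q, v q, w q * x q, w q / x q] (b q) k) (4 * k) := by
  simp only [qps_four]
  exact (((hu.qp_ge hb k).mul (hv.qp_ge hb k)).mul
    (((hw.mul hx).qp_ge hb k).mul ((hw.div hx).qp_ge hb k))).of_eq (by ring)

theorem orderEq_den_neg (hu : UnitAtOne u c₁) (hv : UnitAtOne v c₂) (hw : UnitAtOne w c₃)
    (hu' : UnitAtOne u' c₄) (hb : UnitAtOne b c') (h₁ : 0 < c₁.re) (h₂ : 0 < c₂.re) (h₃ : 0 < c₃.re)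
    (h' : 0 ≤ c'.re) (k : ℕ) :
    OrderEq (fun q => qps [u q, v q, w q, -u' q] (b q) k) (3 * k) := by
  simp only [qps_four]
  exact (((hu.qp_eq_of_pos hb h₁ h' k).mul (hv.qp_eq_of_pos hb h₂ h' k)).mul
    ((hw.qp_eq_of_pos hb h₃ h' k).mul (hu'.qp_neg hb k))).of_eq (by ring)

theorem orderEq_den (hu : UnitAtOne u c₁) (hv : UnitAtOne v c₂) (hw : UnitAtOne w c₃)
    (hu' : UnitAtOne u' c₄) (hb : UnitAtOne b c') (h₁ : 0 < c₁.re) (h₂ : 0 < c₂.re) (h₃ : 0 < c₃.re)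
    (h₄ : 0 < c₄.re) (h' : 0 ≤ c'.re) (k : ℕ) :
    OrderEq (fun q => qps [u q, v q, w q, u' q] (b q) k) (4 * k) := by
  simp only [qps_four]
  exact (((hu.qp_eq_of_pos hb h₁ h' k).mul (hv.qp_eq_of_pos hb h₂ h' k)).mul
    ((hw.qp_eq_of_pos hb h₃ h' k).mul (hu'.qp_eq_of_pos hb h₄ h' k))).of_eq (by ring)

end

section

variable {m : ℕ} {l : Fin (m + 1) → ℂ}

theorem unitAtOne_half : UnitAtOne (fun q => q ^ (1 / 2 : ℂ)) (1 / 2) := .cpow _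

theorem orderEq_one_sub : OrderEq (fun q => 1 - q) 1 := UnitAtOne.id.one_sub_eq one_ne_zero

theorem orderGE_cpow_pow (l : ℂ) (N : ℕ) : OrderGE (fun q => (q ^ l) ^ N) 0 :=
  ((UnitAtOne.cpow l).pow N).orderEq.ge

theorem orderGE_one_sub_cpow_mul (l : ℂ) (N : ℕ) :
    OrderGE (fun q => (1 - q ^ l) * (q ^ l) ^ N) 1 :=
  ((UnitAtOne.cpow l).one_sub_ge.mul (orderGE_cpow_pow l N)).of_eq (add_zero 1)

theorem orderGE_prod_one_sub_cpow_mul (l : Fin m → ℂ) (N : ℕ) :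
    OrderGE (fun q => ∏ i, (1 - q ^ l i) * (q ^ l i) ^ N) m :=
  (OrderGE.prod fun i _ => orderGE_one_sub_cpow_mul (l i) N).of_eq (by simp)

theorem orderGE_qp_zpow (z : ℤ) (k : ℕ) : OrderGE (fun q => qp (q ^ z) q k) k :=
  (UnitAtOne.id.zpow z).qp_ge UnitAtOne.id k

theorem sum_two_mul_fin (m : ℕ) : ∑ i : Fin (m + 1), 2 * ((i : ℕ) : ℤ) = m * (m + 1) := by
  induction m with
  | zero => simp
  | succ m ih =>
    rw [Fin.sum_univ_castSucc]
    simp only [Fin.val_castSucc, ih, Fin.val_last]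
    push_cast
    ring

/-- The condition `h` says that no factor of `(q^{z/2}; q)_i` is identically zero, so that each
vanishes to the order one exactly; the factors of `(-q^{z'/2}; q)_i` do not vanish at `1`. -/
theorem orderEq_qps_two {z z' : ℤ} {i : ℕ} (h : ∀ j < i, z + 2 * (j : ℤ) ≠ 0) :
    OrderEq (fun q => qps [(q ^ (1 / 2 : ℂ)) ^ z, -(q ^ (1 / 2 : ℂ)) ^ z'] q i) i := by
  simp only [qps_two]
  have h1 : OrderEq (fun q => qp ((q ^ (1 / 2 : ℂ)) ^ z) q i) i :=
    (unitAtOne_half.zpow z).qp_eq UnitAtOne.id fun j hj h0 => h j hj (by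
      have : (z : ℂ) + 2 * j = 0 := by linear_combination 2 * h0
      exact_mod_cast this)
  exact (h1.mul ((unitAtOne_half.zpow z').qp_neg UnitAtOne.id i)).of_eq (by ring)

/-- For the index `-1` the only factor is `(1 - q^{z-2})⁻¹`, whence the condition `z ≠ 2`. -/
theorem orderEq_qpInt_zpow {z k : ℤ} (hk : -1 ≤ k) (h : 0 < z) (h' : z ≠ 2 ∨ 0 ≤ k) :
    OrderEq (fun q => qpInt (q ^ z) (q ^ 2) k) k := by
  refine (UnitAtOne.id.zpow z).qpInt_eq (UnitAtOne.id.pow 2) (fun j _ h0 => ?_) fun j hj h0 => ?_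
  · have : z + j * 2 = 0 := by
      push_cast at h0
      have : (z : ℂ) + j * 2 = 0 := by linear_combination h0
      exact_mod_cast this
    omega
  · obtain rfl : j = 0 := by omega
    have : z - 2 = 0 := by
      push_cast at h0
      have : (z : ℂ) - 2 = 0 := by linear_combination h0
      exact_mod_cast this
    omega

theorem regularAtOne_oddA (hl : ∀ i j, i < j → l i + l j ≠ 0) (e N : ℕ) :
    RegularAtOne l N fun q r x => oddA (2 * e + m) q r x := by
  refine regularAtOne_of_order ?_ ?_
  · have h1 : OrderGE (fun q : ℂ => (-1) ^ (m + 1).choose 2 *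
        (q ^ (1 / 2 : ℂ)) ^ (-((m + 1 + 1).choose 3 : ℤ) -
          ((2 * e + m : ℕ) : ℤ) * ((m + 1 + 1).choose 2 : ℤ)) / (1 - q) ^ (m + 1)) (-(m + 1)) :=
      (((orderEq_of_continuousAt continuousAt_const (pow_ne_zero _ (neg_ne_zero.mpr
        one_ne_zero))).ge.mul (unitAtOne_half.zpow _).orderEq.ge).div
        (orderEq_one_sub.pow (m + 1))).of_eq (by push_cast; ring)
    have h2 : ∀ i ∈ (univ : Finset (Fin (m + 1))), OrderGE (fun q : ℂ =>
        qp (q ^ (((2 * e + m : ℕ) : ℤ) + 1 - ((m + 1 : ℕ) : ℤ) + (i + 1))) q (i + 1) /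
        qps [(q ^ (1 / 2 : ℂ)) ^ (1 - ((2 * e + m : ℕ) : ℤ) - ((m + 1 : ℕ) : ℤ)),
          -(q ^ (1 / 2 : ℂ)) ^ (3 + ((2 * e + m : ℕ) : ℤ) - ((m + 1 : ℕ) : ℤ))] q i *
        (q ^ l i) ^ ((2 * e + m + (m + 1) - 1) / 2)) 1 := fun i _ =>
      (((orderGE_qp_zpow _ _).div (orderEq_qps_two fun j hj => by omega)).mul
        (orderGE_cpow_pow _ _)).of_eq (by push_cast; ring)
    exact (h1.mul (OrderGE.prod h2)).of_eq (by simp)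
  · exact orderGE_summand hl UnitAtOne.id
      (fun i => orderGE_num_neg (unitAtOne_half.zpow _) (unitAtOne_half.zpow _) UnitAtOne.id
        (UnitAtOne.cpow (l i)) UnitAtOne.id)
      (orderEq_den_neg UnitAtOne.id UnitAtOne.id (unitAtOne_half.pow 3) (unitAtOne_half.pow 3)
        UnitAtOne.id (by norm_num) (by norm_num) (by norm_num) (by norm_num))

theorem regularAtOne_evenA (hl : ∀ i j, i < j → l i + l j ≠ 0) (e N : ℕ) :
    RegularAtOne l N fun q r x => evenA (2 * e + 1 + m) q r x := by
  refine regularAtOne_of_order ?_ ?_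
  · have h1 : OrderGE (fun q : ℂ => (-1) ^ (m + 1).choose 2 *
        (q ^ (1 / 2 : ℂ)) ^ (-((m + 1 + 1).choose 3 : ℤ) -
          (((2 * e + 1 + m : ℕ) : ℤ) - 1) * ((m + 1 + 1).choose 2 : ℤ)) / (1 - q) ^ (2 * (m + 1)))
        (-(2 * (m + 1))) :=
      (((orderEq_of_continuousAt continuousAt_const (pow_ne_zero _ (neg_ne_zero.mpr
        one_ne_zero))).ge.mul (unitAtOne_half.zpow _).orderEq.ge).div
        (orderEq_one_sub.pow (2 * (m + 1)))).of_eq (by push_cast; ring)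
    have h2 : ∀ i ∈ (univ : Finset (Fin (m + 1))), OrderGE (fun q : ℂ =>
        qp (q ^ (((2 * e + 1 + m : ℕ) : ℤ) + 1 - ((m + 1 : ℕ) : ℤ) + (i + 1))) q (i + 1) /
        qps [(q ^ (1 / 2 : ℂ)) ^ (2 - ((2 * e + 1 + m : ℕ) : ℤ) - ((m + 1 : ℕ) : ℤ)),
          -(q ^ (1 / 2 : ℂ)) ^ (4 + ((2 * e + 1 + m : ℕ) : ℤ) - ((m + 1 : ℕ) : ℤ))] q i) 1 :=
            fun i _ =>
      ((orderGE_qp_zpow _ _).div (orderEq_qps_two fun j hj => by omega)).of_eq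
        (by push_cast; ring)
    exact ((h1.mul (OrderGE.prod h2)).mul (orderGE_prod_one_sub_cpow_mul l _)).of_eq
      (by simp; ring)
  · exact orderGE_summand hl UnitAtOne.id
      (fun i => orderGE_num_neg (unitAtOne_half.zpow _) (unitAtOne_half.zpow _) UnitAtOne.id
        (UnitAtOne.cpow (l i)) UnitAtOne.id)
      (orderEq_den_neg UnitAtOne.id (UnitAtOne.id.pow 2) (unitAtOne_half.pow 3)
        (unitAtOne_half.pow 3)
        UnitAtOne.id (by norm_num) (by norm_num) (by norm_num) (by norm_num))

theorem regularAtOne_oddB (hl : ∀ i j, i < j → l i + l j ≠ 0) (e N : ℕ) :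
    RegularAtOne l N fun q r x => oddB (2 * e + m) q r x := by
  refine regularAtOne_of_order ?_ ?_
  · have he : (2 * e + m + 1 - (m + 1)) / 2 = e := by omega
    have hN : (2 * e + m + (m + 1) - 1) / 2 = e + m := by omega
    have hi : ∀ i, (2 * e + m + (m + 1) + 1 - 2 * (i + 1)) / 2 = e + m - i := fun i => by omega
    simp only [oddB, he, hN, hi]
    have h1 : OrderGE (fun q : ℂ =>
        (q ^ (1 / 2 : ℂ)) ^ (-(((2 * e + m : ℕ) : ℤ) * ((m + 1 : ℕ) : ℤ) / 2)) *
          qp (-q) q e ^ (m + 1) / qp q q (e + m) ^ (m + 1)) (-((m + 1) * (e + m))) :=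
      (((unitAtOne_half.zpow _).orderEq.ge.mul
        ((UnitAtOne.id.qp_neg UnitAtOne.id e).pow (m + 1)).ge).div
        ((UnitAtOne.id.qp_eq_of_pos UnitAtOne.id (by norm_num) (by norm_num) (e + m)).pow
          (m + 1))).of_eq (by push_cast; ring)
    have h2 : ∀ i ∈ (univ : Finset (Fin (m + 1))), OrderGE (fun q : ℂ =>
        qp (q ^ (((2 * e + m : ℕ) : ℤ) + 1 - ((m + 1 : ℕ) : ℤ) + (i + 1))) q i *
        qp ((q ^ (1 / 2 : ℂ)) ^ 3) q (e + m - i) / qp (-q ^ (1 / 2 : ℂ)) q (e + m - i) *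
        (q ^ l i) ^ (e + m)) (e + m) := fun i _ =>
      ((((orderGE_qp_zpow _ _).mul ((unitAtOne_half.pow 3).qp_ge UnitAtOne.id _)).div
        (unitAtOne_half.qp_neg UnitAtOne.id _)).mul (orderGE_cpow_pow _ _)).of_eq
        (by have := i.isLt; omega)
    exact (h1.mul (OrderGE.prod h2)).of_eq (by simp)
  · exact orderGE_summand hl UnitAtOne.id
      (fun i => orderGE_num_neg (unitAtOne_half.zpow _) (unitAtOne_half.zpow _) unitAtOne_half
        (UnitAtOne.cpow (l i)) UnitAtOne.id)
      (orderEq_den_neg UnitAtOne.id unitAtOne_half (unitAtOne_half.pow 3) UnitAtOne.id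
        UnitAtOne.id (by norm_num) (by norm_num) (by norm_num) (by norm_num))

theorem regularAtOne_evenB (hl : ∀ i j, i < j → l i + l j ≠ 0) (e N : ℕ) :
    RegularAtOne l N fun q r x => evenB (2 * e + 1 + m) q r x := by
  refine regularAtOne_of_order ?_ ?_
  · have he : (2 * e + 1 + m + 2 - (m + 1)) / 2 = e + 1 := by omega
    have hN : (2 * e + 1 + m + (m + 1) - 2) / 2 = e + m := by omega
    have hi : ∀ i, (2 * e + 1 + m + (m + 1) - 2 * (i + 1)) / 2 = e + m - i := fun i => by omega
    simp only [evenB, he, hN, hi]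
    have h1 : OrderGE (fun q : ℂ =>
        (q ^ (1 / 2 : ℂ)) ^ (-((((2 * e + 1 + m : ℕ) : ℤ) - 1) * ((m + 1 : ℕ) : ℤ) / 2)) *
          qp (-q) q (e + 1) ^ (m + 1) / ((1 - q) ^ (m + 1) * qp q q (e + m) ^ (m + 1)))
        (-((m + 1) * (e + m + 1))) :=
      (((unitAtOne_half.zpow _).orderEq.ge.mul
        ((UnitAtOne.id.qp_neg UnitAtOne.id (e + 1)).pow (m + 1)).ge).div
        ((orderEq_one_sub.pow (m + 1)).mul ((UnitAtOne.id.qp_eq_of_pos UnitAtOne.id (by norm_num)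
          (by norm_num) (e + m)).pow (m + 1)))).of_eq (by push_cast; ring)
    have h2 : ∀ i ∈ (univ : Finset (Fin (m + 1))), OrderGE (fun q : ℂ =>
        qp (q ^ (((2 * e + 1 + m : ℕ) : ℤ) + 1 - ((m + 1 : ℕ) : ℤ) + (i + 1))) q i *
        qp ((q ^ (1 / 2 : ℂ)) ^ 3) q (e + m - i) / qp (-(q ^ (1 / 2 : ℂ)) ^ 3) q (e + m - i))
            (e + m) :=
          fun i _ =>
      (((orderGE_qp_zpow _ _).mul ((unitAtOne_half.pow 3).qp_ge UnitAtOne.id _)).div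
        ((unitAtOne_half.pow 3).qp_neg UnitAtOne.id _)).of_eq (by have := i.isLt; omega)
    exact ((h1.mul (OrderGE.prod h2)).mul (orderGE_prod_one_sub_cpow_mul l _)).of_eq
      (by simp; ring)
  · exact orderGE_summand hl UnitAtOne.id
      (fun i => orderGE_num_neg (unitAtOne_half.zpow _) (unitAtOne_half.zpow _) unitAtOne_half
        (UnitAtOne.cpow (l i)) UnitAtOne.id)
      (orderEq_den_neg UnitAtOne.id (unitAtOne_half.pow 3) (unitAtOne_half.pow 3) UnitAtOne.id
        UnitAtOne.id (by norm_num) (by norm_num) (by norm_num) (by norm_num))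

theorem regularAtOne_oddC (hl : ∀ i j, i < j → l i + l j ≠ 0) (e N : ℕ) :
    RegularAtOne l N fun q r x => oddC (2 * e + m) q r x := by
  refine regularAtOne_of_order ?_ ?_
  · have h1 : OrderGE (fun q : ℂ =>
        (q ^ (1 / 2 : ℂ)) ^ (-(((2 * e + m : ℕ) : ℤ) * ((m + 1 : ℕ) : ℤ))) /
          ((1 - q) ^ (m + 1) *
            qpInt (q ^ (3 + ((2 * e + m : ℕ) : ℤ) - ((m + 1 : ℕ) : ℤ))) (q ^ 2)
              (((m + 1 : ℕ) : ℤ) - 1) ^ (m + 1)))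
              (-((m + 1) * (m + 1))) :=
      ((unitAtOne_half.zpow _).orderEq.ge.div ((orderEq_one_sub.pow (m + 1)).mul
        ((orderEq_qpInt_zpow (by omega) (by omega) (by omega)).pow (m + 1)))).of_eq (by
          push_cast; ring)
    have h2 : ∀ i ∈ (univ : Finset (Fin (m + 1))), OrderGE (fun q : ℂ =>
        qp (q ^ (((2 * e + m : ℕ) : ℤ) + 1 - ((m + 1 : ℕ) : ℤ) + (i + 1))) q (m + 1) *
          (q ^ l i) ^ ((2 * e + m + (m + 1) - 1) / 2)) (m + 1) := fun i _ =>
      ((orderGE_qp_zpow _ _).mul (orderGE_cpow_pow _ _)).of_eq (by push_cast; ring)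
    exact (h1.mul (OrderGE.prod h2)).of_eq (by simp)
  · exact orderGE_summand hl (UnitAtOne.id.pow 2)
      (fun i => orderGE_num (UnitAtOne.id.zpow _) (UnitAtOne.id.zpow _) UnitAtOne.id
        (UnitAtOne.cpow (l i)) (UnitAtOne.id.pow 2))
      (orderEq_den UnitAtOne.id (UnitAtOne.id.pow 2) (UnitAtOne.id.pow 2) (UnitAtOne.id.pow 3)
        (UnitAtOne.id.pow 2) (by norm_num) (by norm_num) (by norm_num) (by norm_num) (by norm_num))

theorem regularAtOne_evenC (hl : ∀ i j, i < j → l i + l j ≠ 0) (e N : ℕ) :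
    RegularAtOne l N fun q r x => evenC (2 * e + 1 + m) q r x := by
  refine regularAtOne_of_order ?_ ?_
  · have h1 : OrderGE (fun q : ℂ =>
        (q ^ (1 / 2 : ℂ)) ^ (-((((2 * e + 1 + m : ℕ) : ℤ) - 1) * ((m + 1 : ℕ) : ℤ))) /
          ((1 - q) ^ (2 * (m + 1)) *
            qpInt (q ^ (4 + ((2 * e + 1 + m : ℕ) : ℤ) - ((m + 1 : ℕ) : ℤ))) (q ^ 2)
              (((m + 1 : ℕ) : ℤ) - 2) ^ (m + 1)))
              (-((m + 1) * (m + 1))) :=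
      ((unitAtOne_half.zpow _).orderEq.ge.div ((orderEq_one_sub.pow (2 * (m + 1))).mul
        ((orderEq_qpInt_zpow (by omega) (by omega) (by omega)).pow (m + 1)))).of_eq (by
          push_cast; ring)
    have h2 : ∀ i ∈ (univ : Finset (Fin (m + 1))), OrderGE (fun q : ℂ =>
        qp (q ^ (((2 * e + 1 + m : ℕ) : ℤ) + 1 - ((m + 1 : ℕ) : ℤ) + (i + 1))) q i ^ 2) (2 * i) :=
          fun i _ =>
      ((orderGE_qp_zpow _ _).pow 2).of_eq (by push_cast; ring)
    exact ((h1.mul (OrderGE.prod h2)).mul (orderGE_prod_one_sub_cpow_mul l _)).of_eq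
      (by rw [sum_two_mul_fin]; push_cast; ring)
  · exact orderGE_summand hl (UnitAtOne.id.pow 2)
      (fun i => orderGE_num (UnitAtOne.id.zpow _) (UnitAtOne.id.zpow _) UnitAtOne.id
        (UnitAtOne.cpow (l i)) (UnitAtOne.id.pow 2))
      (orderEq_den (UnitAtOne.id.pow 2) (UnitAtOne.id.pow 2) (UnitAtOne.id.pow 3)
        (UnitAtOne.id.pow 3)
        (UnitAtOne.id.pow 2) (by norm_num) (by norm_num) (by norm_num) (by norm_num) (by norm_num))

theorem regularAtOne_oddD (hl : ∀ i j, i < j → l i + l j ≠ 0) (e N : ℕ) :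
    RegularAtOne l N fun q _ x => oddD (2 * e + m) q x := by
  refine regularAtOne_of_order ?_ ?_
  · have h1 : OrderGE (fun q : ℂ =>
        q ^ (-(((2 * e + m : ℕ) : ℤ) * ((m + 1 : ℕ) : ℤ))) /
          ((1 - q) ^ (2 * (m + 1)) *
            qpInt (q ^ (3 + ((2 * e + m : ℕ) : ℤ) - ((m + 1 : ℕ) : ℤ))) (q ^ 2)
              (((m + 1 : ℕ) : ℤ) - 1) ^ (m + 1)))
              (-((m + 1) * (m + 2))) :=
      ((UnitAtOne.id.zpow _).orderEq.ge.div ((orderEq_one_sub.pow (2 * (m + 1))).mul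
        ((orderEq_qpInt_zpow (by omega) (by omega) (by omega)).pow (m + 1)))).of_eq (by
          push_cast; ring)
    have h2 : ∀ i ∈ (univ : Finset (Fin (m + 1))), OrderGE (fun q : ℂ =>
        qp (q ^ (((2 * e + m : ℕ) : ℤ) + 1 - ((m + 1 : ℕ) : ℤ) + (i + 1))) q (i + 1) ^ 2 *
          (q ^ l i) ^ ((2 * e + m + (m + 1) - 1) / 2)) (2 * i + 2) := fun i _ =>
      (((orderGE_qp_zpow _ _).pow 2).mul (orderGE_cpow_pow _ _)).of_eq (by push_cast; ring)
    exact (h1.mul (OrderGE.prod h2)).of_eq (by rw [sum_add_distrib, sum_two_mul_fin]; simp; ring)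
  · exact orderGE_summand hl (UnitAtOne.id.pow 2)
      (fun i => orderGE_num (UnitAtOne.id.zpow _) (UnitAtOne.id.zpow _) (UnitAtOne.id.pow 2)
        (UnitAtOne.cpow (l i)) (UnitAtOne.id.pow 2))
      (orderEq_den (UnitAtOne.id.pow 2) (UnitAtOne.id.pow 2) (UnitAtOne.id.pow 3)
        (UnitAtOne.id.pow 3)
        (UnitAtOne.id.pow 2) (by norm_num) (by norm_num) (by norm_num) (by norm_num) (by norm_num))

theorem regularAtOne_evenD (hl : ∀ i j, i < j → l i + l j ≠ 0) (e N : ℕ) :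
    RegularAtOne l N fun q _ x => evenD (2 * e + 1 + m) q x := by
  refine regularAtOne_of_order ?_ ?_
  · have h1 : OrderGE (fun q : ℂ =>
        q ^ (-((((2 * e + 1 + m : ℕ) : ℤ) - 1) * ((m + 1 : ℕ) : ℤ))) /
          ((1 - q) ^ (2 * (m + 1)) * (1 - q ^ 2) ^ (m + 1) *
            qpInt (q ^ (4 + ((2 * e + 1 + m : ℕ) : ℤ) - ((m + 1 : ℕ) : ℤ))) (q ^ 2)
              (((m + 1 : ℕ) : ℤ) - 2) ^ (m + 1)))
              (-((m + 1) * (m + 2))) :=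
      ((UnitAtOne.id.zpow _).orderEq.ge.div (((orderEq_one_sub.pow (2 * (m + 1))).mul
        (((UnitAtOne.id.pow 2).one_sub_eq (by norm_num)).pow (m + 1))).mul
        ((orderEq_qpInt_zpow (by omega) (by omega) (by omega)).pow (m + 1)))).of_eq (by
          push_cast; ring)
    have h2 : ∀ i ∈ (univ : Finset (Fin (m + 1))), OrderGE (fun q : ℂ =>
        qp (q ^ (((2 * e + 1 + m : ℕ) : ℤ) + 1 - ((m + 1 : ℕ) : ℤ) + (i + 1))) q (m + 1)) (m + 1) :=
          fun i _ =>
      (orderGE_qp_zpow _ _).of_eq (by push_cast; ring)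
    exact ((h1.mul (OrderGE.prod h2)).mul (orderGE_prod_one_sub_cpow_mul l _)).of_eq
      (by simp; ring)
  · exact orderGE_summand hl (UnitAtOne.id.pow 2)
      (fun i => orderGE_num (UnitAtOne.id.zpow _) (UnitAtOne.id.zpow _) (UnitAtOne.id.pow 2)
        (UnitAtOne.cpow (l i)) (UnitAtOne.id.pow 2))
      (orderEq_den (UnitAtOne.id.pow 2) (UnitAtOne.id.pow 3)
        (UnitAtOne.id.pow 3)
        (UnitAtOne.id.pow 4)
        (UnitAtOne.id.pow 2) (by norm_num) (by norm_num) (by norm_num) (by norm_num) (by norm_num))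

end

/-! ### The case of no variables -/

theorem pairProd_zero (f : Fin 0 → Fin 0 → ℂ) : pairProd f = 1 := by simp [pairProd]

theorem value_of_no_variables (n N : ℕ) (q r : ℂ) (x : Fin 0 → ℂ) :
    (oddA n q r x).value N = 1 ∧ (oddB n q r x).value N = 1 ∧ (oddC n q r x).value N = 1 ∧
      (oddD n q x).value N = 1 ∧ (evenA n q r x).value N = 1 ∧ (evenB n q r x).value N = 1 ∧
      (evenC n q r x).value N = 1 ∧ (evenD n q x).value N = 1 := by
  simp [MultiSeries.value, schlosserSummand, pairProd_zero, oddA, oddB, oddC, oddD, evenA, evenB,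
    evenC, evenD, Nat.choose]

theorem regularAtOne_of_mul_eq_one {l : Fin 0 → ℂ} {N : ℕ}
    {E : ℂ → ℂ → (Fin 0 → ℂ) → MultiSeries 0}
    (h : ∀ q r x k, (E q r x).prefactor * (E q r x).summand k = 1) : RegularAtOne l N E :=
  fun k _ => ⟨1, by simp only [h, pairProd_zero, div_one]; exact tendsto_const_nhds⟩

theorem regularAtOne_of_no_variables (n N : ℕ) (l : Fin 0 → ℂ) :
    RegularAtOne l N (fun q r x => oddA n q r x) ∧ RegularAtOne l N (fun q r x => oddB n q r x) ∧
      RegularAtOne l N (fun q r x => oddC n q r x) ∧ RegularAtOne l N (fun q _ x => oddD n q x) ∧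
      RegularAtOne l N (fun q r x => evenA n q r x) ∧
      RegularAtOne l N (fun q r x => evenB n q r x) ∧
      RegularAtOne l N (fun q r x => evenC n q r x) ∧
      RegularAtOne l N (fun q _ x => evenD n q x) := by
  refine ⟨?_, ?_, ?_, ?_, ?_, ?_, ?_, ?_⟩ <;>
  exact regularAtOne_of_mul_eq_one fun q r x k => by
    simp [schlosserSummand, pairProd_zero, oddA, oddB, oddC, oddD, evenA, evenB,
      evenC, evenD, Nat.choose]

end SchurQ

end

theorem mainTheorem7 (m n : ℕ) (hmn : m ≤ n + 1) :
    (∀ q r : ℂ, q ≠ 0 → (∀ k : ℕ, 1 ≤ k → q ^ k ≠ 1) → r ^ 2 = q →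
      ∀ x : Fin m → ℂ, (∀ i, x i ≠ 0) →
        (Odd (n + m) →
          SchurQ.pairProd (fun i j => 1 - x i * x j) * SchurQ.P n q x
              = (SchurQ.oddA n q r x).value ((n + m - 1) / 2) ∧
          SchurQ.pairProd (fun i j => 1 - x i * x j) * SchurQ.P n q x
              = (SchurQ.oddB n q r x).value ((n + m - 1) / 2) ∧
          SchurQ.pairProd (fun i j => 1 - x i * x j) * SchurQ.P n q x
              = (SchurQ.oddC n q r x).value ((n + m - 1) / 2) ∧
          SchurQ.pairProd (fun i j => 1 - x i * x j) * SchurQ.P n q x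
              = (SchurQ.oddD n q x).value ((n + m - 1) / 2)) ∧
        (Even (n + m) →
          SchurQ.pairProd (fun i j => 1 - x i * x j) * SchurQ.P n q x
              = (SchurQ.evenA n q r x).value ((n + m - 2) / 2) ∧
          SchurQ.pairProd (fun i j => 1 - x i * x j) * SchurQ.P n q x
              = (SchurQ.evenB n q r x).value ((n + m - 2) / 2) ∧
          SchurQ.pairProd (fun i j => 1 - x i * x j) * SchurQ.P n q x
              = (SchurQ.evenC n q r x).value ((n + m - 2) / 2) ∧
          SchurQ.pairProd (fun i j => 1 - x i * x j) * SchurQ.P n q x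
              = (SchurQ.evenD n q x).value ((n + m - 2) / 2))) ∧
    (∀ l : Fin m → ℂ, (∀ i j, i < j → l i + l j ≠ 0) →
        (Odd (n + m) →
          SchurQ.RegularAtOne l ((n + m - 1) / 2) (fun q r x => SchurQ.oddA n q r x) ∧
          SchurQ.RegularAtOne l ((n + m - 1) / 2) (fun q r x => SchurQ.oddB n q r x) ∧
          SchurQ.RegularAtOne l ((n + m - 1) / 2) (fun q r x => SchurQ.oddC n q r x) ∧
          SchurQ.RegularAtOne l ((n + m - 1) / 2) (fun q _ x => SchurQ.oddD n q x)) ∧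
        (Even (n + m) →
          SchurQ.RegularAtOne l ((n + m - 2) / 2) (fun q r x => SchurQ.evenA n q r x) ∧
          SchurQ.RegularAtOne l ((n + m - 2) / 2) (fun q r x => SchurQ.evenB n q r x) ∧
          SchurQ.RegularAtOne l ((n + m - 2) / 2) (fun q r x => SchurQ.evenC n q r x) ∧
          SchurQ.RegularAtOne l ((n + m - 2) / 2) (fun q _ x => SchurQ.evenD n q x))) := by
  rcases m with _ | m
  · refine ⟨fun q r _ _ _ x _ => ?_, fun l _ => ?_⟩
    · obtain ⟨h₁, h₂, h₃, h₄, h₅, h₆, h₇, h₈⟩ :=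
        SchurQ.value_of_no_variables n ((n + 0 - 1) / 2) q r x
      obtain ⟨_, _, _, _, g₅, g₆, g₇, g₈⟩ :=
        SchurQ.value_of_no_variables n ((n + 0 - 2) / 2) q r x
      simp only [SchurQ.pairProd_zero, SchurQ.P_zero, one_mul]
      exact ⟨fun _ => ⟨h₁.symm, h₂.symm, h₃.symm, h₄.symm⟩,
        fun _ => ⟨g₅.symm, g₆.symm, g₇.symm, g₈.symm⟩⟩
    · obtain ⟨h₁, h₂, h₃, h₄, -⟩ := SchurQ.regularAtOne_of_no_variables n ((n + 0 - 1) / 2) l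
      obtain ⟨-, -, -, -, h⟩ := SchurQ.regularAtOne_of_no_variables n ((n + 0 - 2) / 2) l
      exact ⟨fun _ => ⟨h₁, h₂, h₃, h₄⟩, fun _ => h⟩
  · refine ⟨fun q r hq₀ hq hrq x hx => ⟨fun hp => ?_, fun hp => ?_⟩,
      fun l hl => ⟨fun hp => ?_, fun hp => ?_⟩⟩
    · obtain ⟨e, rfl⟩ : ∃ e, n = 2 * e + m := ⟨(n - m) / 2, by grind⟩
      have hq : SchurQ.NotRootOfUnity q := ⟨hq₀, hq⟩
      have hr : SchurQ.NotRootOfUnity r := .of_pow (hrq ▸ hq) two_ne_zero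
      exact ⟨SchurQ.value_oddA hr hrq e hx, SchurQ.value_oddB hr hrq e hx,
        SchurQ.value_oddC hq hrq e hx, SchurQ.value_oddD hq e hx⟩
    · obtain ⟨e, rfl⟩ : ∃ e, n = 2 * e + 1 + m := ⟨(n - m) / 2, by grind⟩
      have hq : SchurQ.NotRootOfUnity q := ⟨hq₀, hq⟩
      have hr : SchurQ.NotRootOfUnity r := .of_pow (hrq ▸ hq) two_ne_zero
      exact ⟨SchurQ.value_evenA hr hrq e hx, SchurQ.value_evenB hr hrq e hx,
        SchurQ.value_evenC hq hrq e hx, SchurQ.value_evenD hq e hx⟩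
    · obtain ⟨e, rfl⟩ : ∃ e, n = 2 * e + m := ⟨(n - m) / 2, by grind⟩
      exact ⟨SchurQ.regularAtOne_oddA hl e _, SchurQ.regularAtOne_oddB hl e _,
        SchurQ.regularAtOne_oddC hl e _, SchurQ.regularAtOne_oddD hl e _⟩
    · obtain ⟨e, rfl⟩ : ∃ e, n = 2 * e + 1 + m := ⟨(n - m) / 2, by grind⟩
      exact ⟨SchurQ.regularAtOne_evenA hl e _, SchurQ.regularAtOne_evenB hl e _,
        SchurQ.regularAtOne_evenC hl e _, SchurQ.regularAtOne_evenD hl e _⟩
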